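/- Let $n\ge 1$ and let $b:\mathbb P^n\to\mathbb N$ be such that $(\mathbb P^n,b)$ is a Calabi–Yau orbifold. That is, there are a Calabi–Yau manifold $M$ (a compact connected complex manifold with trivial canonical bundle), a properly discontinuous group $G$ of holomorphic automorphisms of $M$, and an isomorphism $M/G\cong\mathbb P^n$ of complex analytic spaces, with induced map $\varphi:M\to\mathbb P^n$, such that $b(\varphi(q))$ is the order of the isotropy group $G_q$ for every $q\in M$. Let the locus $H=\{p\in\mathbb P^n : b(p)\neq 1\}$ be the hypersurface with distinct irreducible components $H_1,\dots,H_r$, let $d_i$ be the degree of $H_i$, and put $d=\sum_{i=1}^r d_i$. Then for each $i$ the function $b$ is constant on the nonempty set $H_i\setminus\operatorname{sing}(H)$; let $m_i$ (the weight of $H_i$) be its value there. One has $$n+2\le d\le 2n+2,$$ and if $d=2n+2$, then $m_1=m_2=\cdots=m_r=2$. -/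

import Mathlib

open scoped Manifold ContDiff

universe u

noncomputable section

namespace CYOrbifold

/-- Complex projective `n`-space: lines through the origin of `ℂ^(n+1)`. -/
abbrev PSpace (n : ℕ) : Type := Projectivization ℂ (Fin (n + 1) → ℂ)

/-- The point `[z₀ : … : zₙ]` with homogeneous coordinates `z ≠ 0`. -/
abbrev pt {n : ℕ} (z : Fin (n + 1) → ℂ) (hz : z ≠ 0) : PSpace n := Projectivization.mk ℂ z hz

/-- The quotient topology of `ℂ^(n+1) \ {0} → ℙⁿ`. -/
instance instTopologicalSpacePSpace (n : ℕ) : TopologicalSpace (PSpace n) :=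
  TopologicalSpace.coinduced
    (fun z : {z : Fin (n + 1) → ℂ // z ≠ 0} => pt z.1 z.2) inferInstance

/-- The cone over `V ⊆ ℙⁿ`, with the origin removed. -/
def cone {n : ℕ} (V : Set (PSpace n)) : Set (Fin (n + 1) → ℂ) :=
  {z | ∃ hz : z ≠ 0, pt z hz ∈ V}

open Classical in
/-- The pull-back of a function on `ℙⁿ` to `ℂ^(n+1) \ {0}` (extended by `0` to the origin, which
lies in no cone). -/
def coneLift {n : ℕ} (h : PSpace n → ℂ) (z : Fin (n + 1) → ℂ) : ℂ :=
  if hz : z ≠ 0 then h (pt z hz) else 0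

/-- The structure sheaf of the complex manifold `ℙⁿ = (ℂ^(n+1) \ {0}) / ℂˣ`: a function `h` is
holomorphic on the open set `V` if its pull-back is holomorphic on the cone over `V`. -/
def HolomorphicOn {n : ℕ} (h : PSpace n → ℂ) (V : Set (PSpace n)) : Prop :=
  DifferentiableOn ℂ (coneLift h) (cone V)

/-- `M` is a connected complex manifold of dimension `n`. -/
structure IsComplexManifold (n : ℕ) (M : Type*) [TopologicalSpace M]
    [ChartedSpace (Fin n → ℂ) M] : Prop where
  t2 : T2Space M
  secondCountable : SecondCountableTopology M
  connected : ConnectedSpace M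
  manifold : IsManifold 𝓘(ℂ, Fin n → ℂ) ω M

/-- A nowhere vanishing holomorphic `n`-form on `M`, that is, a holomorphic trivialization of the
canonical bundle: in each chart `e` of the atlas, with coordinates `z₁, …, zₙ`, the form is
`f e dz₁ ∧ ⋯ ∧ dzₙ` with `f e` holomorphic and nowhere zero, and on overlaps the coefficients differ
by the Jacobian determinant of the change of coordinates. -/
structure IsNowhereZeroTopForm (n : ℕ) (M : Type*) [TopologicalSpace M]
    [ChartedSpace (Fin n → ℂ) M]
    (f : OpenPartialHomeomorph M (Fin n → ℂ) → (Fin n → ℂ) → ℂ) : Prop where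
  holomorphic : ∀ e ∈ atlas (Fin n → ℂ) M, DifferentiableOn ℂ (f e) e.target
  ne_zero : ∀ e ∈ atlas (Fin n → ℂ) M, ∀ y ∈ e.target, f e y ≠ 0
  transform : ∀ e ∈ atlas (Fin n → ℂ) M, ∀ e' ∈ atlas (Fin n → ℂ) M,
    ∀ y ∈ (e.symm.trans e').source,
      f e y = (fderiv ℂ (e.symm.trans e') y).det * f e' (e.symm.trans e' y)

/-- A Calabi–Yau manifold: a compact connected complex manifold with trivial canonical bundle. -/
structure IsCalabiYauManifold (n : ℕ) (M : Type*) [TopologicalSpace M]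
    [ChartedSpace (Fin n → ℂ) M] : Prop where
  complexManifold : IsComplexManifold n M
  compact : CompactSpace M
  trivialCanonicalBundle : ∃ f, IsNowhereZeroTopForm n M f

/-- `φ : M → (ℙⁿ, b)` is a uniformization with Galois group `G`: `M` is a connected complex
manifold, `G` is a properly discontinuous group of holomorphic automorphisms of `M`, the map `φ`
identifies the ringed space `M / G` with `ℙⁿ`, and `b (φ q)` is the order of the isotropy group
of `q`. -/
structure IsUniformization {n : ℕ} {M : Type*} [TopologicalSpace M]
    [ChartedSpace (Fin n → ℂ) M] (G : Subgroup (Equiv.Perm M)) (φ : M → PSpace n)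
    (b : PSpace n → ℕ) : Prop where
  complexManifold : IsComplexManifold n M
  holomorphic_action : ∀ g ∈ G, MDifferentiable 𝓘(ℂ, Fin n → ℂ) 𝓘(ℂ, Fin n → ℂ) (g : M → M)
  properlyDiscontinuous : ProperlyDiscontinuousSMul G M
  /-- The fibres of `φ` are the orbits of `G`. -/
  fibres : ∀ x y : M, φ x = φ y ↔ ∃ g ∈ G, g x = y
  /-- `ℙⁿ` carries the quotient topology (in particular `φ` is continuous and surjective). -/
  quotientMap : Topology.IsQuotientMap φ
  /-- A function on an open set of `ℙⁿ` is holomorphic iff its pull-back to `M` is. -/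
  structureSheaf : ∀ (V : Set (PSpace n)), IsOpen V → ∀ h : PSpace n → ℂ,
    HolomorphicOn h V ↔ MDifferentiableOn 𝓘(ℂ, Fin n → ℂ) 𝓘(ℂ, ℂ) (h ∘ φ) (φ ⁻¹' V)
  isotropy : ∀ q : M, b (φ q) = Nat.card (MulAction.stabilizer G q)

/-- `(ℙⁿ, b)` is a Calabi–Yau orbifold: it is uniformized by a Calabi–Yau manifold. -/
def IsCalabiYauOrbifold {n : ℕ} (b : PSpace n → ℕ) : Prop :=
  ∃ (M : Type u) (_ : TopologicalSpace M) (_ : ChartedSpace (Fin n → ℂ) M)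
    (G : Subgroup (Equiv.Perm M)) (φ : M → PSpace n),
    IsCalabiYauManifold n M ∧ IsUniformization G φ b

/-- The locus `{p | b p ≠ 1}` of `(ℙⁿ, b)` is a hypersurface with irreducible components
`Hᵢ = {Fᵢ = 0}`, `i < r`, where `Hᵢ` has degree `dᵢ`: the `Fᵢ` are irreducible homogeneous
polynomials of degree `dᵢ`, no two of them proportional. -/
structure IsLocus {n r : ℕ} (b : PSpace n → ℕ) (F : Fin r → MvPolynomial (Fin (n + 1)) ℂ)
    (d : Fin r → ℕ) : Prop where
  irreducible : ∀ i, Irreducible (F i)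
  homogeneous : ∀ i, (F i).IsHomogeneous (d i)
  distinct : ∀ i j, i ≠ j → ¬ Associated (F i) (F j)
  locus_eq : ∀ (z : Fin (n + 1) → ℂ) (hz : z ≠ 0),
    b (pt z hz) ≠ 1 ↔ ∃ i, MvPolynomial.eval z (F i) = 0

/-- The set `Hᵢ \ sing H` (as a set of homogeneous coordinates), where `H = ⋃ Hⱼ` has the reduced
equation `∏ Fⱼ = 0`. -/
def regularPoints {n r : ℕ} (F : Fin r → MvPolynomial (Fin (n + 1)) ℂ) (i : Fin r) :
    Set (Fin (n + 1) → ℂ) :=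
  {z | z ≠ 0 ∧ MvPolynomial.eval z (F i) = 0 ∧
    ∃ k, MvPolynomial.eval z (MvPolynomial.pderiv k (∏ j, F j)) ≠ 0}

/-- `m` is the weight of `Hᵢ`: the constant value of `b` on the nonempty set `Hᵢ \ sing H`. -/
def IsWeight {n r : ℕ} (b : PSpace n → ℕ) (F : Fin r → MvPolynomial (Fin (n + 1)) ℂ)
    (i : Fin r) (m : ℕ) : Prop :=
  (regularPoints F i).Nonempty ∧
    ∀ (z : Fin (n + 1) → ℂ) (hz : z ≠ 0), z ∈ regularPoints F i → b (pt z hz) = m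

end CYOrbifold

end

/-!
The theorem is the canonical bundle formula for the branched covering `φ : M → ℙⁿ`, made explicit.
Since `M` is compact, `G` is finite; let `N = |G|`. The canonical bundle of `ℙⁿ` is `𝒪(-n-1)`, so
pulling back the form `∑ (-1)ⁱ zᵢ dz₀ ∧ ⋯ ∧ dzᵢ₋₁ ∧ dzᵢ₊₁ ∧ ⋯ ∧ dzₙ` and dividing by the nowhere
vanishing `n`-form of `M` gives a section of `φ^* 𝒪(n + 1)`, the Jacobian of `φ`. The product of its
translates by `G` is `G`-invariant, so it descends to a section of `𝒪(N (n + 1))`, which is a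
homogeneous polynomial `P` of degree `N (n + 1)`
(`IsUniformization.exists_ramification_polynomial`).

The Jacobian vanishes exactly at the points with nontrivial isotropy
(`IsUniformization.jacobian_eq_zero_iff_ne_one`), so that `P = 0` is the locus `b ≠ 1`, and the
Nullstellensatz gives `P = c ∏ Fᵢ ^ aᵢ` (`exists_eq_prod_pow`). Comparison of degrees yields
`N (n + 1) = ∑ dᵢ aᵢ`.

At a point of `Hᵢ \ sing H` with isotropy group of order `m`, the map `φ` looks like `t ↦ t ^ m`
in a direction transversal to `Hᵢ`, and its Jacobian vanishes to order `m - 1`. Hence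
`N (m - 1) = aᵢ m` (`IsUniformization.card_mul_isotropy_sub_one`), which determines `m = mᵢ` in
terms of `N` and `aᵢ`, so `b` is constant on `Hᵢ \ sing H`. This local statement does not use the
linearization of the isotropy group: discs parallel to `Hᵢ` lift to `M`, and Cauchy's estimate
shows that `φ` is a submersion modulo the transversal direction
(`IsUniformization.exists_fderiv_coneChart_eq`), so the preimage of a transversal line is a smooth
curve (`exists_transversal_curve`), and the order of `φ` along this curve is found by counting the
points of nearby fibres.

Finally `n + 1 = ∑ dᵢ (1 - 1 / mᵢ)` with `1 / 2 ≤ 1 - 1 / mᵢ < 1` gives the bounds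
(`degree_bounds`).
-/

noncomputable section

namespace CYOrbifold

/-! ### Holomorphic functions of several variables are smooth -/

section

open Metric Set Filter Topology MeasureTheory

/-- Cauchy's formula along the complex line through `x` in the direction `v`. -/
theorem fderiv_apply_eq_circleIntegral {E F : Type*} [NormedAddCommGroup E] [NormedSpace ℂ E]
    [NormedAddCommGroup F] [NormedSpace ℂ F] [CompleteSpace F] {U : Set E} (hU : IsOpen U)
    {f : E → F} (hf : DifferentiableOn ℂ f U) {x v : E}
    (hx : ∀ t ∈ closedBall (0 : ℂ) 1, x + t • v ∈ U) :
    fderiv ℂ f x v = ((2 * Real.pi * Complex.I : ℂ)⁻¹ •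
      ∮ z in C(0, 1), ((z - 0) ^ 2)⁻¹ • f (x + z • v)) := by
  have hline : Continuous fun t : ℂ => x + t • v := by fun_prop
  have hx0 : DifferentiableAt ℂ f (x + (0 : ℂ) • v) :=
    hf.differentiableAt (hU.mem_nhds (hx 0 (by simp)))
  have hd : DifferentiableOn ℂ (fun t : ℂ => f (x + t • v)) ((fun t : ℂ => x + t • v) ⁻¹' U) :=
    hf.comp (by fun_prop) fun t ht => ht
  rw [Complex.two_pi_I_inv_smul_circleIntegral_sub_sq_inv_smul_of_differentiable
    (hU.preimage hline) (fun t ht => hx t ht) hd (mem_ball_self one_pos)]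
  have h1 : HasDerivAt (fun t : ℂ => x + t • v) v 0 := by
    simpa using ((hasDerivAt_id (0 : ℂ)).smul_const v).const_add x
  have h2 := hx0.hasFDerivAt.comp_hasDerivAt (0 : ℂ) h1
  simpa [Function.comp_def] using h2.deriv.symm

/-- The directional derivatives of a holomorphic function of several variables are holomorphic, by
differentiation of Cauchy's formula under the integral sign. -/
theorem differentiableOn_fderiv_apply {E F : Type*} [NormedAddCommGroup E] [NormedSpace ℂ E]
    [FiniteDimensional ℂ E] [NormedAddCommGroup F] [NormedSpace ℂ F] [FiniteDimensional ℂ F]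
    {U : Set E} (hU : IsOpen U) {f : E → F} (hf : DifferentiableOn ℂ f U) (v : E) :
    DifferentiableOn ℂ (fun x => fderiv ℂ f x v) U := by
  have : CompleteSpace F := FiniteDimensional.complete ℂ F
  have : ProperSpace E := FiniteDimensional.proper ℂ E
  have : ProperSpace (E →L[ℂ] F) := FiniteDimensional.proper ℂ _
  -- it suffices to treat short vectors `v`
  suffices H : ∀ x₀ ∈ U, ∃ δ > 0, ∀ v : E, ‖v‖ < δ →
      DifferentiableAt ℂ (fun x => fderiv ℂ f x v) x₀ by
    intro x₀ hx₀
    obtain ⟨δ, hδ, H⟩ := H x₀ hx₀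
    obtain ⟨c, hc⟩ : ∃ c : ℂ, c ≠ 0 ∧ ‖c • v‖ < δ := by
      refine ⟨((δ / (2 * (‖v‖ + 1)) : ℝ) : ℂ), ?_, ?_⟩
      · exact_mod_cast (by positivity : δ / (2 * (‖v‖ + 1)) ≠ 0)
      · rw [norm_smul, Complex.norm_real, Real.norm_of_nonneg (by positivity), div_mul_eq_mul_div,
          div_lt_iff₀ (by positivity)]
        nlinarith [norm_nonneg v]
    have := ((H _ hc.2).const_smul c⁻¹).differentiableWithinAt (s := U)
    simpa [hc.1, Pi.smul_def] using this
  intro x₀ hx₀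
  obtain ⟨R, hR, hRU⟩ : ∃ R > 0, closedBall x₀ (2 * R) ⊆ U := by
    obtain ⟨R, hR, h⟩ := nhds_basis_closedBall.mem_iff.1 (hU.mem_nhds hx₀)
    exact ⟨R / 2, by positivity, by convert! h using 2; ring⟩
  -- `f` is bounded near `x₀`, so by the Schwarz lemma its derivative is bounded, too
  obtain ⟨C, hC⟩ : ∃ C, ∀ x ∈ closedBall x₀ (2 * R), ‖f x‖ ≤ C :=
    (isCompact_closedBall x₀ (2 * R)).exists_bound_of_continuousOn (hf.continuousOn.mono hRU)
  have hC0 : 0 ≤ C := (norm_nonneg _).trans (hC x₀ (mem_closedBall_self (by positivity)))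
  have hbd : ∀ x ∈ ball x₀ R, ‖fderiv ℂ f x‖ ≤ (2 * C + 1) / R := by
    intro x hx
    have hsub : ball x R ⊆ closedBall x₀ (2 * R) := by
      intro y hy
      rw [mem_closedBall]
      have := dist_triangle y x x₀
      rw [mem_ball] at hx hy
      linarith
    refine Complex.norm_fderiv_le_div_of_mapsTo_ball (hf.mono (hsub.trans hRU)) ?_ hR
    intro y hy
    rw [mem_closedBall, dist_eq_norm]
    have h1 := hC y (hsub hy)
    have h2 := hC x (hsub (mem_ball_self hR))
    have := norm_sub_le (f y) (f x)
    linarith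
  refine ⟨R / 2, by positivity, fun v hv => ?_⟩
  have hmem : ∀ x ∈ ball x₀ (R / 2), ∀ t ∈ closedBall (0 : ℂ) 1, x + t • v ∈ ball x₀ R := by
    intro x hx t ht
    rw [mem_ball, dist_eq_norm] at *
    rw [mem_closedBall_zero_iff] at ht
    have h1 : ‖t • v‖ ≤ 1 * ‖v‖ := by rw [norm_smul]; gcongr
    have : x + t • v - x₀ = (x - x₀) + t • v := by abel
    rw [this]
    have := norm_add_le (x - x₀) (t • v)
    linarith
  have hball : ball x₀ R ⊆ U := fun x hx => hRU
    (mem_closedBall.2 (by rw [mem_ball] at hx; linarith))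
  have hmem' : ∀ x ∈ ball x₀ (R / 2), ∀ t : ℝ, x + circleMap 0 1 t • v ∈ ball x₀ R :=
    fun x hx t => hmem x hx _ (by simp)
  have hev : (fun x => fderiv ℂ f x v) =ᶠ[𝓝 x₀] fun x => ((2 * Real.pi * Complex.I : ℂ)⁻¹ •
      ∮ z in C(0, 1), ((z - 0) ^ 2)⁻¹ • f (x + z • v)) := by
    filter_upwards [ball_mem_nhds x₀ (half_pos hR)] with x hx
    exact fderiv_apply_eq_circleIntegral hU hf fun t ht => hball (hmem x hx t ht)
  refine DifferentiableAt.congr_of_eventuallyEq ?_ hev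
  refine DifferentiableAt.const_smul ?_ _
  simp only [circleIntegral]
  simp only [intervalIntegral.integral_of_le Real.two_pi_pos.le]
  set g : ℝ → ℂ := fun θ => deriv (circleMap 0 1) θ * ((circleMap 0 1 θ - 0) ^ 2)⁻¹ with hg
  have hgc : Continuous g := by
    have h0 : ∀ θ, (circleMap 0 1 θ - 0) ^ 2 ≠ 0 := by
      intro θ; simp
    simp only [hg, deriv_circleMap]
    exact ((continuous_circleMap 0 1).mul continuous_const).mul
      ((((continuous_circleMap 0 1).sub continuous_const).pow 2).inv₀ h0)
  have hg1 : ∀ θ, ‖g θ‖ = 1 := by intro θ; simp [hg]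
  have hfc : ∀ x ∈ ball x₀ (R / 2), Continuous fun θ : ℝ => f (x + circleMap 0 1 θ • v) := by
    intro x hx
    exact hf.continuousOn.comp_continuous
      (continuous_const.add ((continuous_circleMap 0 1).smul continuous_const))
      fun θ => hball (hmem' x hx θ)
  have hF : ∀ x ∈ ball x₀ (R / 2), Continuous fun θ : ℝ =>
      deriv (circleMap 0 1) θ • ((circleMap 0 1 θ - 0) ^ 2)⁻¹ • f (x + circleMap 0 1 θ • v) := by
    intro x hx
    have := hgc.smul (hfc x hx)
    simpa only [hg, mul_smul, Pi.smul_def'] using this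
  borelize E
  borelize (E →L[ℂ] F)
  have key := hasFDerivAt_integral_of_dominated_of_fderiv_le
    (μ := volume.restrict (Ioc 0 (2 * Real.pi))) (𝕜 := ℂ)
    (F := fun x θ =>
      deriv (circleMap 0 1) θ • ((circleMap 0 1 θ - 0) ^ 2)⁻¹ • f (x + circleMap 0 1 θ • v))
    (F' := fun x θ => g θ • fderiv ℂ f (x + circleMap 0 1 θ • v))
    (bound := fun _ => (2 * C + 1) / R)
    (ball_mem_nhds x₀ (half_pos hR)) ?_ ?_ ?_ ?_ ?_ ?_
  · exact key.differentiableAt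
  · filter_upwards [ball_mem_nhds x₀ (half_pos hR)] with x hx
    exact (hF x hx).aestronglyMeasurable
  · have := (hF x₀ (mem_ball_self (half_pos hR))).intervalIntegrable (μ := volume) 0 (2 * Real.pi)
    exact (intervalIntegrable_iff_integrableOn_Ioc_of_le Real.two_pi_pos.le).1 this
  · refine hgc.aestronglyMeasurable.smul ?_
    have hc : Continuous fun θ : ℝ => x₀ + circleMap 0 1 θ • v :=
      continuous_const.add ((continuous_circleMap 0 1).smul continuous_const)
    exact ((measurable_fderiv ℂ f).comp hc.measurable).aestronglyMeasurable
  · refine Eventually.of_forall fun θ x hx => ?_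
    rw [norm_smul, hg1, one_mul]
    exact hbd _ (hmem' x hx θ)
  · exact integrable_const _
  · refine Eventually.of_forall fun θ x hx => ?_
    have h1 := (hf.differentiableAt (hU.mem_nhds (hball (hmem' x hx θ)))).hasFDerivAt
    have h2 : HasFDerivAt (fun x : E => x + circleMap 0 1 θ • v) (ContinuousLinearMap.id ℂ E) x :=
      (hasFDerivAt_id x).add_const _
    have h3 := (h1.comp x h2).const_smul (g θ)
    simpa only [ContinuousLinearMap.comp_id, Function.comp_def, hg, mul_smul, Pi.smul_def] using h3

/-- A complex differentiable function of several variables is smooth. -/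
theorem contDiffOn_of_differentiableOn {E F : Type*} [NormedAddCommGroup E] [NormedSpace ℂ E]
    [FiniteDimensional ℂ E] [NormedAddCommGroup F] [NormedSpace ℂ F] [FiniteDimensional ℂ F]
    {U : Set E} (hU : IsOpen U) {f : E → F} (hf : DifferentiableOn ℂ f U) :
    ContDiffOn ℂ ∞ f U := by
  refine contDiffOn_infty.2 fun k => ?_
  induction k generalizing f with
  | zero => exact contDiffOn_zero.2 hf.continuousOn
  | succ k ih =>
    rw [Nat.cast_succ, contDiffOn_succ_iff_fderiv_of_isOpen hU]
    refine ⟨hf, fun h => absurd h (by simp), ?_⟩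
    exact contDiffOn_clm_apply.2 fun v => ih (differentiableOn_fderiv_apply hU hf v)

theorem contDiffAt_of_differentiableOn {E F : Type*} [NormedAddCommGroup E] [NormedSpace ℂ E]
    [FiniteDimensional ℂ E] [NormedAddCommGroup F] [NormedSpace ℂ F] [FiniteDimensional ℂ F]
    {U : Set E} (hU : IsOpen U) {f : E → F} (hf : DifferentiableOn ℂ f U) {x : E} (hx : x ∈ U) :
    ContDiffAt ℂ ∞ f x :=
  (contDiffOn_of_differentiableOn hU hf).contDiffAt (hU.mem_nhds hx)

theorem differentiableOn_fderiv {E F : Type*} [NormedAddCommGroup E] [NormedSpace ℂ E]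
    [FiniteDimensional ℂ E] [NormedAddCommGroup F] [NormedSpace ℂ F] [FiniteDimensional ℂ F]
    {U : Set E} (hU : IsOpen U) {f : E → F} (hf : DifferentiableOn ℂ f U) :
    DifferentiableOn ℂ (fderiv ℂ f) U :=
  ((contDiffOn_infty_iff_fderiv_of_isOpen hU).1
    (contDiffOn_of_differentiableOn hU hf)).2.differentiableOn (by simp)

end

/-! ### Homogeneous holomorphic functions are polynomials -/

section

open Metric Set Filter Topology

/-- A homogeneous function of degree `D ≥ 2` that is holomorphic away from the origin is entire: it
is `O(‖z‖ ^ D)`, so that its derivative at the origin vanishes. -/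
theorem differentiable_of_homogeneous {E : Type*} [NormedAddCommGroup E] [NormedSpace ℂ E]
    [FiniteDimensional ℂ E] {P : E → ℂ} (hP : DifferentiableOn ℂ P {0}ᶜ) {D : ℕ}
    (hD : 2 ≤ D) (hom : ∀ (c : ℂ) z, P (c • z) = c ^ D * P z) : Differentiable ℂ P := by
  have : ProperSpace E := FiniteDimensional.proper ℂ E
  intro z
  by_cases hz : z = 0
  swap
  · exact hP.differentiableAt (isOpen_compl_singleton.mem_nhds hz)
  subst hz
  obtain ⟨C, hC⟩ : ∃ C, ∀ z ∈ sphere (0 : E) 1, ‖P z‖ ≤ C :=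
    (isCompact_sphere (0 : E) 1).exists_bound_of_continuousOn
      (hP.continuousOn.mono fun z hz => ne_of_mem_sphere hz one_ne_zero)
  have h0 : P 0 = 0 := by
    have := hom 0 0
    rwa [zero_smul, zero_pow (by omega), zero_mul] at this
  have hbd : ∀ z, ‖P z‖ ≤ C * ‖z‖ ^ D := by
    intro z
    by_cases hz : z = 0
    · subst hz; simp [h0, show D ≠ 0 by omega]
    · have hn : ((‖z‖ : ℝ) : ℂ) ≠ 0 := by exact_mod_cast norm_ne_zero_iff.2 hz
      have h1 := hom (‖z‖ : ℝ) (((‖z‖ : ℝ) : ℂ)⁻¹ • z)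
      rw [smul_smul, mul_inv_cancel₀ hn, one_smul] at h1
      rw [h1, norm_mul, norm_pow, Complex.norm_real, norm_norm, mul_comm]
      gcongr
      exact hC _ (by simp [norm_smul, norm_ne_zero_iff.2 hz])
  refine HasFDerivAt.differentiableAt (f' := 0) ?_
  refine .of_isLittleO ?_
  simp only [h0, sub_zero, zero_apply]
  refine (Asymptotics.IsBigO.of_bound C (g := fun z : E => ‖z‖ ^ D)
    (Eventually.of_forall fun z => ?_)).trans_isLittleO ?_
  · simpa using hbd z
  · exact Asymptotics.isLittleO_norm_pow_id (by omega)

/-- An entire homogeneous function is a polynomial: it is given by its Taylor polynomial at the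
origin. -/
theorem exists_mvPolynomial_of_homogeneous {ι : Type*} [Fintype ι] {P : (ι → ℂ) → ℂ}
    (hP : Differentiable ℂ P) {D : ℕ} (hom : ∀ (c : ℂ) z, P (c • z) = c ^ D * P z) :
    ∃ p : MvPolynomial ι ℂ, p.IsHomogeneous D ∧ ∀ z, MvPolynomial.eval z p = P z := by
  classical
  have hcd : ContDiff ℂ ∞ P := contDiffOn_univ.1
    (contDiffOn_of_differentiableOn isOpen_univ hP.differentiableOn)
  set M := iteratedFDeriv ℂ D P 0 with hM
  -- along the line through `z`, the function is `t ^ D * P z`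
  have key : ∀ z, M (fun _ => z) = (D.factorial : ℂ) * P z := by
    intro z
    have h1 := ContinuousLinearMap.iteratedFDeriv_comp_right
      (ContinuousLinearMap.toSpanSingleton ℂ z) hcd 0 (i := D) (by exact_mod_cast le_top)
    have h2 := congrArg (fun m => m fun _ => (1 : ℂ)) h1
    have h3 : P ∘ (ContinuousLinearMap.toSpanSingleton ℂ z) = fun t : ℂ => t ^ D * P z := by
      ext t; simp [hom]
    simp only [ContinuousMultilinearMap.compContinuousLinearMap_apply, map_zero,
      ContinuousLinearMap.toSpanSingleton_apply, one_smul] at h2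
    rw [hM, ← h2, ← iteratedDeriv_eq_iteratedFDeriv, h3]
    have h4 : (fun t : ℂ => t ^ D * P z) = fun t => P z * t ^ D := by ext; ring
    rw [h4, iteratedDeriv_const_mul_field, iteratedDeriv_eq_iterate,
      iter_deriv_pow]
    have h5 : ∏ i ∈ Finset.range D, ((D : ℂ) - i) = D.factorial := by
      rw [← Nat.descFactorial_self, Nat.descFactorial_eq_prod_range, Nat.cast_prod]
      exact Finset.prod_congr rfl fun i hi => (Nat.cast_sub (Finset.mem_range.1 hi).le).symm
    simp [h5, mul_comm]
  refine ⟨MvPolynomial.C ((D.factorial : ℂ)⁻¹) * ∑ r : Fin D → ι,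
    MvPolynomial.C (M fun j => Pi.single (r j) 1) * ∏ j, MvPolynomial.X (r j), ?_, ?_⟩
  · refine MvPolynomial.IsHomogeneous.C_mul ?_ _
    refine MvPolynomial.IsHomogeneous.sum _ _ _ fun r _ => ?_
    refine MvPolynomial.IsHomogeneous.C_mul ?_ _
    have := MvPolynomial.IsHomogeneous.prod (Finset.univ : Finset (Fin D))
      (fun j => (MvPolynomial.X (r j) : MvPolynomial ι ℂ)) (fun _ => 1)
      fun j _ => MvPolynomial.isHomogeneous_X _ _
    simpa using this
  · intro z
    have h1 : M (fun _ => z) = ∑ r : Fin D → ι, (∏ j, z (r j)) * M fun j => Pi.single (r j) 1 := by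
      conv_lhs =>
        rw [show (fun _ : Fin D => z) = fun _ => ∑ i, z i • (Pi.single i 1 : ι → ℂ) by
          ext j i; simp [Finset.sum_apply, Pi.single_apply]]
      rw [ContinuousMultilinearMap.map_sum]
      refine Finset.sum_congr rfl fun r _ => ?_
      rw [ContinuousMultilinearMap.map_smul_univ, smul_eq_mul]
    have h2 : (D.factorial : ℂ) ≠ 0 := by exact_mod_cast D.factorial_ne_zero
    rw [← mul_right_inj' h2, ← key z, h1]
    simp only [map_mul, map_sum, MvPolynomial.eval_C, map_prod, MvPolynomial.eval_X]
    rw [mul_inv_cancel_left₀ h2]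
    exact Finset.sum_congr rfl fun r _ => mul_comm _ _

end

/-! ### Hypersurfaces and their equations -/

section

open MvPolynomial

/-- Nullstellensatz for a hypersurface with irreducible equation. -/
theorem dvd_of_irreducible_of_vanish {σ : Type*} [Finite σ] {f g : MvPolynomial σ ℂ}
    (hf : Irreducible f) (h : ∀ z, eval z f = 0 → eval z g = 0) : f ∣ g := by
  have hp : (Ideal.span {f}).IsPrime :=
    (Ideal.span_singleton_prime hf.ne_zero).2 hf.prime
  have h1 := MvPolynomial.IsPrime.vanishingIdeal_zeroLocus (K := ℂ) (Ideal.span {f})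
  rw [← Ideal.mem_span_singleton, ← h1, mem_vanishingIdeal_iff]
  intro z hz
  have := hz f (Ideal.mem_span_singleton_self f)
  rw [aeval_eq_eval] at this ⊢
  exact h z this

/-- The Nullstellensatz in projective space, where no condition is imposed at the origin. This fails
for `n = 0`, as the zero set of `X 0` in `ℙ⁰` is empty. -/
theorem dvd_of_irreducible_of_vanish_off_zero {n : ℕ} (hn : 1 ≤ n)
    {f g : MvPolynomial (Fin (n + 1)) ℂ} (hf : Irreducible f)
    (h : ∀ z ≠ 0, eval z f = 0 → eval z g = 0) : f ∣ g := by
  have hX : ∀ j, f ∣ X j * g := by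
    intro j
    refine dvd_of_irreducible_of_vanish hf fun z hz => ?_
    by_cases hz0 : z = 0
    · simp [hz0]
    · simp [h z hz0 hz]
  by_contra hfg
  have h0 := (hf.prime.dvd_or_dvd (hX 0)).resolve_right hfg
  have h1 := (hf.prime.dvd_or_dvd (hX (Fin.last n))).resolve_right hfg
  have h2 : (X 0 : MvPolynomial (Fin (n + 1)) ℂ) ∣ X (Fin.last n) :=
    (hf.dvd_symm (X_prime (i := (0 : Fin (n + 1)))).irreducible h0).trans h1
  obtain ⟨q, hq⟩ := h2
  have hne : (Fin.last n) ≠ 0 := by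
    rw [Ne, Fin.ext_iff]; simp; omega
  have := congrArg (eval (Pi.single (Fin.last n) (1 : ℂ))) hq
  simp [hne.symm] at this

/-- A polynomial whose zero set in projective space is the union of the hypersurfaces `Fᵢ = 0`
is a product of powers of the `Fᵢ`. -/
theorem exists_eq_prod_pow {n r : ℕ} (hn : 1 ≤ n) {P : MvPolynomial (Fin (n + 1)) ℂ}
    {F : Fin r → MvPolynomial (Fin (n + 1)) ℂ} (hirr : ∀ i, Irreducible (F i))
    (h : ∀ z ≠ 0, eval z P = 0 ↔ ∃ i, eval z (F i) = 0) :
    ∃ (c : ℂ) (a : Fin r → ℕ), c ≠ 0 ∧ P = C c * ∏ i, F i ^ a i := by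
  have hP0 : P ≠ 0 := by
    rintro rfl
    have h1 : (X 0 : MvPolynomial (Fin (n + 1)) ℂ) * ∏ i, F i = 0 := by
      refine MvPolynomial.funext fun z => ?_
      by_cases hz : z = 0
      · simp [hz]
      · obtain ⟨i, hi⟩ := (h z hz).1 (by simp)
        simp only [map_mul, map_prod, map_zero]
        rw [Finset.prod_eq_zero (Finset.mem_univ i) hi, mul_zero]
    rcases mul_eq_zero.1 h1 with h2 | h2
    · exact X_ne_zero _ h2
    · obtain ⟨i, -, hi⟩ := Finset.prod_eq_zero_iff.1 h2
      exact (hirr i).ne_zero hi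
  -- every irreducible factor of `P` is one of the `F i`
  have hdvd : ∀ Q, Irreducible Q → Q ∣ P → ∃ i, Associated (F i) Q := by
    intro Q hQ hQP
    have h1 : Q ∣ ∏ i, F i := by
      refine dvd_of_irreducible_of_vanish_off_zero hn hQ fun z hz hQz => ?_
      obtain ⟨R, rfl⟩ := hQP
      obtain ⟨i, hi⟩ := (h z hz).1 (by simp [hQz])
      rw [map_prod, Finset.prod_eq_zero (Finset.mem_univ i) hi]
    obtain ⟨i, -, hi⟩ := (Prime.dvd_finsetProd_iff hQ.prime _).1 h1
    exact ⟨i, ((hQ.associated_of_dvd (hirr i) hi)).symm⟩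
  clear h
  induction P using WfDvdMonoid.induction_on_irreducible with
  | zero => exact absurd rfl hP0
  | unit u hu =>
    obtain ⟨c, hc, rfl⟩ := (MvPolynomial.isUnit_iff_eq_C_of_isReduced).1 hu
    exact ⟨c, 0, hc.ne_zero, by simp⟩
  | mul P Q hP hQ ih =>
    obtain ⟨c, a, hc, rfl⟩ := ih hP fun R hR hRP => hdvd R hR (hRP.mul_left Q)
    obtain ⟨i, u, hu⟩ := hdvd Q hQ (dvd_mul_right _ _)
    obtain ⟨c', hc', hcu⟩ := (MvPolynomial.isUnit_iff_eq_C_of_isReduced).1 u.isUnit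
    refine ⟨c' * c, a + Pi.single i 1, mul_ne_zero hc'.ne_zero hc, ?_⟩
    have h1 : ∏ j, F j ^ (a + Pi.single i 1 : Fin r → ℕ) j = (∏ j, F j ^ a j) * F i := by
      simp only [Pi.add_apply, pow_add, Finset.prod_mul_distrib]
      congr 1
      rw [Finset.prod_eq_single i]
      · simp
      · intro j _ hj; simp [hj]
      · simp
    rw [h1, ← hu, hcu, C_mul]
    ring

theorem isHomogeneous_degree_eq_sum {σ : Type*} {r : ℕ} {P : MvPolynomial σ ℂ} {c : ℂ}
    (hc : c ≠ 0) {F : Fin r → MvPolynomial σ ℂ} {a d : Fin r → ℕ} (hirr : ∀ i, Irreducible (F i))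
    (hF : ∀ i, (F i).IsHomogeneous (d i)) (hP : P = C c * ∏ i, F i ^ a i) {D : ℕ}
    (hD : P.IsHomogeneous D) : D = ∑ i, d i * a i := by
  have h1 : P.IsHomogeneous (∑ i, d i * a i) := by
    rw [hP]
    exact (MvPolynomial.IsHomogeneous.prod _ _ _ fun i _ => (hF i).pow (a i)).C_mul c
  refine hD.inj_right h1 ?_
  rw [hP]
  exact mul_ne_zero (by simpa using hc)
    (Finset.prod_ne_zero_iff.2 fun i _ => pow_ne_zero _ (hirr i).ne_zero)

theorem degree_pos_of_irreducible {σ : Type*} {f : MvPolynomial σ ℂ} {d : ℕ}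
    (hf : Irreducible f) (hd : f.IsHomogeneous d) : 0 < d := by
  by_contra h0
  obtain rfl : d = 0 := by omega
  have h1 := totalDegree_eq_zero_iff_eq_C.1 ((totalDegree_zero_iff_isHomogeneous _).2 hd)
  apply hf.not_isUnit
  rw [h1]
  refine IsUnit.map C (isUnit_iff_ne_zero.2 fun h => hf.ne_zero ?_)
  rw [h1, h, C_0]

/-- For reasons of degree `f` divides `∂ₖ f` only if `∂ₖ f = 0`, and not all `∂ₖ f` vanish, by
Euler's identity. -/
theorem exists_not_dvd_pderiv {n d : ℕ} {f : MvPolynomial (Fin n) ℂ}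
    (hf : Irreducible f) (hd : f.IsHomogeneous d) : ∃ k, ¬ f ∣ pderiv k f := by
  by_contra! h
  have hpos := degree_pos_of_irreducible hf hd
  have h0 : ∀ k, pderiv k f = 0 := by
    intro k
    by_contra hk
    obtain ⟨q, hq⟩ := h k
    have h1 := hd.totalDegree hf.ne_zero
    have h2 := (hd.pderiv (i := k)).totalDegree hk
    have hq0 : q ≠ 0 := by rintro rfl; exact hk (by simpa using hq)
    rw [hq, totalDegree_mul_of_isDomain hf.ne_zero hq0] at h2
    omega
  have h1 := hd.sum_X_mul_pderiv
  simp only [h0, mul_zero, Finset.sum_const_zero] at h1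
  rcases smul_eq_zero.1 h1.symm with h2 | h2
  · omega
  · exact hf.ne_zero h2

theorem pderiv_prod_eq {n r : ℕ} (F : Fin r → MvPolynomial (Fin n) ℂ) (k : Fin n) (i : Fin r) :
    ∃ q, pderiv k (∏ j, F j) = pderiv k (F i) * ∏ j ∈ Finset.univ.erase i, F j + F i * q := by
  refine ⟨pderiv k (∏ j ∈ Finset.univ.erase i, F j), ?_⟩
  rw [← Finset.mul_prod_erase _ _ (Finset.mem_univ i), pderiv_mul]

theorem regularPoints_nonempty {n r : ℕ} (hn : 1 ≤ n) {F : Fin r → MvPolynomial (Fin (n + 1)) ℂ}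
    {d : Fin r → ℕ} (hirr : ∀ i, Irreducible (F i)) (hF : ∀ i, (F i).IsHomogeneous (d i))
    (hdist : ∀ i j, i ≠ j → ¬ Associated (F i) (F j)) (i : Fin r) :
    (regularPoints F i).Nonempty := by
  obtain ⟨k, hk⟩ := exists_not_dvd_pderiv (hirr i) (hF i)
  by_contra hne
  rw [Set.not_nonempty_iff_eq_empty] at hne
  have h1 : F i ∣ pderiv k (∏ j, F j) := by
    refine dvd_of_irreducible_of_vanish_off_zero hn (hirr i) fun z hz hz' => ?_
    by_contra hzk
    have : z ∈ regularPoints F i := ⟨hz, hz', k, hzk⟩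
    rw [hne] at this
    exact this
  obtain ⟨q, hq⟩ := pderiv_prod_eq F k i
  rw [hq] at h1
  have h2 := (dvd_add_left (dvd_mul_right (F i) q)).1 h1
  rcases (hirr i).prime.dvd_or_dvd h2 with h3 | h3
  · exact hk h3
  · obtain ⟨j, hj, hij⟩ := (Prime.dvd_finsetProd_iff (hirr i).prime _).1 h3
    exact hdist i j (Finset.ne_of_mem_erase hj).symm
      ((hirr i).associated_of_dvd (hirr j) hij)

/-- At a point of `Hᵢ \ sing H` the hypersurface `Hᵢ` is smooth, and no other component passes
through the point. -/
theorem regularPoints_spec {n r : ℕ} {F : Fin r → MvPolynomial (Fin (n + 1)) ℂ} {i : Fin r}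
    {z : Fin (n + 1) → ℂ} (hz : z ∈ regularPoints F i) :
    (∃ k, eval z (pderiv k (F i)) ≠ 0) ∧ ∀ j, j ≠ i → eval z (F j) ≠ 0 := by
  obtain ⟨-, hzi, k, hk⟩ := hz
  obtain ⟨q, hq⟩ := pderiv_prod_eq F k i
  rw [hq] at hk
  simp only [map_add, map_mul, hzi, zero_mul, add_zero, map_prod] at hk
  refine ⟨⟨k, left_ne_zero_of_mul hk⟩, fun j hj => ?_⟩
  exact Finset.prod_ne_zero_iff.1 (right_ne_zero_of_mul hk) j
    (Finset.mem_erase.2 ⟨hj, Finset.mem_univ j⟩)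

/-- The canonical bundle formula bounds the degree of the branch divisor: by
`N (n + 1) = ∑ dᵢ aᵢ` with `aᵢ = N (1 - 1 / mᵢ)`, the number `n + 1` is a combination of the `dᵢ`
with coefficients `1 - 1 / mᵢ`, and these lie in `[1 / 2, 1)`. -/
theorem degree_bounds {n r N : ℕ} (hN : 0 < N) {a d m : Fin r → ℕ} (hd : ∀ i, 0 < d i)
    (hm : ∀ i, 2 ≤ m i) (ham : ∀ i, N * (m i - 1) = a i * m i)
    (hsum : N * (n + 1) = ∑ i, d i * a i) :
    n + 2 ≤ ∑ i, d i ∧ ∑ i, d i ≤ 2 * n + 2 ∧ (∑ i, d i = 2 * n + 2 → ∀ i, m i = 2) := by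
  -- `1 - 1 / mᵢ < 1`
  have ha : ∀ i, a i < N := by
    intro i
    obtain ⟨k, hk⟩ : ∃ k, m i = k + 1 := ⟨m i - 1, by have := hm i; omega⟩
    have := ham i
    rw [hk] at this
    simp only [Nat.add_sub_cancel] at this
    by_contra! hc
    nlinarith
  -- `1 - 1 / mᵢ ≥ 1 / 2`
  have ha2 : ∀ i, N ≤ 2 * a i := by
    intro i
    obtain ⟨k, hk⟩ : ∃ k, m i = k + 2 := ⟨m i - 2, by have := hm i; omega⟩
    have := ham i
    rw [hk] at this
    simp only [show k + 2 - 1 = k + 1 by omega] at this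
    by_contra! hc
    nlinarith
  have hne : (Finset.univ : Finset (Fin r)).Nonempty := by
    rw [Finset.nonempty_iff_ne_empty]
    intro h
    rw [h, Finset.sum_empty] at hsum
    exact absurd hsum (by positivity)
  have h1 : N * (n + 1) < N * ∑ i, d i := by
    rw [hsum, Finset.mul_sum]
    refine Finset.sum_lt_sum_of_nonempty hne fun i _ => ?_
    rw [mul_comm]
    exact Nat.mul_lt_mul_of_pos_right (ha i) (hd i)
  have h2 : N * ∑ i, d i ≤ N * (2 * n + 2) := by
    rw [show N * (2 * n + 2) = 2 * (N * (n + 1)) by ring, hsum, Finset.mul_sum, Finset.mul_sum]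
    refine Finset.sum_le_sum fun i _ => ?_
    nlinarith [ha2 i, hd i]
  refine ⟨Nat.lt_of_mul_lt_mul_left h1, Nat.le_of_mul_le_mul_left h2 hN, fun heq i => ?_⟩
  have h3 : ∑ i, N * d i = ∑ i, 2 * (d i * a i) := by
    rw [← Finset.mul_sum, heq, ← Finset.mul_sum, ← hsum]; ring
  have h4 := (Finset.sum_eq_sum_iff_of_le fun i _ => by nlinarith [ha2 i, hd i]).1 h3 i
    (Finset.mem_univ i)
  have h5 : N = 2 * a i := by
    have : d i * N = d i * (2 * a i) := by linarith
    exact Nat.eq_of_mul_eq_mul_left (hd i) this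
  have h6 := ham i
  have ha0 : 0 < a i := by omega
  obtain ⟨k, hk⟩ : ∃ k, m i = k + 1 := ⟨m i - 1, by have := hm i; omega⟩
  rw [hk, h5] at h6
  simp only [Nat.add_sub_cancel] at h6
  have : a i * (2 * k) = a i * (k + 1) := by linarith
  have := Nat.eq_of_mul_eq_mul_left ha0 this
  omega

end

/-! ### Wronskians of lifts to the cone -/

open Metric Set Filter Topology

/-- Dropping the first coordinate, as a continuous linear map. -/
def tailL (n : ℕ) : (Fin (n + 1) → ℂ) →L[ℂ] (Fin n → ℂ) :=
  ContinuousLinearMap.pi fun i => ContinuousLinearMap.proj (Fin.succ i)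

@[simp] theorem tailL_apply {n : ℕ} (v : Fin (n + 1) → ℂ) : tailL n v = Fin.tail v := rfl

/-- The linear map `v ↦ v₀ a + A (v₁, …, vₙ)`. -/
def consMap {n : ℕ} (a : Fin (n + 1) → ℂ) (A : (Fin n → ℂ) →L[ℂ] (Fin (n + 1) → ℂ)) :
    (Fin (n + 1) → ℂ) →L[ℂ] (Fin (n + 1) → ℂ) :=
  (ContinuousLinearMap.proj (R := ℂ) (φ := fun _ : Fin (n + 1) => ℂ) 0).smulRight a + A ∘L tailL n

theorem consMap_apply {n : ℕ} (a : Fin (n + 1) → ℂ) (A : (Fin n → ℂ) →L[ℂ] (Fin (n + 1) → ℂ))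
    (v : Fin (n + 1) → ℂ) : consMap a A v = v 0 • a + A (Fin.tail v) := by
  simp [consMap]

/-- The block triangular endomorphism `v ↦ (v₀ + μ (v₁, …, vₙ), K (v₁, …, vₙ))`. -/
def blockMap {n : ℕ} (μ : (Fin n → ℂ) →L[ℂ] ℂ) (K : (Fin n → ℂ) →L[ℂ] (Fin n → ℂ)) :
    (Fin (n + 1) → ℂ) →L[ℂ] (Fin (n + 1) → ℂ) :=
  ContinuousLinearMap.pi (Fin.cons (ContinuousLinearMap.proj 0 + μ ∘L tailL n)
    fun i => ContinuousLinearMap.proj i ∘L K ∘L tailL n)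

theorem blockMap_apply {n : ℕ} (μ : (Fin n → ℂ) →L[ℂ] ℂ) (K : (Fin n → ℂ) →L[ℂ] (Fin n → ℂ))
    (v : Fin (n + 1) → ℂ) :
    blockMap μ K v = Fin.cons (v 0 + μ (Fin.tail v)) (K (Fin.tail v)) := by
  ext i
  refine Fin.cases ?_ (fun i => ?_) i <;> simp [blockMap]

theorem det_blockMap {n : ℕ} (μ : (Fin n → ℂ) →L[ℂ] ℂ) (K : (Fin n → ℂ) →L[ℂ] (Fin n → ℂ)) :
    (blockMap μ K).det = K.det := by
  have h0 : Fin.tail (Pi.single 0 1 : Fin (n + 1) → ℂ) = 0 := by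
    ext i; simp [Fin.tail]
  have hs : ∀ j : Fin n, Fin.tail (Pi.single j.succ 1 : Fin (n + 1) → ℂ) = Pi.single j 1 := by
    intro j; ext i; simp [Fin.tail, Pi.single_apply]
  rw [ContinuousLinearMap.det, ContinuousLinearMap.det, ← LinearMap.det_toMatrix',
    ← LinearMap.det_toMatrix', Matrix.det_succ_column_zero, Fin.sum_univ_succ]
  have hcol : ∀ i : Fin (n + 1),
      LinearMap.toMatrix' (blockMap μ K : (Fin (n + 1) → ℂ) →ₗ[ℂ] _) i 0 =
        (Fin.cons 1 0 : Fin (n + 1) → ℂ) i := by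
    intro i
    rw [LinearMap.toMatrix'_apply, ContinuousLinearMap.coe_coe, blockMap_apply, h0]
    simp
  simp only [hcol, Fin.cons_zero, Fin.cons_succ, Pi.zero_apply]
  simp only [Fin.val_zero, pow_zero, mul_one, one_mul, mul_zero, zero_mul, Finset.sum_const_zero,
    add_zero]
  congr 1
  ext i j
  rw [Matrix.submatrix_apply, LinearMap.toMatrix'_apply, LinearMap.toMatrix'_apply]
  simp only [ContinuousLinearMap.coe_coe, blockMap_apply]
  simp [hs]

theorem det_consMap_comp {n : ℕ} (a : Fin (n + 1) → ℂ) (A : (Fin n → ℂ) →L[ℂ] (Fin (n + 1) → ℂ))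
    (K : (Fin n → ℂ) →L[ℂ] (Fin n → ℂ)) :
    (consMap a (A ∘L K)).det = K.det * (consMap a A).det := by
  have : consMap a (A ∘L K) = consMap a A ∘L blockMap 0 K := by
    ext1 v
    simp [consMap_apply, blockMap_apply]
  rw [this, ContinuousLinearMap.det, ContinuousLinearMap.toLinearMap_comp, LinearMap.det_comp]
  change (consMap a A).det * (blockMap 0 K).det = _
  rw [det_blockMap, mul_comm]

/-- Scaling the columns by `c` and adding multiples of the first column to the others. -/
theorem det_consMap_smul {n : ℕ} (c : ℂ) (hc : c ≠ 0) (μ : (Fin n → ℂ) →L[ℂ] ℂ)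
    (a : Fin (n + 1) → ℂ) (A : (Fin n → ℂ) →L[ℂ] (Fin (n + 1) → ℂ)) :
    (consMap (c • a) (c • A + μ.smulRight a)).det = c ^ (n + 1) * (consMap a A).det := by
  have : consMap (c • a) (c • A + μ.smulRight a) =
      c • (consMap a A ∘L blockMap (c⁻¹ • μ) (ContinuousLinearMap.id ℂ _)) := by
    ext1 v
    simp only [consMap_apply, blockMap_apply, ContinuousLinearMap.comp_apply, Fin.cons_zero,
      Fin.tail_cons, ContinuousLinearMap.id_apply, ContinuousLinearMap.smulRight_apply,
      add_apply, smul_apply, smul_add, add_smul, smul_smul, smul_eq_mul,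
      mul_inv_cancel_left₀ hc]
    rw [mul_comm c (v 0)]
    abel
  rw [this, ContinuousLinearMap.det]
  change LinearMap.det (c • ((consMap a A).toLinearMap ∘ₗ
    (blockMap (c⁻¹ • μ) (ContinuousLinearMap.id ℂ _)).toLinearMap)) = _
  rw [LinearMap.det_smul, LinearMap.det_comp]
  change _ * ((consMap a A).det * (blockMap (c⁻¹ • μ) (ContinuousLinearMap.id ℂ _)).det) = _
  rw [det_blockMap]
  simp [ContinuousLinearMap.det]

/-- For a map `Z : ℂⁿ → ℂⁿ⁺¹`, the determinant `det (Z, ∂₁Z, …, ∂ₙZ)`: the pull-back under `Z` of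
the `n`-form `∑ (-1)ⁱ zᵢ dz₀ ∧ ⋯ ∧ dzᵢ₋₁ ∧ dzᵢ₊₁ ∧ ⋯ ∧ dzₙ`. -/
def wronskian {n : ℕ} (Z : (Fin n → ℂ) → (Fin (n + 1) → ℂ)) (y : Fin n → ℂ) : ℂ :=
  (consMap (Z y) (fderiv ℂ Z y)).det

theorem wronskian_comp {n : ℕ} {Z : (Fin n → ℂ) → (Fin (n + 1) → ℂ)}
    {T : (Fin n → ℂ) → (Fin n → ℂ)} {y : Fin n → ℂ} (hZ : DifferentiableAt ℂ Z (T y))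
    (hT : DifferentiableAt ℂ T y) :
    wronskian (Z ∘ T) y = (fderiv ℂ T y).det * wronskian Z (T y) := by
  rw [wronskian, fderiv_comp y hZ hT, det_consMap_comp, wronskian, Function.comp_apply]

/-- Rescaling a lift of a map to `ℙⁿ` multiplies the wronskian by the factor of automorphy of
`𝒪(n + 1)`. -/
theorem wronskian_smul {n : ℕ} {Z : (Fin n → ℂ) → (Fin (n + 1) → ℂ)}
    {c : (Fin n → ℂ) → ℂ} {y : Fin n → ℂ} (hZ : DifferentiableAt ℂ Z y)
    (hc : DifferentiableAt ℂ c y) (h0 : c y ≠ 0) :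
    wronskian (fun y => c y • Z y) y = c y ^ (n + 1) * wronskian Z y := by
  rw [wronskian, fderiv_fun_smul hc hZ, det_consMap_smul _ h0, wronskian]

theorem wronskian_congr {n : ℕ} {Z Z' : (Fin n → ℂ) → (Fin (n + 1) → ℂ)} {y : Fin n → ℂ}
    (h : Z =ᶠ[𝓝 y] Z') : wronskian Z y = wronskian Z' y := by
  rw [wronskian, wronskian, h.fderiv_eq, h.eq_of_nhds]

theorem differentiableWithinAt_finsetProd {E : Type*} [NormedAddCommGroup E] [NormedSpace ℂ E]
    {ι : Type*} {U : Set E} {f : ι → E → ℂ} {x : E} (s : Finset ι)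
    (hf : ∀ i ∈ s, DifferentiableWithinAt ℂ (f i) U x) :
    DifferentiableWithinAt ℂ (fun x => ∏ i ∈ s, f i x) U x := by
  classical
  induction s using Finset.induction_on with
  | empty => simpa using differentiableWithinAt_const (1 : ℂ)
  | insert i s hi ih =>
    simp only [Finset.prod_insert hi]
    exact (hf i (Finset.mem_insert_self i s)).mul
      (ih fun j hj => hf j (Finset.mem_insert_of_mem hj))

theorem differentiableOn_det {E : Type*} [NormedAddCommGroup E] [NormedSpace ℂ E] {m : ℕ}
    {U : Set E} {f : E → ((Fin m → ℂ) →L[ℂ] (Fin m → ℂ))}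
    (hf : ∀ v, DifferentiableOn ℂ (fun x => f x v) U) :
    DifferentiableOn ℂ (fun x => (f x).det) U := by
  have h1 : ∀ x, (f x).det = ∑ σ : Equiv.Perm (Fin m), (Equiv.Perm.sign σ : ℂ) *
      ∏ i, f x (Pi.single i 1) (σ i) := by
    intro x
    rw [ContinuousLinearMap.det, ← LinearMap.det_toMatrix', Matrix.det_apply']
    simp [LinearMap.toMatrix'_apply]
  simp only [h1]
  have h2 : ∀ i j, DifferentiableOn ℂ (fun x => f x (Pi.single i 1) j) U := by
    intro i j
    exact differentiableOn_pi.1 (hf _) j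
  refine DifferentiableOn.fun_sum fun σ _ => DifferentiableOn.const_mul ?_ _
  exact fun x hx => differentiableWithinAt_finsetProd _ fun i _ => h2 i (σ i) x hx

theorem differentiableOn_wronskian {n : ℕ} {Z : (Fin n → ℂ) → (Fin (n + 1) → ℂ)}
    {U : Set (Fin n → ℂ)} (hU : IsOpen U) (hZ : DifferentiableOn ℂ Z U) :
    DifferentiableOn ℂ (wronskian Z) U := by
  have h1 := differentiableOn_fderiv hU hZ
  refine differentiableOn_det fun v => ?_
  simp only [consMap_apply]
  exact (hZ.const_smul (v 0)).add (h1.clm_apply (differentiableOn_const _))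

/-- The map `(s, y) ↦ s Z(y)` parametrizing a cone. -/
def coneMap {n : ℕ} (Z : (Fin n → ℂ) → (Fin (n + 1) → ℂ)) (c : Fin (n + 1) → ℂ) :
    Fin (n + 1) → ℂ := c 0 • Z (Fin.tail c)

theorem hasFDerivAt_coneMap {n : ℕ} {Z : (Fin n → ℂ) → (Fin (n + 1) → ℂ)} {c : Fin (n + 1) → ℂ}
    (hZ : DifferentiableAt ℂ Z (Fin.tail c)) :
    HasFDerivAt (coneMap Z) (consMap (Z (Fin.tail c)) (c 0 • fderiv ℂ Z (Fin.tail c))) c := by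
  have h1 : HasFDerivAt (fun c : Fin (n + 1) → ℂ => Z (Fin.tail c))
      (fderiv ℂ Z (Fin.tail c) ∘L tailL n) c :=
    HasFDerivAt.comp (g := Z) c hZ.hasFDerivAt (tailL n).hasFDerivAt
  have h2 : HasFDerivAt (fun c : Fin (n + 1) → ℂ => c 0)
      (ContinuousLinearMap.proj (R := ℂ) (φ := fun _ : Fin (n + 1) => ℂ) 0) c :=
    hasFDerivAt_apply 0 c
  refine (h2.smul h1).congr_fderiv ?_
  ext1 v
  simp [consMap_apply, add_comm]

theorem det_fderiv_coneMap {n : ℕ} {Z : (Fin n → ℂ) → (Fin (n + 1) → ℂ)} {c : Fin (n + 1) → ℂ}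
    (hZ : DifferentiableAt ℂ Z (Fin.tail c)) :
    (fderiv ℂ (coneMap Z) c).det = c 0 ^ n * wronskian Z (Fin.tail c) := by
  rw [(hasFDerivAt_coneMap hZ).fderiv]
  have : c 0 • fderiv ℂ Z (Fin.tail c) =
      fderiv ℂ Z (Fin.tail c) ∘L (c 0 • ContinuousLinearMap.id ℂ _) := by
    ext1 v; simp
  rw [this, det_consMap_comp, wronskian]
  congr 1
  rw [ContinuousLinearMap.det]
  change LinearMap.det (c 0 • LinearMap.id) = _
  rw [LinearMap.det_smul]
  simp

/-! ### Local biholomorphisms and limits of lifted discs -/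

/-- The holomorphic inverse function theorem. -/
theorem exists_openPartialHomeomorph {m : ℕ} {f : (Fin m → ℂ) → (Fin m → ℂ)}
    {U : Set (Fin m → ℂ)} (hU : IsOpen U) (hf : DifferentiableOn ℂ f U) {x : Fin m → ℂ}
    (hx : x ∈ U) (hdet : (fderiv ℂ f x).det ≠ 0) :
    ∃ e : OpenPartialHomeomorph (Fin m → ℂ) (Fin m → ℂ), x ∈ e.source ∧ e.source ⊆ U ∧
      (∀ y, e y = f y) ∧ DifferentiableOn ℂ e.symm e.target := by
  have hdd : DifferentiableOn ℂ (fun y => (fderiv ℂ f y).det) U :=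
    differentiableOn_det fun v => differentiableOn_fderiv_apply hU hf v
  set U' := U ∩ (fun y => (fderiv ℂ f y).det) ⁻¹' {0}ᶜ with hU'
  have hU'o : IsOpen U' := hdd.continuousOn.isOpen_inter_preimage hU isOpen_compl_singleton
  have hcd : ∀ y ∈ U, ContDiffAt ℂ 1 f y := fun y hy =>
    (contDiffAt_of_differentiableOn hU hf hy).of_le (by exact_mod_cast le_top)
  have hne : ∀ y ∈ U', (fderiv ℂ f y).det ≠ 0 := fun y hy => hy.2
  have heq : ∀ y, ∀ hy : y ∈ U', HasFDerivAt f (((fderiv ℂ f y).toContinuousLinearEquivOfDetNeZero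
      (hne y hy) : (Fin m → ℂ) ≃L[ℂ] (Fin m → ℂ)) :
        (Fin m → ℂ) →L[ℂ] (Fin m → ℂ)) y := by
    intro y hy
    rw [ContinuousLinearMap.coe_toContinuousLinearEquivOfDetNeZero]
    exact (hf.differentiableAt (hU.mem_nhds hy.1)).hasFDerivAt
  have hxU' : x ∈ U' := ⟨hx, hdet⟩
  set e0 := (hcd x hx).toOpenPartialHomeomorph f (heq x hxU') one_ne_zero with he0
  refine ⟨e0.restrOpen U' hU'o, ?_, ?_, ?_, ?_⟩
  · rw [OpenPartialHomeomorph.restrOpen_source]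
    exact ⟨(hcd x hx).mem_toOpenPartialHomeomorph_source (heq x hxU') one_ne_zero, hxU'⟩
  · rw [OpenPartialHomeomorph.restrOpen_source]
    exact fun y hy => hy.2.1
  · intro y
    exact congrFun ((hcd x hx).toOpenPartialHomeomorph_coe (heq x hxU') one_ne_zero) y
  · set e := e0.restrOpen U' hU'o
    intro y hy
    have h1 : e.symm y ∈ U' := by
      have := e.map_target hy
      rw [OpenPartialHomeomorph.restrOpen_source] at this
      exact this.2
    have hfe : (e : (Fin m → ℂ) → (Fin m → ℂ)) = f :=
      (hcd x hx).toOpenPartialHomeomorph_coe (heq x hxU') one_ne_zero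
    have h2 := e.contDiffAt_symm (n := 1) hy (by rw [hfe]; exact heq _ h1)
      (by rw [hfe]; exact hcd _ h1.1)
    exact (h2.differentiableAt one_ne_zero).differentiableWithinAt

/-- Continuous lifts of holomorphic maps through a local biholomorphism are holomorphic. -/
theorem differentiableOn_of_comp {E : Type*} [NormedAddCommGroup E] [NormedSpace ℂ E] {m : ℕ}
    {Φ : (Fin m → ℂ) → (Fin m → ℂ)} {O : Set (Fin m → ℂ)} (hO : IsOpen O)
    (hΦ : DifferentiableOn ℂ Φ O) {D : Set E} (hD : IsOpen D) {c w : E → (Fin m → ℂ)}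
    (hc : ContinuousOn c D) (hcO : ∀ τ ∈ D, c τ ∈ O)
    (hdet : ∀ τ ∈ D, (fderiv ℂ Φ (c τ)).det ≠ 0) (hw : DifferentiableOn ℂ w D)
    (hcw : ∀ τ ∈ D, Φ (c τ) = w τ) : DifferentiableOn ℂ c D := by
  intro τ₀ hτ₀
  obtain ⟨e, he1, -, he3, he4⟩ := exists_openPartialHomeomorph hO hΦ (hcO τ₀ hτ₀) (hdet τ₀ hτ₀)
  have hca := hc.continuousAt (hD.mem_nhds hτ₀)
  have hev : c =ᶠ[𝓝 τ₀] e.symm ∘ w := by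
    filter_upwards [hD.mem_nhds hτ₀, hca.preimage_mem_nhds (e.open_source.mem_nhds he1)]
      with τ h1 h2
    rw [Function.comp_apply, ← hcw τ h1, ← he3, e.left_inv h2]
  have h1 : w τ₀ ∈ e.target := by
    rw [← hcw τ₀ hτ₀, ← he3]; exact e.map_source he1
  have h2 : DifferentiableAt ℂ (e.symm ∘ w) τ₀ :=
    (he4.differentiableAt (e.open_target.mem_nhds h1)).comp τ₀
      (hw.differentiableAt (hD.mem_nhds hτ₀))
  exact (h2.congr_of_eventuallyEq hev).differentiableWithinAt

/-- If discs `wⱼ` lift through `Φ` to uniformly bounded discs `cⱼ` with centres tending to `c₀`,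
then the limit of the velocities of the `wⱼ` lies in the image of the derivative of `Φ` at `c₀`:
by Cauchy's estimate the velocities of the `cⱼ` have a convergent subsequence. -/
theorem mem_range_fderiv_of_lifts {m : ℕ} {Φ : (Fin m → ℂ) → (Fin m → ℂ)} {O : Set (Fin m → ℂ)}
    (hO : IsOpen O) (hΦ : DifferentiableOn ℂ Φ O) {c₀ ξ : Fin m → ℂ} (hc₀ : c₀ ∈ O)
    {c w : ℕ → ℂ → (Fin m → ℂ)} {R C : ℝ} (hR : 0 < R)
    (hc : ∀ j, DifferentiableOn ℂ (c j) (ball 0 R)) (hC : ∀ j, ∀ τ ∈ ball (0 : ℂ) R, ‖c j τ‖ ≤ C)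
    (hcO : ∀ j, ∀ τ ∈ ball (0 : ℂ) R, c j τ ∈ O)
    (hlim : Tendsto (fun j => c j 0) atTop (𝓝 c₀))
    (hcw : ∀ j, ∀ τ ∈ ball (0 : ℂ) R, Φ (c j τ) = w j τ)
    (hξ : Tendsto (fun j => deriv (w j) 0) atTop (𝓝 ξ)) : ∃ X, fderiv ℂ Φ c₀ X = ξ := by
  have h0 : (0 : ℂ) ∈ ball (0 : ℂ) R := mem_ball_self hR
  have hbd : ∀ j, deriv (c j) 0 ∈ closedBall (0 : Fin m → ℂ) (C / (R / 2)) := by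
    intro j
    rw [mem_closedBall_zero_iff]
    refine Complex.norm_deriv_le_of_forall_mem_sphere_norm_le (by positivity) ?_ ?_
    · refine DifferentiableOn.diffContOnCl ?_
      rw [closure_ball _ (by positivity)]
      exact (hc j).mono (closedBall_subset_ball (by linarith))
    · intro τ hτ
      exact hC j τ (closedBall_subset_ball (by linarith) (sphere_subset_closedBall hτ))
  obtain ⟨X, -, φ, hφ, hX⟩ := tendsto_subseq_of_bounded isBounded_closedBall hbd
  refine ⟨X, ?_⟩
  have hder : ∀ j, fderiv ℂ Φ (c j 0) (deriv (c j) 0) = deriv (w j) 0 := by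
    intro j
    have h1 : HasDerivAt (Φ ∘ c j) (fderiv ℂ Φ (c j 0) (deriv (c j) 0)) 0 :=
      (hΦ.differentiableAt (hO.mem_nhds (hcO j 0 h0))).hasFDerivAt.comp_hasDerivAt 0
        ((hc j).differentiableAt (isOpen_ball.mem_nhds h0)).hasDerivAt
    have h2 : w j =ᶠ[𝓝 0] Φ ∘ c j := by
      filter_upwards [isOpen_ball.mem_nhds h0] with τ hτ
      exact (hcw j τ hτ).symm
    rw [h2.deriv_eq, h1.deriv]
  have hcont : ContinuousAt (fderiv ℂ Φ) c₀ :=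
    (differentiableOn_fderiv hO hΦ).continuousOn.continuousAt (hO.mem_nhds hc₀)
  have h1 : Tendsto (fun j => fderiv ℂ Φ (c (φ j) 0) (deriv (c (φ j)) 0)) atTop
      (𝓝 (fderiv ℂ Φ c₀ X)) :=
    ((isBoundedBilinearMap_apply (𝕜 := ℂ)).continuous.tendsto (fderiv ℂ Φ c₀, X)).comp
      ((hcont.tendsto.comp (hlim.comp hφ.tendsto_atTop)).prodMk_nhds hX)
  simp only [hder] at h1
  exact tendsto_nhds_unique h1 (hξ.comp hφ.tendsto_atTop)

/-! ### Orders of vanishing in one variable -/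

theorem ncard_pow_eq {k : ℕ} (hk : k ≠ 0) {ε : ℂ} (hε : ε ≠ 0) :
    {w : ℂ | w ^ k = ε}.ncard = k := by
  classical
  have h1 : {w : ℂ | w ^ k = ε} = ((Polynomial.nthRoots k ε).toFinset : Set ℂ) := by
    ext w
    simp [Polynomial.mem_nthRoots (Nat.pos_of_ne_zero hk)]
  have h2 : (Polynomial.nthRoots k ε).Nodup :=
    Polynomial.nodup_roots (Polynomial.separable_X_pow_sub_C ε (by exact_mod_cast hk) hε)
  rw [h1, Set.ncard_coe_finset, Multiset.toFinset_card_of_nodup h2,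
    (Complex.isPrimitiveRoot_exp k hk).card_nthRoots,
    if_pos (IsAlgClosed.exists_pow_nat_eq ε (Nat.pos_of_ne_zero hk))]

theorem exists_analytic_root {g : ℂ → ℂ} (hg : AnalyticAt ℂ g 0) (h0 : g 0 ≠ 0) {k : ℕ}
    (hk : k ≠ 0) : ∃ ρ : ℂ → ℂ, AnalyticAt ℂ ρ 0 ∧ ρ 0 ≠ 0 ∧ ∀ᶠ t in 𝓝 0, ρ t ^ k = g t := by
  obtain ⟨c, hc⟩ := IsAlgClosed.exists_pow_nat_eq (g 0) (Nat.pos_of_ne_zero hk)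
  have hc0 : c ≠ 0 := by
    rintro rfl
    rw [zero_pow hk] at hc
    exact h0 hc.symm
  have hk' : (k : ℂ) ≠ 0 := by exact_mod_cast hk
  have hq : AnalyticAt ℂ (fun t => g t / g 0) 0 := hg.div analyticAt_const h0
  have hq0 : g 0 / g 0 ∈ Complex.slitPlane := by rw [div_self h0]; exact Complex.one_mem_slitPlane
  refine ⟨fun t => c * Complex.exp (Complex.log (g t / g 0) / k), ?_, ?_, ?_⟩
  · exact analyticAt_const.mul (((hq.clog hq0).div analyticAt_const hk').cexp)
  · exact mul_ne_zero hc0 (Complex.exp_ne_zero _)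
  · filter_upwards [hg.continuousAt.eventually_ne h0] with t ht
    rw [mul_pow, ← Complex.exp_nat_mul, mul_div_cancel₀ _ hk', Complex.exp_log (div_ne_zero ht h0),
      hc, mul_div_cancel₀ _ h0]

/-- A nonconstant holomorphic function of one variable which vanishes at `0` is `t ^ k` up to a
change of coordinate, so it takes every small nonzero value `k` times near `0`. -/
theorem exists_order {h : ℂ → ℂ} (ha : AnalyticAt ℂ h 0) (h0 : h 0 = 0)
    (hne : ¬ ∀ᶠ t in 𝓝 0, h t = 0) :
    ∃ (k : ℕ) (g g₁ : ℂ → ℂ), k ≠ 0 ∧ ContinuousAt g 0 ∧ g 0 ≠ 0 ∧ ContinuousAt g₁ 0 ∧ g₁ 0 ≠ 0 ∧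
      (∀ᶠ t in 𝓝 0, h t = t ^ k * g t) ∧ (∀ᶠ t in 𝓝 0, deriv h t = t ^ (k - 1) * g₁ t) ∧
      ∃ N₀ ∈ 𝓝 (0 : ℂ), ∀ N ∈ 𝓝 (0 : ℂ), N ⊆ N₀ →
        ∀ᶠ ε in 𝓝[≠] (0 : ℂ), {t ∈ N | h t = ε}.ncard = k := by
  obtain ⟨k, g, hg, hg0, hgh⟩ := ha.exists_eventuallyEq_pow_smul_nonzero_iff.2 hne
  simp only [sub_zero, smul_eq_mul] at hgh
  have hk : k ≠ 0 := by
    rintro rfl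
    have := hgh.self_of_nhds
    rw [h0, pow_zero, one_mul] at this
    exact hg0 this.symm
  have hk' : (k : ℂ) ≠ 0 := by exact_mod_cast hk
  refine ⟨k, g, fun t => k * g t + t * deriv g t, hk, hg.continuousAt, hg0, ?_, ?_, hgh, ?_, ?_⟩
  · exact (continuousAt_const.mul hg.continuousAt).add (continuousAt_id.mul hg.deriv.continuousAt)
  · simpa using ⟨hk, hg0⟩
  · have h1 : ∀ᶠ t in 𝓝 0, h =ᶠ[𝓝 t] fun t => t ^ k * g t := hgh.eventually_nhds
    filter_upwards [h1, hg.eventually_analyticAt] with t ht hgt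
    rw [ht.deriv_eq, ((hasDerivAt_pow k t).fun_mul hgt.differentiableAt.hasDerivAt).deriv]
    obtain ⟨j, rfl⟩ : ∃ j, k = j + 1 := ⟨k - 1, by omega⟩
    simp only [Nat.add_sub_cancel]
    push_cast
    ring
  · obtain ⟨ρ, hρ, hρ0, hρg⟩ := exists_analytic_root hg hg0 hk
    have hW : AnalyticAt ℂ (fun t => t * ρ t) 0 := analyticAt_id.mul hρ
    have hWd : HasDerivAt (fun t => t * ρ t) (ρ 0) 0 := by
      simpa using (hasDerivAt_id' (0 : ℂ)).fun_mul hρ.differentiableAt.hasDerivAt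
    have hWf := hWd.hasFDerivAt_equiv hρ0
    set e := ContDiffAt.toOpenPartialHomeomorph _ (hW.contDiffAt (n := 1)) hWf one_ne_zero
    have hes : (0 : ℂ) ∈ e.source :=
      ContDiffAt.mem_toOpenPartialHomeomorph_source (hW.contDiffAt (n := 1)) hWf one_ne_zero
    have hee : ∀ t, e t = t * ρ t := fun t => rfl
    have hWh : ∀ᶠ t in 𝓝 0, e t ^ k = h t := by
      filter_upwards [hρg, hgh] with t h1 h2
      rw [hee, mul_pow, h1, h2]
    refine ⟨e.source ∩ {t | e t ^ k = h t}, inter_mem (e.open_source.mem_nhds hes) hWh,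
      fun N hN hNN => ?_⟩
    have h1 : e '' N ∈ 𝓝 (0 : ℂ) := by
      have := e.image_mem_nhds hes hN
      rwa [hee, zero_mul] at this
    obtain ⟨δ, hδ, hball⟩ := Metric.mem_nhds_iff.1 h1
    have h2 : ∀ᶠ ε in 𝓝[≠] (0 : ℂ), ε ∈ ball (0 : ℂ) (δ ^ k) :=
      mem_nhdsWithin_of_mem_nhds (ball_mem_nhds _ (by positivity))
    filter_upwards [h2, self_mem_nhdsWithin] with ε hε hε0
    have hinj : InjOn e {t ∈ N | h t = ε} := e.injOn.mono fun t ht => (hNN ht.1).1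
    rw [← ncard_pow_eq hk hε0, ← hinj.ncard_image]
    congr 1
    ext w
    constructor
    · rintro ⟨t, ⟨htN, hth⟩, rfl⟩
      exact (hNN htN).2.trans hth
    · intro hw
      have hwδ : w ∈ ball (0 : ℂ) δ := by
        rw [mem_ball_zero_iff] at hε ⊢
        rw [← hw, norm_pow] at hε
        exact lt_of_pow_lt_pow_left₀ k hδ.le hε
      obtain ⟨t, htN, rfl⟩ := hball hwδ
      exact ⟨t, ⟨htN, (hNN htN).2.symm.trans hw⟩, rfl⟩

theorem order_unique {i j : ℕ} {u v : ℂ → ℂ} (hu : ContinuousAt u 0) (hu0 : u 0 ≠ 0)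
    (hv : ContinuousAt v 0) (hv0 : v 0 ≠ 0) (h : ∀ᶠ t in 𝓝 (0 : ℂ), t ^ i * u t = t ^ j * v t) :
    i = j := by
  have key : ∀ (i j : ℕ) (u v : ℂ → ℂ), ContinuousAt u 0 → u 0 ≠ 0 → ContinuousAt v 0 →
      (∀ᶠ t in 𝓝 (0 : ℂ), t ^ i * u t = t ^ j * v t) → ¬ i < j := by
    intro i j u v hu hu0 hv h hij
    have h1 : ∀ᶠ t in 𝓝[≠] (0 : ℂ), u t = t ^ (j - i) * v t := by
      filter_upwards [mem_nhdsWithin_of_mem_nhds h, self_mem_nhdsWithin] with t ht ht0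
      have : t ^ i ≠ 0 := pow_ne_zero _ ht0
      rw [← mul_right_inj' this, ht, ← mul_assoc, ← pow_add, Nat.add_sub_cancel' hij.le]
    have h2 : Tendsto u (𝓝[≠] 0) (𝓝 (u 0)) := hu.tendsto.mono_left nhdsWithin_le_nhds
    have h3 : Tendsto (fun t : ℂ => t ^ (j - i) * v t) (𝓝[≠] 0) (𝓝 (0 ^ (j - i) * v 0)) :=
      ((continuousAt_id.pow _).mul hv).tendsto.mono_left nhdsWithin_le_nhds
    rw [zero_pow (by omega), zero_mul] at h3
    exact hu0 (tendsto_nhds_unique h2 (h3.congr' (h1.mono fun t ht => ht.symm)))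
  have h1 := key i j u v hu hu0 hv h
  have h2 := key j i v u hv hv0 hu (h.mono fun t ht => ht.symm)
  omega

/-! ### Curves transversal to a hypersurface -/

/-- A linear map that preserves all coordinates but the `l`-th one has a single diagonal entry
different from `1`. -/
theorem det_eq_of_apply_eq {m : ℕ} (K : (Fin m → ℂ) →L[ℂ] (Fin m → ℂ)) (l : Fin m)
    (hK : ∀ v, ∀ i, i ≠ l → K v i = v i) : K.det = K (Pi.single l 1) l := by
  have h1 : LinearMap.toMatrix' (K : (Fin m → ℂ) →ₗ[ℂ] (Fin m → ℂ)) =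
      (1 : Matrix (Fin m) (Fin m) ℂ).updateRow l (fun j => K (Pi.single j 1) l) := by
    ext i j
    rw [LinearMap.toMatrix'_apply, ContinuousLinearMap.coe_coe]
    by_cases hi : i = l
    · subst hi; simp
    · rw [hK _ _ hi, Matrix.updateRow_ne hi, Matrix.one_apply, Pi.single_apply]
  rw [ContinuousLinearMap.det, ← LinearMap.det_toMatrix', h1, ← Matrix.cramer_transpose_apply,
    Matrix.transpose_one, Matrix.cramer_one]
  rfl

/-- If `K` is onto modulo the `l`-th coordinate, then replacing the `l`-th component of `K` by a
suitable coordinate function makes it injective. -/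
theorem exists_coordinate {m : ℕ} (K : (Fin m → ℂ) →L[ℂ] (Fin m → ℂ)) (l : Fin m)
    (hK : ∀ v : Fin m → ℂ, ∃ X, ∀ i, i ≠ l → K X i = v i) :
    ∃ j, ∀ v, (∀ i, i ≠ l → K v i = 0) → v j = 0 → v = 0 := by
  classical
  let π : (Fin m → ℂ) →ₗ[ℂ] ({i : Fin m // i ≠ l} → ℂ) :=
    LinearMap.pi fun i => LinearMap.proj i.1 ∘ₗ (K : (Fin m → ℂ) →ₗ[ℂ] (Fin m → ℂ))
  have hπ : ∀ v i, π v i = K v i.1 := fun v i => rfl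
  have hsurj : Function.Surjective π := by
    intro w
    obtain ⟨X, hX⟩ := hK fun i => if hi : i ≠ l then w ⟨i, hi⟩ else 0
    refine ⟨X, ?_⟩
    ext i
    rw [hπ, hX _ i.2, dif_pos i.2]
  have hrank := LinearMap.finrank_range_add_finrank_ker π
  rw [LinearMap.range_eq_top.2 hsurj, finrank_top, Module.finrank_fintype_fun_eq_card,
    Module.finrank_fintype_fun_eq_card] at hrank
  simp only [Fintype.card_fin, ne_eq, Fintype.card_subtype_compl, Fintype.card_unique] at hrank
  have hm : 0 < m := l.pos
  have h1 : Module.finrank ℂ (LinearMap.ker π) = 1 := by omega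
  obtain ⟨k₀, hk₀, hspan⟩ := finrank_eq_one_iff'.1 h1
  obtain ⟨j, hj⟩ : ∃ j, k₀.1 j ≠ 0 := by
    by_contra! h
    exact hk₀ (Subtype.ext (funext h))
  refine ⟨j, fun v hv hvj => ?_⟩
  obtain ⟨c, hc⟩ := hspan ⟨v, by
    rw [LinearMap.mem_ker]; ext i; rw [hπ]; exact hv i.1 i.2⟩
  have hc' : c • k₀.1 = v := congrArg Subtype.val hc
  rw [← hc', Pi.smul_apply, smul_eq_mul] at hvj
  rw [← hc', (mul_eq_zero.1 hvj).resolve_right hj, zero_smul]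

/-- If `Φ` is a submersion modulo the `l`-th coordinate, the preimage of the line through `Φ c₀`
parallel to the `l`-th axis is a smooth curve `c` near `c₀`, on which the Jacobian determinant of
`Φ` is the derivative of the `l`-th component `h`, up to a nonvanishing factor. The curve is
parametrized by its `j`-th coordinate, and contains all points near `c₀` in that preimage. -/
theorem exists_transversal_curve {m : ℕ} {Φ : (Fin m → ℂ) → (Fin m → ℂ)} {O : Set (Fin m → ℂ)}
    (hO : IsOpen O) (hΦ : DifferentiableOn ℂ Φ O) {c₀ : Fin m → ℂ} (hc₀ : c₀ ∈ O) (l : Fin m)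
    (hK : ∀ v : Fin m → ℂ, ∃ X, ∀ i, i ≠ l → fderiv ℂ Φ c₀ X i = v i) :
    ∃ (c : ℂ → (Fin m → ℂ)) (h κ : ℂ → ℂ) (j : Fin m), ContinuousAt c 0 ∧ c 0 = c₀ ∧
      AnalyticAt ℂ h 0 ∧ h 0 = 0 ∧ ContinuousAt κ 0 ∧ κ 0 ≠ 0 ∧
      (∀ᶠ t in 𝓝 0, Φ (c t) = Φ c₀ + Pi.single l (h t) ∧ c t j = c₀ j + t ∧
        (fderiv ℂ Φ (c t)).det * κ t = deriv h t) ∧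
      ∃ Ω ∈ 𝓝 c₀, ∀ x ∈ Ω, ∀ ε, Φ x = Φ c₀ + Pi.single l ε →
        c (x j - c₀ j) = x ∧ h (x j - c₀ j) = ε := by
  obtain ⟨j, hj⟩ := exists_coordinate _ l hK
  -- the curve is the preimage of a line under the local biholomorphism `T`
  set T : (Fin m → ℂ) → (Fin m → ℂ) := fun x => Function.update (Φ x) l (x j) with hT
  have hTd : DifferentiableOn ℂ T O := by
    refine differentiableOn_pi.2 fun i => ?_
    by_cases hi : i = l
    · subst hi
      simp only [hT, Function.update_self]
      exact (differentiable_apply j).differentiableOn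
    · simp only [hT, Function.update_of_ne hi]
      exact differentiableOn_pi.1 hΦ i
  have hTc : ∀ v, ∀ i, i ≠ l → fderiv ℂ T c₀ v i = fderiv ℂ Φ c₀ v i := by
    intro v i hi
    have h3 := (hasFDerivAt_pi'.1 (hTd.differentiableAt (hO.mem_nhds hc₀)).hasFDerivAt) i
    have h4 := (hasFDerivAt_pi'.1 (hΦ.differentiableAt (hO.mem_nhds hc₀)).hasFDerivAt) i
    have h5 : (fun x => T x i) = fun x => Φ x i := by
      ext x; simp only [hT, Function.update_of_ne hi]
    rw [h5] at h3
    exact congrArg (fun L => L v) (h3.unique h4)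
  have hTl : ∀ v, fderiv ℂ T c₀ v l = v j := by
    intro v
    have h3 := (hasFDerivAt_pi'.1 (hTd.differentiableAt (hO.mem_nhds hc₀)).hasFDerivAt) l
    have h5 : (fun x => T x l) = fun x => x j := by
      ext x; simp only [hT, Function.update_self]
    rw [h5] at h3
    exact congrArg (fun L => L v) (h3.unique (hasFDerivAt_apply j c₀))
  have hdet : (fderiv ℂ T c₀).det ≠ 0 := by
    intro h0
    have h1 := LinearMap.bot_lt_ker_of_det_eq_zero h0
    obtain ⟨v, hv, hv0⟩ := (Submodule.ne_bot_iff _).1 h1.ne'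
    rw [LinearMap.mem_ker, ContinuousLinearMap.coe_coe] at hv
    refine hv0 (hj v (fun i hi => ?_) ?_)
    · rw [← hTc v i hi, hv]; rfl
    · rw [← hTl v, hv]; rfl
  obtain ⟨e, he1, he2, he3, he4⟩ := exists_openPartialHomeomorph hO hTd hc₀ hdet
  set u : ℂ → (Fin m → ℂ) := fun t => T c₀ + Pi.single l t with hu
  have hud : Differentiable ℂ u := by
    refine (differentiable_const _).add (differentiable_pi.2 fun i => ?_)
    by_cases hi : i = l
    · subst hi; simp
    · simp [hi]
  have hu' : ∀ t, HasDerivAt u (Pi.single l 1) t := by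
    intro t
    refine hasDerivAt_pi.2 fun i => ?_
    by_cases hi : i = l
    · subst hi; simpa [hu] using (hasDerivAt_id' t).const_add (T c₀ i)
    · simpa [hu, hi] using hasDerivAt_const t (T c₀ i)
  have hu0 : u 0 = T c₀ := by simp [hu]
  have hTt : T c₀ ∈ e.target := by rw [← he3]; exact e.map_source he1
  have hes : e.symm (T c₀) = c₀ := by rw [← he3, e.left_inv he1]
  have htgt : ∀ᶠ t in 𝓝 (0 : ℂ), u t ∈ e.target :=
    hud.continuous.continuousAt.preimage_mem_nhds (by rw [hu0]; exact e.open_target.mem_nhds hTt)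
  set c : ℂ → (Fin m → ℂ) := fun t => e.symm (u t) with hc
  have hTct : ∀ t, u t ∈ e.target → T (c t) = u t := by
    intro t ht
    rw [← he3, hc, e.right_inv ht]
  have hcd : ∀ t, u t ∈ e.target → DifferentiableAt ℂ c t := fun t ht =>
    (he4.differentiableAt (e.open_target.mem_nhds ht)).comp t hud.differentiableAt
  have hc0 : c 0 = c₀ := by rw [hc]; simp only [hu0, hes]
  have hmem : ∀ t, u t ∈ e.target → c t ∈ O := fun t ht => he2 (e.map_target ht)
  set h : ℂ → ℂ := fun t => Φ (c t) l - Φ c₀ l with hh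
  have hΦd : ∀ x ∈ O, DifferentiableAt ℂ Φ x := fun x hx => hΦ.differentiableAt (hO.mem_nhds hx)
  have hGd : ∀ y ∈ e.target, HasFDerivAt (Φ ∘ e.symm)
      (fderiv ℂ Φ (e.symm y) ∘L fderiv ℂ e.symm y) y := fun y hy =>
    (hΦd _ (he2 (e.map_target hy))).hasFDerivAt.comp y
      (he4.differentiableAt (e.open_target.mem_nhds hy)).hasFDerivAt
  have hhd : ∀ t, u t ∈ e.target → HasDerivAt h
      ((fderiv ℂ Φ (c t) ∘L fderiv ℂ e.symm (u t)) (Pi.single l 1) l) t := by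
    intro t ht
    have h1 := (hGd _ ht).comp_hasDerivAt t (hu' t)
    have h2 := (hasDerivAt_pi.1 h1 l).sub_const (Φ c₀ l)
    exact h2
  refine ⟨c, h, fun t => (fderiv ℂ e.symm (u t)).det, j, (hcd 0 ?_).continuousAt, hc0, ?_, ?_, ?_,
    ?_, ?_, e.source, e.open_source.mem_nhds he1, ?_⟩
  · rw [hu0]; exact hTt
  · refine Complex.analyticAt_iff_eventually_differentiableAt.2 ?_
    filter_upwards [htgt] with t ht
    exact (hhd t ht).differentiableAt
  · simp only [hh, hc0, sub_self]
  · have h1 : DifferentiableOn ℂ (fun y => (fderiv ℂ e.symm y).det) e.target :=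
      differentiableOn_det fun v => differentiableOn_fderiv_apply e.open_target he4 v
    refine ContinuousAt.comp (g := fun y => (fderiv ℂ e.symm y).det) ?_
      hud.continuous.continuousAt
    rw [hu0]
    exact h1.continuousOn.continuousAt (e.open_target.mem_nhds hTt)
  · have h1 : HasFDerivAt (T ∘ e.symm) (fderiv ℂ T (e.symm (T c₀)) ∘L fderiv ℂ e.symm (T c₀))
        (T c₀) := by
      refine HasFDerivAt.comp _ ?_
        (he4.differentiableAt (e.open_target.mem_nhds hTt)).hasFDerivAt
      rw [hes]
      exact (hTd.differentiableAt (hO.mem_nhds hc₀)).hasFDerivAt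
    have h2 : T ∘ e.symm =ᶠ[𝓝 (T c₀)] id := by
      filter_upwards [e.open_target.mem_nhds hTt] with y hy
      rw [Function.comp_apply, ← he3, e.right_inv hy, id]
    have h3 := (h1.congr_of_eventuallyEq h2.symm).unique (hasFDerivAt_id (T c₀))
    have h4 := congrArg ContinuousLinearMap.det h3
    intro h5
    simp only [hu0] at h5
    rw [ContinuousLinearMap.det, ContinuousLinearMap.toLinearMap_comp, LinearMap.det_comp] at h4
    change _ * (fderiv ℂ e.symm (T c₀)).det = LinearMap.det LinearMap.id at h4
    rw [h5, mul_zero, LinearMap.det_id] at h4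
    exact zero_ne_one h4
  · filter_upwards [htgt] with t ht
    -- `Φ ∘ T⁻¹` preserves all coordinates but the `l`-th one, so its Jacobian is `h'`
    refine ⟨?_, ?_, ?_⟩
    · ext i
      by_cases hi : i = l
      · subst hi; simp [hh]
      · have h1 := congrFun (hTct t ht) i
        simpa [hT, hu, hi] using h1
    · have h1 := congrFun (hTct t ht) l
      simpa [hT, hu] using h1
    · rw [(hhd t ht).deriv, ← det_eq_of_apply_eq _ l]
      · rw [ContinuousLinearMap.det, ContinuousLinearMap.det, ContinuousLinearMap.det,
          ContinuousLinearMap.toLinearMap_comp, LinearMap.det_comp]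
      · intro v i hi
        have h1 := hasFDerivAt_pi'.1 (hGd _ ht) i
        have h2 : (fun y => (Φ ∘ e.symm) y i) =ᶠ[𝓝 (u t)] fun y => y i := by
          filter_upwards [e.open_target.mem_nhds ht] with y hy
          have h3 : T (e.symm y) = y := by rw [← he3, e.right_inv hy]
          have := congrFun h3 i
          simpa [hT, hi] using this
        have h3 := (h1.congr_of_eventuallyEq h2.symm).unique (hasFDerivAt_apply i (u t))
        exact congrArg (fun L => L v) h3
  · intro x hx ε hε
    have h1 : u (x j - c₀ j) = T x := by
      ext i
      by_cases hi : i = l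
      · subst hi; simp [hu, hT]
      · have := congrFun hε i
        simp only [Pi.add_apply, Pi.single_eq_of_ne hi, add_zero] at this
        simp [hu, hT, hi, this]
    have h2 : c (x j - c₀ j) = x := by
      simp only [hc, h1]
      rw [← he3, e.left_inv hx]
    refine ⟨h2, ?_⟩
    simp only [hh, h2, hε]
    simp

/-! ### Affine charts of projective space -/

/-- The representative of a point of `ℙⁿ` whose `k`-th coordinate is `1`. It is only meaningful
on the `k`-th standard affine chart; elsewhere it is `0`, by division by zero. -/
def affineLift {n : ℕ} (k : Fin (n + 1)) (p : PSpace n) : Fin (n + 1) → ℂ :=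
  (p.rep k)⁻¹ • p.rep

/-- The standard affine chart `{z_k ≠ 0}` of `ℙⁿ`; the condition does not depend on the
representative (see `pt_mem_affineChart`). -/
def affineChart {n : ℕ} (k : Fin (n + 1)) : Set (PSpace n) := {p | p.rep k ≠ 0}

theorem exists_smul_rep_eq {n : ℕ} (z : Fin (n + 1) → ℂ) (hz : z ≠ 0) :
    ∃ a : ℂ, a ≠ 0 ∧ z = a • (pt z hz).rep := by
  obtain ⟨a, ha⟩ := Projectivization.exists_smul_eq_mk_rep ℂ z hz
  refine ⟨((a⁻¹ : ℂˣ) : ℂ), (a⁻¹).ne_zero, ?_⟩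
  rw [← ha]
  change z = ((a⁻¹ : ℂˣ) : ℂ) • (a : ℂ) • z
  rw [smul_smul]
  simp

theorem pt_mem_affineChart {n : ℕ} {k : Fin (n + 1)} {z : Fin (n + 1) → ℂ} (hz : z ≠ 0) :
    pt z hz ∈ affineChart k ↔ z k ≠ 0 := by
  obtain ⟨a, ha, h⟩ := exists_smul_rep_eq z hz
  have h1 : z k = a * (pt z hz).rep k := congrFun h k
  change (pt z hz).rep k ≠ 0 ↔ z k ≠ 0
  rw [h1]
  simp [ha]

theorem affineLift_pt {n : ℕ} (k : Fin (n + 1)) {z : Fin (n + 1) → ℂ} (hz : z ≠ 0) :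
    affineLift k (pt z hz) = (z k)⁻¹ • z := by
  obtain ⟨a, ha, h⟩ := exists_smul_rep_eq z hz
  have h1 : z k = a * (pt z hz).rep k := congrFun h k
  have h2 : (z k)⁻¹ • z = (z k)⁻¹ • a • (pt z hz).rep := congrArg _ h
  rw [affineLift, h2, h1, smul_smul, mul_inv, mul_comm a⁻¹, mul_assoc, inv_mul_cancel₀ ha, mul_one]

theorem affineLift_self {n : ℕ} {k : Fin (n + 1)} {p : PSpace n} (hp : p ∈ affineChart k) :
    affineLift k p k = 1 := by
  rw [affineLift, Pi.smul_apply, smul_eq_mul, inv_mul_cancel₀ hp]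

theorem affineLift_ne_zero {n : ℕ} {k : Fin (n + 1)} {p : PSpace n} (hp : p ∈ affineChart k) :
    affineLift k p ≠ 0 := by
  intro h
  have := affineLift_self hp
  rw [h] at this
  exact zero_ne_one this

theorem pt_affineLift {n : ℕ} {k : Fin (n + 1)} {p : PSpace n} (hp : p ∈ affineChart k) :
    pt (affineLift k p) (affineLift_ne_zero hp) = p := by
  conv_rhs => rw [← p.mk_rep]
  rw [Projectivization.mk_eq_mk_iff']
  exact ⟨(p.rep k)⁻¹, rfl⟩

theorem pt_smul {n : ℕ} {z : Fin (n + 1) → ℂ} (hz : z ≠ 0) {a : ℂ} (h : a • z ≠ 0) :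
    pt (a • z) h = pt z hz := by
  rw [Projectivization.mk_eq_mk_iff']
  exact ⟨a, rfl⟩

theorem affineLift_change {n : ℕ} {k k' : Fin (n + 1)} {p : PSpace n} (hp : p ∈ affineChart k) :
    affineLift k' p = (affineLift k p k')⁻¹ • affineLift k p := by
  conv_lhs => rw [← pt_affineLift hp]
  rw [affineLift_pt]

theorem continuous_pt {n : ℕ} :
    Continuous fun z : {z : Fin (n + 1) → ℂ // z ≠ 0} => pt z.1 z.2 :=
  continuous_coinduced_rng

theorem continuous_pt_comp {n : ℕ} {E : Type*} [TopologicalSpace E] {w : E → (Fin (n + 1) → ℂ)}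
    (hw : Continuous w) (h0 : ∀ x, w x ≠ 0) : Continuous fun x => pt (w x) (h0 x) :=
  continuous_pt.comp (hw.subtype_mk h0)

theorem isOpen_cone {n : ℕ} {V : Set (PSpace n)} (hV : IsOpen V) : IsOpen (cone V) := by
  have h1 : cone V = Subtype.val ''
      ((fun z : {z : Fin (n + 1) → ℂ // z ≠ 0} => pt z.1 z.2) ⁻¹' V) := by
    ext z
    constructor
    · rintro ⟨hz, h⟩; exact ⟨⟨z, hz⟩, h, rfl⟩
    · rintro ⟨⟨z, hz⟩, h, rfl⟩; exact ⟨hz, h⟩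
  rw [h1]
  exact (isOpen_compl_singleton (x := (0 : Fin (n + 1) → ℂ))).isOpenMap_subtype_val _
    (hV.preimage continuous_pt)

theorem isOpen_affineChart {n : ℕ} (k : Fin (n + 1)) :
    IsOpen (affineChart k : Set (PSpace n)) := by
  refine isOpen_coinduced.2 ?_
  have : (fun z : {z : Fin (n + 1) → ℂ // z ≠ 0} => pt z.1 z.2) ⁻¹' affineChart k =
      {z | z.1 k ≠ 0} := by
    ext z; exact pt_mem_affineChart z.2
  rw [this]
  exact isOpen_ne_fun ((continuous_apply k).comp continuous_subtype_val) continuous_const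

theorem cone_affineChart {n : ℕ} (k : Fin (n + 1)) :
    cone (affineChart k : Set (PSpace n)) = {z | z k ≠ 0} := by
  ext z
  constructor
  · rintro ⟨hz, h⟩; exact (pt_mem_affineChart hz).1 h
  · intro h
    have hz : z ≠ 0 := by rintro rfl; exact h rfl
    exact ⟨hz, (pt_mem_affineChart hz).2 h⟩

theorem coneLift_of_ne_zero {n : ℕ} (h : PSpace n → ℂ) {z : Fin (n + 1) → ℂ} (hz : z ≠ 0) :
    coneLift h z = h (pt z hz) := by
  rw [coneLift, dif_pos hz]

theorem holomorphicOn_affineLift {n : ℕ} (k i : Fin (n + 1)) :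
    HolomorphicOn (fun p : PSpace n => affineLift k p i) (affineChart k) := by
  rw [HolomorphicOn, cone_affineChart]
  have h1 : DifferentiableOn ℂ (fun z : Fin (n + 1) → ℂ => (z k)⁻¹ * z i) {z | z k ≠ 0} :=
    ((differentiable_apply k).differentiableOn.inv fun z hz => hz).mul
      (differentiable_apply i).differentiableOn
  refine h1.congr fun z hz => ?_
  have hz0 : z ≠ 0 := by rintro rfl; exact hz rfl
  rw [coneLift_of_ne_zero _ hz0, affineLift_pt]
  rfl

section Charts

variable {n : ℕ} {M : Type*} [TopologicalSpace M] [ChartedSpace (Fin n → ℂ) M]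
  [IsManifold 𝓘(ℂ, Fin n → ℂ) ω M]

/-- Functions holomorphic on a part of `M` are holomorphic in the charts of the atlas. -/
theorem differentiableOn_comp_symm {F : Type*} [NormedAddCommGroup F] [NormedSpace ℂ F]
    {f : M → F} {s : Set M} (hf : MDifferentiableOn 𝓘(ℂ, Fin n → ℂ) 𝓘(ℂ, F) f s)
    {e : OpenPartialHomeomorph M (Fin n → ℂ)} (he : e ∈ atlas (Fin n → ℂ) M) :
    DifferentiableOn ℂ (f ∘ e.symm) (e.target ∩ e.symm ⁻¹' s) := by
  rw [← mdifferentiableOn_iff_differentiableOn]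
  refine MDifferentiableOn.comp (I' := 𝓘(ℂ, Fin n → ℂ)) (u := s) hf ?_ fun y hy => hy.2
  have := (mdifferentiable_of_mem_atlas (I := 𝓘(ℂ, Fin n → ℂ)) he).2
  exact this.mono fun y hy => hy.1

theorem mdifferentiableOn_of_charts {F : Type*} [NormedAddCommGroup F] [NormedSpace ℂ F]
    {f : M → F} {s : Set M}
    (h : ∀ x ∈ s, ∃ e ∈ atlas (Fin n → ℂ) M, x ∈ e.source ∧
      DifferentiableAt ℂ (f ∘ e.symm) (e x)) :
    MDifferentiableOn 𝓘(ℂ, Fin n → ℂ) 𝓘(ℂ, F) f s := by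
  intro x hx
  obtain ⟨e, he, hxe, hd⟩ := h x hx
  have h1 : MDifferentiableAt 𝓘(ℂ, Fin n → ℂ) 𝓘(ℂ, Fin n → ℂ) e x :=
    ((mdifferentiable_of_mem_atlas (I := 𝓘(ℂ, Fin n → ℂ)) he).1 x hxe).mdifferentiableAt
      (e.open_source.mem_nhds hxe)
  have h2 : MDifferentiableAt 𝓘(ℂ, Fin n → ℂ) 𝓘(ℂ, F) (f ∘ e.symm) (e x) :=
    hd.mdifferentiableAt
  refine ((h2.comp x h1).congr_of_eventuallyEq ?_).mdifferentiableWithinAt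
  filter_upwards [e.open_source.mem_nhds hxe] with y hy
  simp [e.left_inv hy]

end Charts

/-! ### Uniformizations in charts -/

section Uniformization

variable {n : ℕ} {M : Type*} [TopologicalSpace M] [ChartedSpace (Fin n → ℂ) M]

/-- In the chart `e` of `M`, the lift of `φ : M → ℙⁿ` to `ℂⁿ⁺¹` with `k`-th coordinate `1`. -/
def localLift (φ : M → PSpace n) (k : Fin (n + 1)) (e : OpenPartialHomeomorph M (Fin n → ℂ))
    (y : Fin n → ℂ) : Fin (n + 1) → ℂ := affineLift k (φ (e.symm y))

/-- The open set on which `localLift φ k e` is holomorphic. -/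
def liftDomain (φ : M → PSpace n) (k : Fin (n + 1)) (e : OpenPartialHomeomorph M (Fin n → ℂ)) :
    Set (Fin n → ℂ) := e.target ∩ e.symm ⁻¹' (φ ⁻¹' affineChart k)

/-- The permutation `g` of `M` in the charts `e` and `e'`. -/
def inCharts (g : Equiv.Perm M) (e e' : OpenPartialHomeomorph M (Fin n → ℂ)) (y : Fin n → ℂ) :
    Fin n → ℂ := e' (g (e.symm y))

/-- The set on which `inCharts g e e'` represents `g`. -/
def inChartsDomain (g : Equiv.Perm M) (e e' : OpenPartialHomeomorph M (Fin n → ℂ)) :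
    Set (Fin n → ℂ) := e.target ∩ e.symm ⁻¹' (g ⁻¹' e'.source)

omit [ChartedSpace (Fin n → ℂ) M] in
theorem inCharts_inv_inCharts {g : Equiv.Perm M} {e e' : OpenPartialHomeomorph M (Fin n → ℂ)}
    {y : Fin n → ℂ} (hy : y ∈ inChartsDomain g e e') :
    inCharts g⁻¹ e' e (inCharts g e e' y) = y := by
  have h1 : e'.symm (e' (g (e.symm y))) = g (e.symm y) := e'.left_inv hy.2
  rw [inCharts, inCharts, h1, show g⁻¹ (g (e.symm y)) = e.symm y from g.symm_apply_apply _,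
    e.right_inv hy.1]

omit [ChartedSpace (Fin n → ℂ) M] in
theorem inCharts_mem {g : Equiv.Perm M} {e e' : OpenPartialHomeomorph M (Fin n → ℂ)}
    {y : Fin n → ℂ} (hy : y ∈ inChartsDomain g e e') :
    inCharts g e e' y ∈ inChartsDomain g⁻¹ e' e := by
  have h1 : e'.symm (e' (g (e.symm y))) = g (e.symm y) := e'.left_inv hy.2
  refine ⟨e'.map_source hy.2, ?_⟩
  rw [mem_preimage, mem_preimage, inCharts, h1,
    show g⁻¹ (g (e.symm y)) = e.symm y from g.symm_apply_apply _]
  exact e.map_target hy.1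

variable {G : Subgroup (Equiv.Perm M)} {φ : M → PSpace n} {b : PSpace n → ℕ}

namespace IsUniformization

section Charts

variable (hU : IsUniformization G φ b)
include hU

theorem continuous_perm {g : Equiv.Perm M} (hg : g ∈ G) : Continuous g :=
  haveI := hU.complexManifold.manifold
  (hU.holomorphic_action g hg).continuous

theorem map_perm {g : Equiv.Perm M} (hg : g ∈ G) (x : M) : φ (g x) = φ x :=
  ((hU.fibres x (g x)).2 ⟨g, hg, rfl⟩).symm

theorem isOpen_liftDomain (k : Fin (n + 1)) (e : OpenPartialHomeomorph M (Fin n → ℂ)) :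
    IsOpen (liftDomain φ k e) :=
  e.isOpen_inter_preimage_symm ((isOpen_affineChart k).preimage hU.quotientMap.continuous)

theorem isOpen_inChartsDomain {g : Equiv.Perm M} (hg : g ∈ G)
    (e e' : OpenPartialHomeomorph M (Fin n → ℂ)) : IsOpen (inChartsDomain g e e') :=
  e.isOpen_inter_preimage_symm (e'.open_source.preimage (hU.continuous_perm hg))

theorem differentiableOn_localLift (k : Fin (n + 1)) {e : OpenPartialHomeomorph M (Fin n → ℂ)}
    (he : e ∈ atlas (Fin n → ℂ) M) :
    DifferentiableOn ℂ (localLift φ k e) (liftDomain φ k e) := by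
  have := hU.complexManifold.manifold
  refine differentiableOn_pi.2 fun i => ?_
  have h1 := (hU.structureSheaf _ (isOpen_affineChart k) _).1 (holomorphicOn_affineLift k i)
  exact differentiableOn_comp_symm h1 he

theorem differentiableOn_inCharts {g : Equiv.Perm M} (hg : g ∈ G)
    {e e' : OpenPartialHomeomorph M (Fin n → ℂ)} (he : e ∈ atlas (Fin n → ℂ) M)
    (he' : e' ∈ atlas (Fin n → ℂ) M) :
    DifferentiableOn ℂ (inCharts g e e') (inChartsDomain g e e') := by
  have := hU.complexManifold.manifold
  have h1 : MDifferentiableOn 𝓘(ℂ, Fin n → ℂ) 𝓘(ℂ, Fin n → ℂ) (e' ∘ g) (g ⁻¹' e'.source) :=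
    (mdifferentiableOn_atlas he').comp (hU.holomorphic_action g hg).mdifferentiableOn
      fun x hx => hx
  exact differentiableOn_comp_symm h1 he

theorem det_inCharts_ne_zero {g : Equiv.Perm M} (hg : g ∈ G)
    {e e' : OpenPartialHomeomorph M (Fin n → ℂ)} (he : e ∈ atlas (Fin n → ℂ) M)
    (he' : e' ∈ atlas (Fin n → ℂ) M) {y : Fin n → ℂ} (hy : y ∈ inChartsDomain g e e') :
    (fderiv ℂ (inCharts g e e') y).det ≠ 0 := by
  have h1 := ((hU.differentiableOn_inCharts (G.inv_mem hg) he' he).differentiableAt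
    ((hU.isOpen_inChartsDomain (G.inv_mem hg) e' e).mem_nhds (inCharts_mem hy))).hasFDerivAt
  have h2 := ((hU.differentiableOn_inCharts hg he he').differentiableAt
    ((hU.isOpen_inChartsDomain hg e e').mem_nhds hy)).hasFDerivAt
  have h3 : inCharts g⁻¹ e' e ∘ inCharts g e e' =ᶠ[𝓝 y] id := by
    filter_upwards [(hU.isOpen_inChartsDomain hg e e').mem_nhds hy] with y' hy'
    exact inCharts_inv_inCharts hy'
  have h4 := ((h1.comp y h2).congr_of_eventuallyEq h3.symm).unique (hasFDerivAt_id y)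
  have h5 := congrArg ContinuousLinearMap.det h4
  intro h6
  rw [ContinuousLinearMap.det, ContinuousLinearMap.toLinearMap_comp, LinearMap.det_comp] at h5
  change _ * (fderiv ℂ (inCharts g e e') y).det = LinearMap.det LinearMap.id at h5
  rw [h6, mul_zero, LinearMap.det_id] at h5
  exact zero_ne_one h5

/-- By invariance of `φ`, its local lifts at `x` and `g x` are related by the coordinate expression
of `g`. -/
theorem wronskian_inCharts {g : Equiv.Perm M} (hg : g ∈ G) (k : Fin (n + 1))
    {e e' : OpenPartialHomeomorph M (Fin n → ℂ)} (he : e ∈ atlas (Fin n → ℂ) M)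
    (he' : e' ∈ atlas (Fin n → ℂ) M) {y : Fin n → ℂ} (hy : y ∈ inChartsDomain g e e')
    (hyk : y ∈ liftDomain φ k e) :
    wronskian (localLift φ k e) y = (fderiv ℂ (inCharts g e e') y).det *
      wronskian (localLift φ k e') (inCharts g e e' y) := by
  have hev : ∀ y ∈ inChartsDomain g e e', φ (e'.symm (inCharts g e e' y)) = φ (e.symm y) := by
    intro y hy
    rw [inCharts, e'.left_inv hy.2, hU.map_perm hg]
  have h1 : localLift φ k e =ᶠ[𝓝 y] localLift φ k e' ∘ inCharts g e e' := by
    filter_upwards [(hU.isOpen_inChartsDomain hg e e').mem_nhds hy] with y' hy'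
    rw [Function.comp_apply, localLift, localLift, hev y' hy']
  have h2 : inCharts g e e' y ∈ liftDomain φ k e' := by
    refine ⟨e'.map_source hy.2, ?_⟩
    rw [mem_preimage, mem_preimage, hev y hy]
    exact hyk.2
  rw [wronskian_congr h1, wronskian_comp]
  · exact (hU.differentiableOn_localLift k he').differentiableAt
      ((hU.isOpen_liftDomain k e').mem_nhds h2)
  · exact (hU.differentiableOn_inCharts hg he he').differentiableAt
      ((hU.isOpen_inChartsDomain hg e e').mem_nhds hy)

/-- The lifts with `k`-th and with `k'`-th coordinate `1` have proportional wronskians. -/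
theorem wronskian_change {k k' : Fin (n + 1)} {e : OpenPartialHomeomorph M (Fin n → ℂ)}
    (he : e ∈ atlas (Fin n → ℂ) M) {y : Fin n → ℂ} (hyk : y ∈ liftDomain φ k e)
    (hyk' : y ∈ liftDomain φ k' e) :
    wronskian (localLift φ k' e) y =
      ((localLift φ k e y k')⁻¹) ^ (n + 1) * wronskian (localLift φ k e) y := by
  have h0 : localLift φ k e y k' ≠ 0 := by
    have h1 := affineLift_self hyk'.2
    rw [affineLift_change (k := k) hyk.2] at h1
    intro h2
    rw [localLift] at h2
    rw [h2] at h1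
    simp at h1
  have h1 : localLift φ k' e =ᶠ[𝓝 y]
      fun y => (localLift φ k e y k')⁻¹ • localLift φ k e y := by
    filter_upwards [(hU.isOpen_liftDomain k e).mem_nhds hyk] with y' hy'
    exact affineLift_change hy'.2
  have hd := (hU.differentiableOn_localLift k he).differentiableAt
    ((hU.isOpen_liftDomain k e).mem_nhds hyk)
  rw [wronskian_congr h1]
  exact wronskian_smul hd ((differentiableAt_pi.1 hd k').inv h0) (inv_ne_zero h0)

end Charts

end IsUniformization

/-- The coefficient of the `n`-form `φ^* (∑ (-1)ⁱ xᵢ dx₀ ∧ ⋯ ∧ dxᵢ₋₁ ∧ dxᵢ₊₁ ∧ ⋯ ∧ dxₙ)`, where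
`x = z / z_k`, with respect to the nowhere vanishing `n`-form `f` of `M`. -/
def jacobian (φ : M → PSpace n)
    (f : OpenPartialHomeomorph M (Fin n → ℂ) → (Fin n → ℂ) → ℂ) (k : Fin (n + 1)) (x : M) : ℂ :=
  wronskian (localLift φ k (chartAt (Fin n → ℂ) x)) (chartAt (Fin n → ℂ) x x) /
    f (chartAt (Fin n → ℂ) x) (chartAt (Fin n → ℂ) x x)

namespace IsUniformization

variable (hU : IsUniformization G φ b)
  {f : OpenPartialHomeomorph M (Fin n → ℂ) → (Fin n → ℂ) → ℂ}
  (hf : IsNowhereZeroTopForm n M f)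
include hU

omit [ChartedSpace (Fin n → ℂ) M] hU in
theorem apply_mem_liftDomain {e : OpenPartialHomeomorph M (Fin n → ℂ)} {x : M} (hx : x ∈ e.source)
    {k : Fin (n + 1)} (hk : φ x ∈ affineChart k) : e x ∈ liftDomain φ k e := by
  refine ⟨e.map_source hx, ?_⟩
  rw [mem_preimage, e.left_inv hx]
  exact hk

include hf

/-- The Jacobian does not depend on the chart. -/
theorem jacobian_eq {e : OpenPartialHomeomorph M (Fin n → ℂ)} (he : e ∈ atlas (Fin n → ℂ) M)
    {x : M} (hx : x ∈ e.source) {k : Fin (n + 1)} (hk : φ x ∈ affineChart k) :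
    jacobian φ f k x = wronskian (localLift φ k e) (e x) / f e (e x) := by
  set e' := chartAt (Fin n → ℂ) x with he'
  have hx' : x ∈ e'.source := mem_chart_source _ x
  have hy : e x ∈ inChartsDomain 1 e e' := by
    refine ⟨e.map_source hx, ?_⟩
    rw [mem_preimage, e.left_inv hx]
    exact hx'
  have h1 : inCharts 1 e e' (e x) = e' x := by
    rw [inCharts, e.left_inv hx]; rfl
  have h2 := hU.wronskian_inCharts G.one_mem k he (chart_mem_atlas _ x) hy
    (apply_mem_liftDomain hx hk)
  have hsrc : e x ∈ (e.symm.trans e').source := by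
    rw [OpenPartialHomeomorph.trans_source]
    refine ⟨e.map_source hx, ?_⟩
    rw [mem_preimage, e.left_inv hx]
    exact hx'
  have h3 := hf.transform e he e' (chart_mem_atlas _ x) (e x) hsrc
  have h4 : ((e.symm.trans e' : OpenPartialHomeomorph (Fin n → ℂ) (Fin n → ℂ)) :
      (Fin n → ℂ) → (Fin n → ℂ)) = inCharts 1 e e' := rfl
  rw [h4, h1] at h3
  rw [← he', h1] at h2
  have h5 : (fderiv ℂ (inCharts 1 e e') (e x)).det ≠ 0 :=
    hU.det_inCharts_ne_zero G.one_mem he (chart_mem_atlas _ x) hy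
  rw [h2, h3, mul_div_mul_left _ _ h5, jacobian]

theorem differentiableAt_jacobian {e : OpenPartialHomeomorph M (Fin n → ℂ)}
    (he : e ∈ atlas (Fin n → ℂ) M) {y : Fin n → ℂ} {k : Fin (n + 1)}
    (hy : y ∈ liftDomain φ k e) :
    DifferentiableAt ℂ (jacobian φ f k ∘ e.symm) y := by
  have hd : DifferentiableAt ℂ (fun y => wronskian (localLift φ k e) y * (f e y)⁻¹) y := by
    have h1 := (differentiableOn_wronskian (hU.isOpen_liftDomain k e)
      (hU.differentiableOn_localLift k he)).differentiableAt
      ((hU.isOpen_liftDomain k e).mem_nhds hy)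
    have h2 := (hf.holomorphic e he).differentiableAt (e.open_target.mem_nhds hy.1)
    exact h1.mul (h2.inv (hf.ne_zero e he y hy.1))
  refine hd.congr_of_eventuallyEq ?_
  filter_upwards [(hU.isOpen_liftDomain k e).mem_nhds hy] with y' hy'
  rw [Function.comp_apply, hU.jacobian_eq hf he (e.map_target hy'.1) hy'.2, e.right_inv hy'.1,
    div_eq_mul_inv]

theorem jacobian_eq_zero_iff {e : OpenPartialHomeomorph M (Fin n → ℂ)}
    (he : e ∈ atlas (Fin n → ℂ) M) {x : M} (hx : x ∈ e.source) {k : Fin (n + 1)}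
    (hk : φ x ∈ affineChart k) :
    jacobian φ f k x = 0 ↔ wronskian (localLift φ k e) (e x) = 0 := by
  rw [hU.jacobian_eq hf he hx hk, div_eq_zero_iff,
    or_iff_left (hf.ne_zero e he _ (e.map_source hx))]

/-- The forms belonging to different affine charts of `ℙⁿ` differ by the transition function of
`𝒪(n + 1)`. -/
theorem jacobian_change {x : M} {z : Fin (n + 1) → ℂ} (hz : z ≠ 0) (hxz : φ x = pt z hz)
    {k k' : Fin (n + 1)} (hk : z k ≠ 0) (hk' : z k' ≠ 0) :
    z k' ^ (n + 1) * jacobian φ f k' x = z k ^ (n + 1) * jacobian φ f k x := by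
  set e := chartAt (Fin n → ℂ) x with he
  have hx : x ∈ e.source := mem_chart_source _ x
  have hak : φ x ∈ affineChart k := by rw [hxz]; exact (pt_mem_affineChart hz).2 hk
  have hak' : φ x ∈ affineChart k' := by rw [hxz]; exact (pt_mem_affineChart hz).2 hk'
  have he' : e ∈ atlas (Fin n → ℂ) M := chart_mem_atlas _ x
  rw [hU.jacobian_eq hf he' hx hak, hU.jacobian_eq hf he' hx hak',
    hU.wronskian_change he' (apply_mem_liftDomain hx hak)
    (apply_mem_liftDomain hx hak')]
  have h1 : localLift φ k e (e x) k' = (z k)⁻¹ * z k' := by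
    rw [localLift, e.left_inv hx, hxz, affineLift_pt]; rfl
  rw [h1, mul_inv, inv_inv, mul_pow, inv_pow]
  have := pow_ne_zero (n + 1) hk'
  field_simp

end IsUniformization

end Uniformization

/-! ### The ramification polynomial -/

section Ramification

variable {n : ℕ} {M : Type*} [TopologicalSpace M] [ChartedSpace (Fin n → ℂ) M]
  {G : Subgroup (Equiv.Perm M)} {φ : M → PSpace n} {b : PSpace n → ℕ}

namespace IsUniformization

/-- A properly discontinuous group of automorphisms of a compact space is finite. -/
theorem finite_group (hU : IsUniformization G φ b) [CompactSpace M] : Finite G := by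
  have := hU.properlyDiscontinuous
  have := hU.complexManifold.connected
  have h1 := ProperlyDiscontinuousSMul.finite_disjoint_inter_image (Γ := G)
    (isCompact_univ (X := M)) isCompact_univ
  refine Set.finite_univ_iff.1 (h1.subset fun g _ => ?_)
  obtain ⟨x⟩ := (inferInstance : Nonempty M)
  have h2 : ((g • ·) '' (univ : Set M) ∩ univ).Nonempty := ⟨g • x, ⟨x, mem_univ _, rfl⟩, mem_univ _⟩
  exact h2

/-- The product of the translates of the pull-back of the form
`∑ (-1)ⁱ zᵢ dz₀ ∧ ⋯ ∧ dzᵢ₋₁ ∧ dzᵢ₊₁ ∧ ⋯ ∧ dzₙ`, relative to a nowhere vanishing `n`-form, descends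
to a homogeneous polynomial: it is a section of `𝒪(|G| (n + 1))`. -/
theorem exists_ramification_polynomial (hU : IsUniformization G φ b) [Fintype G] (hn : 1 ≤ n)
    {f : OpenPartialHomeomorph M (Fin n → ℂ) → (Fin n → ℂ) → ℂ} (hf : IsNowhereZeroTopForm n M f) :
    ∃ P : MvPolynomial (Fin (n + 1)) ℂ, P.IsHomogeneous (Fintype.card G * (n + 1)) ∧
      ∀ (x : M) (z : Fin (n + 1) → ℂ) (hz : z ≠ 0) (k : Fin (n + 1)), φ x = pt z hz → z k ≠ 0 →
        MvPolynomial.eval z P = ∏ g : G, (z k ^ (n + 1) * jacobian φ f k (g.1 x)) := by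
  obtain ⟨σ, hσ⟩ := hU.quotientMap.surjective.hasRightInverse
  -- the invariant function on the `k`-th affine chart
  let q : Fin (n + 1) → PSpace n → ℂ := fun k p => ∏ g : G, jacobian φ f k (g.1 (σ p))
  have hq : ∀ k x, q k (φ x) = ∏ g : G, jacobian φ f k (g.1 x) := by
    intro k x
    obtain ⟨g₀, hg₀, hgx⟩ := (hU.fibres x (σ (φ x))).1 (hσ (φ x)).symm
    change ∏ g : G, jacobian φ f k (g.1 (σ (φ x))) = _
    rw [← hgx]
    exact Fintype.prod_equiv (Equiv.mulRight (⟨g₀, hg₀⟩ : G)) _ _ fun g => rfl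
  have hqh : ∀ k, HolomorphicOn (q k) (affineChart k) := by
    intro k
    have := hU.complexManifold.manifold
    refine (hU.structureSheaf _ (isOpen_affineChart k) _).2 ?_
    refine mdifferentiableOn_of_charts fun x hx => ?_
    set e := chartAt (Fin n → ℂ) x
    refine ⟨e, chart_mem_atlas _ x, mem_chart_source _ x, ?_⟩
    have hxe : x ∈ e.source := mem_chart_source _ x
    have h1 : (q k ∘ φ) ∘ e.symm = fun y => ∏ g : G, (jacobian φ f k ∘ g.1) (e.symm y) := by
      ext y; exact hq k _
    rw [h1]
    have h2 : ∀ g : G, DifferentiableAt ℂ (fun y => (jacobian φ f k ∘ g.1) (e.symm y)) (e x) := by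
      intro g
      set e' := chartAt (Fin n → ℂ) (g.1 x)
      have hy : e x ∈ inChartsDomain g.1 e e' := by
        refine ⟨e.map_source hxe, ?_⟩
        rw [mem_preimage, e.left_inv hxe]
        exact mem_chart_source _ _
      have h3 : inCharts g.1 e e' (e x) ∈ liftDomain φ k e' := by
        rw [inCharts, e.left_inv hxe]
        refine apply_mem_liftDomain (mem_chart_source _ _) ?_
        rw [hU.map_perm g.2]; exact hx
      have h4 : DifferentiableAt ℂ ((jacobian φ f k ∘ e'.symm) ∘ inCharts g.1 e e') (e x) :=
        (hU.differentiableAt_jacobian hf (chart_mem_atlas _ _) h3).comp _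
          ((hU.differentiableOn_inCharts g.2 (chart_mem_atlas _ _)
            (chart_mem_atlas _ _)).differentiableAt
            ((hU.isOpen_inChartsDomain g.2 e e').mem_nhds hy))
      refine h4.congr_of_eventuallyEq ?_
      filter_upwards [(hU.isOpen_inChartsDomain g.2 e e').mem_nhds hy] with y hy'
      rw [Function.comp_apply, Function.comp_apply, Function.comp_apply, inCharts,
        e'.left_inv hy'.2]
    exact differentiableWithinAt_univ.1
      (differentiableWithinAt_finsetProd _ fun g _ => (h2 g).differentiableWithinAt)
  have hN : 0 < Fintype.card G := Fintype.card_pos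
  set D := Fintype.card G * (n + 1) with hD
  have hD2 : 2 ≤ D := by
    rw [hD]; nlinarith
  have hval : ∀ (x : M) (z : Fin (n + 1) → ℂ) (hz : z ≠ 0) (k : Fin (n + 1)), φ x = pt z hz →
      z k ^ D * q k (pt z hz) = ∏ g : G, (z k ^ (n + 1) * jacobian φ f k (g.1 x)) := by
    intro x z hz k hx
    rw [← hx, hq, Finset.prod_mul_distrib, Finset.prod_const, Finset.card_univ, ← pow_mul, hD,
      mul_comm (n + 1)]
  -- the local definitions on the cones over the affine charts agree
  have hind : ∀ (z : Fin (n + 1) → ℂ) (hz : z ≠ 0) (k k' : Fin (n + 1)), z k ≠ 0 → z k' ≠ 0 →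
      z k ^ D * q k (pt z hz) = z k' ^ D * q k' (pt z hz) := by
    intro z hz k k' hk hk'
    rw [hval _ z hz k (hσ (pt z hz)), hval _ z hz k' (hσ (pt z hz))]
    refine Finset.prod_congr rfl fun g _ => ?_
    refine hU.jacobian_change hf hz ?_ hk' hk
    rw [hU.map_perm g.2]
    exact hσ _
  have hex : ∀ z : Fin (n + 1) → ℂ, z ≠ 0 → ∃ k, z k ≠ 0 := fun z hz => Function.ne_iff.1 hz
  classical
  let P : (Fin (n + 1) → ℂ) → ℂ := fun z =>
    if hz : z ≠ 0 then z (hex z hz).choose ^ D * q (hex z hz).choose (pt z hz) else 0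
  have hP : ∀ (z : Fin (n + 1) → ℂ) (hz : z ≠ 0) (k : Fin (n + 1)), z k ≠ 0 →
      P z = z k ^ D * q k (pt z hz) := by
    intro z hz k hk
    simp only [P, dif_pos hz]
    exact hind z hz _ _ (hex z hz).choose_spec hk
  have hP0 : P 0 = 0 := by simp [P]
  have hPd : DifferentiableOn ℂ P {0}ᶜ := by
    intro z hz
    obtain ⟨k, hk⟩ := hex z hz
    have ho : IsOpen {z : Fin (n + 1) → ℂ | z k ≠ 0} :=
      isOpen_ne_fun (continuous_apply k) continuous_const
    have h1 := hqh k
    rw [HolomorphicOn, cone_affineChart] at h1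
    have h2 : DifferentiableAt ℂ (fun z => z k ^ D * coneLift (q k) z) z :=
      ((differentiableAt_apply k z).pow D).mul (h1.differentiableAt (ho.mem_nhds hk))
    refine (h2.congr_of_eventuallyEq ?_).differentiableWithinAt
    filter_upwards [ho.mem_nhds hk] with w hw
    have hw0 : w ≠ 0 := by rintro rfl; exact hw rfl
    rw [hP w hw0 k hw, coneLift_of_ne_zero _ hw0]
  have hhom : ∀ (c : ℂ) z, P (c • z) = c ^ D * P z := by
    intro c z
    by_cases hz : z = 0
    · rw [hz, smul_zero, hP0, mul_zero]
    by_cases hc : c = 0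
    · rw [hc, zero_smul, hP0, zero_pow (by omega), zero_mul]
    obtain ⟨k, hk⟩ := hex z hz
    have hcz : c • z ≠ 0 := smul_ne_zero hc hz
    rw [hP z hz k hk, hP (c • z) hcz k (mul_ne_zero hc hk), pt_smul hz hcz, Pi.smul_apply,
      smul_eq_mul, mul_pow, mul_assoc]
  obtain ⟨p, hp1, hp2⟩ := exists_mvPolynomial_of_homogeneous
    (differentiable_of_homogeneous hPd hD2 hhom) hhom
  refine ⟨p, hp1, fun x z hz k hx hk => ?_⟩
  rw [hp2, hP z hz k hk, hval x z hz k hx]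

/-- An element of `G` which fixes all points near a given one is trivial, by the identity
theorem. -/
theorem eq_one_of_eventually_fixed (hU : IsUniformization G φ b) {g : Equiv.Perm M} (hg : g ∈ G)
    {x : M} (hx : ∀ᶠ y in 𝓝 x, g y = y) : g = 1 := by
  have := hU.complexManifold.connected
  have := hU.complexManifold.t2
  set S : Set M := {x | ∀ᶠ y in 𝓝 x, g y = y} with hS
  have hSo : IsOpen S := by
    rw [isOpen_iff_mem_nhds]
    intro y hy
    exact eventually_eventually_nhds.2 hy
  -- at a point of the closure of `S`, the identity theorem applies on a ball in a chart
  have hSc : IsClosed S := by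
    refine isClosed_of_closure_subset fun x hx => ?_
    have hfix : g x = x := by
      have h1 : IsClosed {y | g y = y} := isClosed_eq (hU.continuous_perm hg) continuous_id
      exact h1.closure_subset_iff.2 (fun y hy => hy.self_of_nhds) hx
    set e := chartAt (Fin n → ℂ) x with he
    have hxe : x ∈ e.source := mem_chart_source _ x
    have hea : e ∈ atlas (Fin n → ℂ) M := chart_mem_atlas _ x
    have hy : e x ∈ inChartsDomain g e e := by
      refine ⟨e.map_source hxe, ?_⟩
      rw [mem_preimage, e.left_inv hxe, mem_preimage, hfix]
      exact hxe
    obtain ⟨r, hr, hball⟩ := Metric.isOpen_iff.1 (hU.isOpen_inChartsDomain hg e e) _ hy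
    have hV : e.source ∩ e ⁻¹' ball (e x) r ∈ 𝓝 x :=
      inter_mem (e.open_source.mem_nhds hxe)
        ((e.continuousAt hxe).preimage_mem_nhds (ball_mem_nhds _ hr))
    obtain ⟨s, ⟨hse, hsb⟩, hsS⟩ := mem_closure_iff_nhds.1 hx _ hV
    have hT := hU.differentiableOn_inCharts hg hea hea
    have hTs : ∀ᶠ y in 𝓝 (e s), inCharts g e e y = y := by
      have h1 : ContinuousAt e.symm (e s) := e.continuousAt_symm (e.map_source hse)
      have h2 : ∀ᶠ y in 𝓝 (e s), g (e.symm y) = e.symm y := by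
        refine h1.tendsto.eventually (p := fun x => g x = x) ?_
        rw [e.left_inv hse]
        exact hsS
      filter_upwards [h2, e.open_target.mem_nhds (e.map_source hse)] with y h3 h4
      rw [inCharts, h3, e.right_inv h4]
    have hTb : ∀ y ∈ ball (e x) r, inCharts g e e y = y := by
      intro y hyb
      -- restrict to the complex line through `e s` and `y`
      set a := e s with ha
      let γ : ℂ → (Fin n → ℂ) := fun t => a + t • (y - a)
      have hγ : Differentiable ℂ γ := by fun_prop
      have hconv : Convex ℝ (γ ⁻¹' ball (e x) r) := by
        intro t ht u hu α β hα hβ hαβ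
        have h2 : γ (α • t + β • u) = α • γ t + β • γ u := by
          ext i
          simp only [γ, Pi.add_apply, Pi.smul_apply, Pi.sub_apply, smul_eq_mul, Complex.real_smul]
          have h3 : (α : ℂ) + β = 1 := by exact_mod_cast hαβ
          linear_combination (-(a i)) * h3
        rw [mem_preimage, h2]
        exact convex_ball (e x) r ht hu hα hβ hαβ
      have hopen : IsOpen (γ ⁻¹' ball (e x) r) := isOpen_ball.preimage hγ.continuous
      have hd : DifferentiableOn ℂ (fun t => inCharts g e e (γ t) - γ t) (γ ⁻¹' ball (e x) r) :=
        (hT.comp hγ.differentiableOn fun t ht => hball ht).sub hγ.differentiableOn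
      have hγ0 : γ 0 = a := by simp [γ]
      have hγ1 : γ 1 = y := by simp [γ]
      have h0 : (0 : ℂ) ∈ γ ⁻¹' ball (e x) r := by rw [mem_preimage, hγ0]; exact hsb
      have h1 : (1 : ℂ) ∈ γ ⁻¹' ball (e x) r := by rw [mem_preimage, hγ1]; exact hyb
      have hz : (fun t => inCharts g e e (γ t) - γ t) =ᶠ[𝓝 0] 0 := by
        have h2 : Tendsto γ (𝓝 0) (𝓝 a) := by
          have := hγ.continuous.tendsto 0
          rwa [hγ0] at this
        filter_upwards [h2.eventually hTs] with t ht
        simp [ht]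
      have h3 := (hd.analyticOnNhd hopen).eqOn_zero_of_preconnected_of_eventuallyEq_zero
        hconv.isPreconnected h0 hz h1
      simp only [hγ1, Pi.zero_apply] at h3
      exact sub_eq_zero.1 h3
    rw [hS, mem_ofPred_eq]
    filter_upwards [hV] with w hw
    have h1 := hTb (e w) hw.2
    have h2 : (e w) ∈ inChartsDomain g e e := hball hw.2
    rw [inCharts, e.left_inv hw.1] at h1
    have h3 := h2.2
    rw [mem_preimage, e.left_inv hw.1] at h3
    exact e.injOn h3 hw.1 h1
  have hSu : S = univ := IsClopen.eq_univ ⟨hSc, hSo⟩ ⟨x, hx⟩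
  ext y
  have : y ∈ S := by rw [hSu]; exact mem_univ y
  exact this.self_of_nhds

theorem isOpenMap (hU : IsUniformization G φ b) : IsOpenMap φ := by
  intro W hW
  rw [← hU.quotientMap.isOpen_preimage]
  have h1 : φ ⁻¹' (φ '' W) = ⋃ g ∈ G, (g : M → M) ⁻¹' W := by
    ext x
    simp only [mem_preimage, mem_image, mem_iUnion]
    constructor
    · rintro ⟨y, hy, hyx⟩
      obtain ⟨g, hg, rfl⟩ := (hU.fibres x y).1 hyx.symm
      exact ⟨g, hg, hy⟩
    · rintro ⟨g, hg, hy⟩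
      exact ⟨g x, hy, hU.map_perm hg x⟩
  rw [h1]
  exact isOpen_biUnion fun g hg => hW.preimage (hU.continuous_perm hg)

/-- Only elements of the isotropy group of `x` move points within a small neighbourhood of `x`. -/
theorem exists_open_nhds (hU : IsUniformization G φ b) (x : M) :
    ∃ W, IsOpen W ∧ x ∈ W ∧ ∀ g ∈ G, ∀ y ∈ W, g y ∈ W → g x = x := by
  have := hU.complexManifold.t2
  have := hU.properlyDiscontinuous
  have : LocallyCompactSpace M := ChartedSpace.locallyCompactSpace (Fin n → ℂ) M
  have : ContinuousConstSMul G M := ⟨fun g => hU.continuous_perm g.2⟩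
  obtain ⟨W, hW, h⟩ := ProperlyDiscontinuousSMul.exists_nhds_image_smul_eq_self G x
  refine ⟨interior W, isOpen_interior, mem_interior_iff_mem_nhds.2 hW, fun g hg y hy hgy => ?_⟩
  exact h ⟨g, hg⟩ ⟨g y, ⟨y, interior_subset hy, rfl⟩, interior_subset hgy⟩

end IsUniformization

end Ramification

/-! ### The zero set of the Jacobian -/

section ZeroSet

variable {n : ℕ} {M : Type*} [TopologicalSpace M] [ChartedSpace (Fin n → ℂ) M]
  {G : Subgroup (Equiv.Perm M)} {φ : M → PSpace n} {b : PSpace n → ℕ}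

namespace IsUniformization

/-- At a point with trivial isotropy the map `φ` is a local biholomorphism: it is locally injective,
and by the description of the structure sheaf of `M / G` the coordinates of `M`, as functions on
`ℙⁿ`, are holomorphic. -/
theorem wronskian_ne_zero (hU : IsUniformization G φ b) {x : M}
    (hx : ∀ g ∈ G, g x = x → g = 1) {e : OpenPartialHomeomorph M (Fin n → ℂ)}
    (he : e ∈ atlas (Fin n → ℂ) M) (hxe : x ∈ e.source) {k : Fin (n + 1)}
    (hk : φ x ∈ affineChart k) : wronskian (localLift φ k e) (e x) ≠ 0 := by
  have := hU.complexManifold.manifold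
  obtain ⟨W₀, hW₀o, hxW₀, hW₀⟩ := hU.exists_open_nhds x
  set W := W₀ ∩ e.source with hWdef
  have hWo : IsOpen W := hW₀o.inter e.open_source
  have hxW : x ∈ W := ⟨hxW₀, hxe⟩
  have hW : ∀ g ∈ G, ∀ y ∈ W, g y ∈ W → g = 1 := fun g hg y hy hgy =>
    hx g hg (hW₀ g hg y hy.1 hgy.1)
  have hinj : ∀ y ∈ W, ∀ y' ∈ W, φ y = φ y' → y = y' := by
    intro y hy y' hy' h
    obtain ⟨g, hg, rfl⟩ := (hU.fibres y y').1 h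
    rw [hW g hg y hy hy']
    rfl
  set V := φ '' W with hV
  have hVo : IsOpen V := hU.isOpenMap W hWo
  -- the local inverse of `φ` over `V`
  have hτ : ∀ p : PSpace n, ∃ y : M, p ∈ V → y ∈ W ∧ φ y = p := by
    intro p
    by_cases hp : p ∈ V
    · obtain ⟨y, hy, hyp⟩ := hp
      exact ⟨y, fun _ => ⟨hy, hyp⟩⟩
    · exact ⟨x, fun h => absurd h hp⟩
  choose τ hτ using hτ
  have hτφ : ∀ y ∈ W, τ (φ y) = y := by
    intro y hy
    have h1 := hτ (φ y) ⟨y, hy, rfl⟩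
    exact hinj _ h1.1 _ hy h1.2
  have hhol : ∀ j, HolomorphicOn (fun p => e (τ p) j) V := by
    intro j
    refine (hU.structureSheaf V hVo _).2 (mdifferentiableOn_of_charts fun x' hx' => ?_)
    obtain ⟨y, hy, hyx⟩ := hx'
    obtain ⟨g, hg, rfl⟩ := (hU.fibres x' y).1 hyx.symm
    set e' := chartAt (Fin n → ℂ) x'
    have hxe' : x' ∈ e'.source := mem_chart_source _ x'
    refine ⟨e', chart_mem_atlas _ x', hxe', ?_⟩
    have hmem : e' x' ∈ inChartsDomain g e' e := by
      refine ⟨e'.map_source hxe', ?_⟩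
      rw [mem_preimage, e'.left_inv hxe']
      exact hy.2
    have hd := (hU.differentiableOn_inCharts hg (chart_mem_atlas _ x') he).differentiableAt
      ((hU.isOpen_inChartsDomain hg e' e).mem_nhds hmem)
    refine (differentiableAt_pi.1 hd j).congr_of_eventuallyEq ?_
    have hWg : IsOpen ((g : M → M) ⁻¹' W) := hWo.preimage (hU.continuous_perm hg)
    filter_upwards [(e'.isOpen_inter_preimage_symm hWg).mem_nhds
      ⟨e'.map_source hxe', by rw [mem_preimage, e'.left_inv hxe']; exact hy⟩] with w hw
    change e (τ (φ (e'.symm w))) j = e (g (e'.symm w)) j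
    rw [← hU.map_perm hg, hτφ _ hw.2]
  set Z := localLift φ k e with hZ
  set y₀ := e x with hy₀
  have hy₀L : y₀ ∈ liftDomain φ k e := apply_mem_liftDomain hxe hk
  have hZd := (hU.differentiableOn_localLift k he).differentiableAt
    ((hU.isOpen_liftDomain k e).mem_nhds hy₀L)
  -- a left inverse of the parametrization `(s, y) ↦ s • Z y` of the cone, up to the coordinate `s`
  let H : (Fin (n + 1) → ℂ) → (Fin n → ℂ) := fun z j => coneLift (fun p => e (τ p) j) z
  have hpt : ∀ y ∈ liftDomain φ k e, ∀ (s : ℂ), s ≠ 0 → ∃ h0 : s • Z y ≠ 0,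
      pt (s • Z y) h0 = φ (e.symm y) := by
    intro y hy s hs
    have h1 : Z y ≠ 0 := affineLift_ne_zero hy.2
    refine ⟨smul_ne_zero hs h1, ?_⟩
    rw [pt_smul h1]
    exact pt_affineLift hy.2
  have hHd : DifferentiableAt ℂ H (Z y₀) := by
    refine differentiableAt_pi.2 fun j => (hhol j).differentiableAt ((isOpen_cone hVo).mem_nhds ?_)
    obtain ⟨h0, h1⟩ := hpt y₀ hy₀L 1 one_ne_zero
    rw [show e.symm y₀ = x from e.left_inv hxe] at h1
    simp only [one_smul] at h0 h1
    exact ⟨h0, by rw [h1]; exact ⟨x, hxW, rfl⟩⟩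
  set c₀ : Fin (n + 1) → ℂ := Fin.cons 1 y₀ with hc₀
  have htail : Fin.tail c₀ = y₀ := Fin.tail_cons _ _
  have hcont : Continuous fun c : Fin (n + 1) → ℂ => (Fin.tail c : Fin n → ℂ) :=
    (tailL n).continuous
  have hHZ : H ∘ coneMap Z =ᶠ[𝓝 c₀] fun c => Fin.tail c := by
    have h1 : IsOpen (liftDomain φ k e ∩ (e.target ∩ e.symm ⁻¹' W)) :=
      (hU.isOpen_liftDomain k e).inter (e.isOpen_inter_preimage_symm hWo)
    have h2 : y₀ ∈ liftDomain φ k e ∩ (e.target ∩ e.symm ⁻¹' W) := by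
      refine ⟨hy₀L, hy₀L.1, ?_⟩
      rw [mem_preimage, hy₀, e.left_inv hxe]
      exact hxW
    have h3 : (fun c : Fin (n + 1) → ℂ => (Fin.tail c : Fin n → ℂ)) ⁻¹'
        (liftDomain φ k e ∩ (e.target ∩ e.symm ⁻¹' W)) ∈ 𝓝 c₀ :=
      (h1.preimage hcont).mem_nhds (by rw [mem_preimage, htail]; exact h2)
    have h4 : ∀ᶠ c : Fin (n + 1) → ℂ in 𝓝 c₀, c 0 ≠ 0 :=
      (continuous_apply 0).continuousAt.eventually_ne (by simp [hc₀])
    filter_upwards [h3, h4] with c hc hc0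
    obtain ⟨h0, h5⟩ := hpt _ hc.1 (c 0) hc0
    ext j
    change coneLift (fun p => e (τ p) j) (c 0 • Z (Fin.tail c)) = Fin.tail c j
    rw [coneLift_of_ne_zero _ h0, h5, hτφ _ hc.2.2, e.right_inv hc.1.1]
  have hΦ : HasFDerivAt (coneMap Z) (consMap (Z y₀) (fderiv ℂ Z y₀)) c₀ := by
    have := hasFDerivAt_coneMap (Z := Z) (c := c₀) (by rw [htail]; exact hZd)
    rw [htail] at this
    simpa [hc₀] using this
  have hcz : coneMap Z c₀ = Z y₀ := by rw [coneMap, htail]; simp [hc₀]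
  have hcomp : HasFDerivAt (H ∘ coneMap Z)
      (fderiv ℂ H (Z y₀) ∘L consMap (Z y₀) (fderiv ℂ Z y₀)) c₀ := by
    refine HasFDerivAt.comp c₀ ?_ hΦ
    rw [hcz]; exact hHd.hasFDerivAt
  have huniq := (hcomp.congr_of_eventuallyEq hHZ.symm).unique (tailL n).hasFDerivAt
  intro hdet
  obtain ⟨v, hv, hv0⟩ := (Submodule.ne_bot_iff _).1 (LinearMap.bot_lt_ker_of_det_eq_zero hdet).ne'
  rw [LinearMap.mem_ker, ContinuousLinearMap.coe_coe] at hv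
  have h1 := congrArg (fun L => L v) huniq
  simp only [ContinuousLinearMap.comp_apply, hv, map_zero, tailL_apply] at h1
  rw [consMap_apply, ← h1, map_zero, add_zero] at hv
  have h2 : v 0 = 0 := (smul_eq_zero.1 hv).resolve_right (affineLift_ne_zero hy₀L.2)
  apply hv0
  ext i
  refine Fin.cases h2 (fun i => ?_) i
  exact (congrFun h1 i).symm

/-- Where the Jacobian does not vanish, `φ` is locally injective. -/
theorem exists_injOn_of_wronskian_ne_zero (hU : IsUniformization G φ b) {x : M}
    {e : OpenPartialHomeomorph M (Fin n → ℂ)}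
    (he : e ∈ atlas (Fin n → ℂ) M) (hxe : x ∈ e.source) {k : Fin (n + 1)}
    (hk : φ x ∈ affineChart k) (hw : wronskian (localLift φ k e) (e x) ≠ 0) :
    ∃ W ∈ 𝓝 x, InjOn φ W := by
  set Z := localLift φ k e with hZ
  set y₀ := e x with hy₀
  have hy₀L : y₀ ∈ liftDomain φ k e := apply_mem_liftDomain hxe hk
  set c₀ : Fin (n + 1) → ℂ := Fin.cons 1 y₀ with hc₀
  have htail : Fin.tail c₀ = y₀ := Fin.tail_cons _ _
  have hcont : Continuous fun c : Fin (n + 1) → ℂ => (Fin.tail c : Fin n → ℂ) :=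
    (tailL n).continuous
  set O := (fun c : Fin (n + 1) → ℂ => (Fin.tail c : Fin n → ℂ)) ⁻¹' liftDomain φ k e
  have hO : IsOpen O := (hU.isOpen_liftDomain k e).preimage hcont
  have hZd : ∀ c ∈ O, DifferentiableAt ℂ Z (Fin.tail c) := fun c hc =>
    (hU.differentiableOn_localLift k he).differentiableAt ((hU.isOpen_liftDomain k e).mem_nhds hc)
  have hΦ : DifferentiableOn ℂ (coneMap Z) O := fun c hc =>
    (hasFDerivAt_coneMap (hZd c hc)).differentiableAt.differentiableWithinAt
  have hc₀O : c₀ ∈ O := by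
    change Fin.tail c₀ ∈ liftDomain φ k e
    rw [htail]; exact hy₀L
  have hdet : (fderiv ℂ (coneMap Z) c₀).det ≠ 0 := by
    rw [det_fderiv_coneMap (hZd _ hc₀O), htail]
    simpa [hc₀] using hw
  obtain ⟨E, hE1, -, hE3, -⟩ := exists_openPartialHomeomorph hO hΦ hc₀O hdet
  have hcons : Continuous fun y : Fin n → ℂ => (Fin.cons 1 y : Fin (n + 1) → ℂ) := by
    refine continuous_pi fun i => ?_
    refine Fin.cases ?_ (fun i => ?_) i
    · simpa using continuous_const
    · simpa using continuous_apply i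
  refine ⟨e.source ∩ e ⁻¹' ((fun y : Fin n → ℂ => (Fin.cons 1 y : Fin (n + 1) → ℂ)) ⁻¹' E.source),
    inter_mem (e.open_source.mem_nhds hxe) ((e.continuousAt hxe).preimage_mem_nhds
      ((E.open_source.preimage hcons).mem_nhds hE1)), ?_⟩
  intro y hy y' hy' h
  have h1 : coneMap Z (Fin.cons 1 (e y)) = coneMap Z (Fin.cons 1 (e y')) := by
    simp only [coneMap, Fin.cons_zero, Fin.tail_cons, hZ, localLift, e.left_inv hy.1,
      e.left_inv hy'.1, h]
  rw [← hE3, ← hE3] at h1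
  have h2 := E.injOn hy.2 hy'.2 h1
  exact e.injOn hy.1 hy'.1 (Fin.cons_right_injective (α := fun _ => ℂ) 1 h2)

theorem isotropy_eq_one_iff (hU : IsUniformization G φ b) (x : M) :
    b (φ x) = 1 ↔ ∀ g ∈ G, g x = x → g = 1 := by
  rw [hU.isotropy, Nat.card_eq_one_iff_unique]
  constructor
  · rintro ⟨h, -⟩ g hg hgx
    have h1 : (⟨⟨g, hg⟩, hgx⟩ : MulAction.stabilizer G x) = 1 := Subsingleton.elim _ _
    exact congrArg (fun a : MulAction.stabilizer G x => a.1.1) h1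
  · intro h
    refine ⟨⟨fun a c => ?_⟩, ⟨1⟩⟩
    have h1 : ∀ a : MulAction.stabilizer G x, a = 1 := fun a =>
      Subtype.ext (Subtype.ext (h a.1.1 a.1.2 a.2))
    rw [h1 a, h1 c]

/-- The Jacobian vanishes exactly at the points with nontrivial isotropy: where it does not vanish,
`φ` is locally injective, so elements of the isotropy group are the identity near the point. -/
theorem jacobian_eq_zero_iff_ne_one (hU : IsUniformization G φ b)
    {f : OpenPartialHomeomorph M (Fin n → ℂ) → (Fin n → ℂ) → ℂ} (hf : IsNowhereZeroTopForm n M f)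
    {x : M} {k : Fin (n + 1)} (hk : φ x ∈ affineChart k) :
    jacobian φ f k x = 0 ↔ b (φ x) ≠ 1 := by
  rw [hU.jacobian_eq_zero_iff hf (chart_mem_atlas _ x) (mem_chart_source _ x) hk,
    ne_eq, hU.isotropy_eq_one_iff]
  constructor
  · intro h h1
    exact hU.wronskian_ne_zero h1 (chart_mem_atlas _ x) (mem_chart_source _ x) hk h
  · intro h
    by_contra h1
    apply h
    intro g hg hgx
    obtain ⟨W, hW, hinj⟩ := hU.exists_injOn_of_wronskian_ne_zero (chart_mem_atlas _ x)
      (mem_chart_source _ x) hk h1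
    have h2 : ∀ᶠ y in 𝓝 x, g y ∈ W := by
      refine (hU.continuous_perm hg).continuousAt.eventually_mem ?_
      rw [hgx]; exact hW
    refine hU.eq_one_of_eventually_fixed hg (x := x) ?_
    filter_upwards [h2, hW] with y h3 h4
    exact hinj h3 h4 (hU.map_perm hg y)

end IsUniformization

end ZeroSet

/-! ### Slices and lifting of discs -/

section Slice

variable {n : ℕ} {M : Type*} [TopologicalSpace M] [ChartedSpace (Fin n → ℂ) M]
  {G : Subgroup (Equiv.Perm M)} {φ : M → PSpace n} {b : PSpace n → ℕ}

/-- `W` is an open neighbourhood of `q`, invariant under the isotropy group of `q` and disjoint from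
its translates by all other elements of `G`. -/
structure IsSlice (G : Subgroup (Equiv.Perm M)) (q : M) (W : Set M) : Prop where
  isOpen : IsOpen W
  mem : q ∈ W
  mapsTo : ∀ g ∈ G, g q = q → ∀ y ∈ W, g y ∈ W
  fixes : ∀ g ∈ G, ∀ y ∈ W, g y ∈ W → g q = q

namespace IsUniformization

/-- Slices exist inside any neighbourhood of `q`: intersect the translates of a small neighbourhood
by the isotropy group. -/
theorem exists_slice (hU : IsUniformization G φ b) [Finite G] (q : M) {U : Set M} (hq : U ∈ 𝓝 q) :
    ∃ W ⊆ U, IsSlice G q W := by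
  obtain ⟨W₀, hW₀o, hqW₀, hW₀⟩ := hU.exists_open_nhds q
  set W₁ := W₀ ∩ interior U with hW₁
  have hW₁o : IsOpen W₁ := hW₀o.inter isOpen_interior
  have hqW₁ : q ∈ W₁ := ⟨hqW₀, mem_interior_iff_mem_nhds.2 hq⟩
  let W : Set M := ⋂ g : MulAction.stabilizer G q, (g.1.1 : M → M) ⁻¹' W₁
  have hmem : ∀ y, y ∈ W ↔ ∀ g ∈ G, g q = q → g y ∈ W₁ := by
    intro y
    simp only [W, mem_iInter, mem_preimage]
    exact ⟨fun h g hg hgq => h ⟨⟨g, hg⟩, hgq⟩, fun h g => h g.1.1 g.1.2 g.2⟩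
  have hsub : ∀ y ∈ W, y ∈ W₁ := fun y hy => (hmem y).1 hy 1 G.one_mem rfl
  refine ⟨W, fun y hy => interior_subset (hsub y hy).2, ?_, ?_, ?_, ?_⟩
  · exact isOpen_iInter_of_finite fun g => hW₁o.preimage (hU.continuous_perm g.1.2)
  · exact (hmem q).2 fun g _ hgq => by rw [hgq]; exact hqW₁
  · intro g hg hgq y hy
    refine (hmem _).2 fun g' hg' hgq' => ?_
    exact (hmem y).1 hy (g' * g) (G.mul_mem hg' hg) (by rw [Equiv.Perm.mul_apply, hgq, hgq'])
  · intro g hg y hy hgy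
    exact hW₀ g hg y (hsub y hy).1 (hsub _ hgy).1

/-- Over a point without isotropy, a slice at `q` contains as many points of the fibre as the
isotropy group of `q` has elements. -/
theorem ncard_fibre (hU : IsUniformization G φ b) {q : M} {W : Set M} (hW : IsSlice G q W)
    {p : PSpace n} (hp : p ∈ φ '' W) (hb : b p = 1) : {x ∈ W | φ x = p}.ncard = b (φ q) := by
  obtain ⟨x, hx, rfl⟩ := hp
  rw [hU.isotropy, ← Nat.card_coe_set_eq]
  refine (Nat.card_congr (Equiv.ofBijective
    (fun g : MulAction.stabilizer G q => (⟨g.1.1 x, hW.mapsTo _ g.1.2 g.2 x hx,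
      hU.map_perm g.1.2 x⟩ : {y ∈ W | φ y = φ x})) ⟨?_, ?_⟩)).symm
  · intro g g' h
    have h1 : g.1.1 x = g'.1.1 x := congrArg Subtype.val h
    have h2 : (g'.1.1⁻¹ * g.1.1) x = x := by
      rw [Equiv.Perm.mul_apply, h1]; exact g'.1.1.symm_apply_apply x
    have h3 := (hU.isotropy_eq_one_iff x).1 hb _ (G.mul_mem (G.inv_mem g'.1.2) g.1.2) h2
    exact Subtype.ext (Subtype.ext (inv_mul_eq_one.1 h3).symm)
  · rintro ⟨y, hy, hyx⟩
    obtain ⟨g, hg, rfl⟩ := (hU.fibres x y).1 hyx.symm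
    exact ⟨⟨⟨g, hg⟩, hW.fixes g hg x hx hy⟩, rfl⟩

/-- Over the complement of the branch locus `φ` is a covering. -/
theorem isCoveringMapOn (hU : IsUniformization G φ b) : IsCoveringMapOn φ {p | b p = 1} := by
  have := hU.complexManifold.t2
  have := hU.properlyDiscontinuous
  have : LocallyCompactSpace M := ChartedSpace.locallyCompactSpace (Fin n → ℂ) M
  have : ContinuousConstSMul G M := ⟨fun g => hU.continuous_perm g.2⟩
  have hG : ∀ {x y : M}, φ x = φ y ↔ x ∈ MulAction.orbit G y := by
    intro x y
    rw [eq_comm, hU.fibres y x]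
    exact ⟨fun ⟨g, hg, h⟩ => ⟨⟨g, hg⟩, h⟩, fun ⟨g, h⟩ => ⟨g.1, g.2, h⟩⟩
  refine (hU.quotientMap.isCoveringMapOn_of_properlyDiscontinuousSMul hG).mono fun p hp => ?_
  obtain ⟨x, rfl⟩ := hU.quotientMap.surjective p
  refine ⟨x, ?_, rfl⟩
  rw [mem_ofPred_eq, Subgroup.eq_bot_iff_forall]
  exact fun g hg => Subtype.ext ((hU.isotropy_eq_one_iff x).1 hp g.1 g.2 hg)

/-- A disc in the image of a slice which avoids the branch locus lifts to the slice. -/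
theorem exists_lift (hU : IsUniformization G φ b) {q : M} {W : Set M} (hW : IsSlice G q W)
    {R : ℝ} {p : ball (0 : ℂ) R → PSpace n} (hp : Continuous p)
    (hpW : ∀ τ, p τ ∈ φ '' W) (hb : ∀ τ, b (p τ) = 1) (h0 : (0 : ℂ) ∈ ball (0 : ℂ) R)
    {x : M} (hx : x ∈ W) (hxp : φ x = p ⟨0, h0⟩) :
    ∃ σ : ℂ → M, ContinuousOn σ (ball 0 R) ∧ σ 0 = x ∧
      ∀ τ : ball (0 : ℂ) R, σ τ ∈ W ∧ φ (σ τ) = p τ := by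
  have : ContractibleSpace (ball (0 : ℂ) R) :=
    (convex_ball (0 : ℂ) R).contractibleSpace ⟨0, h0⟩
  have : LocallyPathConnectedSpace (ball (0 : ℂ) R) := isOpen_ball.locallyPathConnectedSpace
  obtain ⟨S, ⟨hS0, hS⟩, -⟩ := hU.isCoveringMapOn.existsUnique_continuousMap_lifts
    (A := ball (0 : ℂ) R) ⟨p, hp⟩ (a₀ := ⟨0, h0⟩) (e₀ := x) hxp
    hb
  have hS' : ∀ τ, φ (S τ) = p τ := fun τ => congrFun hS τ
  -- the lift stays in the slice
  have hclopen : IsClopen (S ⁻¹' W) := by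
    refine ⟨⟨?_⟩, hW.isOpen.preimage S.continuous⟩
    have h1 : (S ⁻¹' W)ᶜ = ⋃ g : {g : G // g.1 q ≠ q},
        S ⁻¹' ((g.1.1⁻¹ : Equiv.Perm M) ⁻¹' W) := by
      ext τ
      simp only [mem_compl_iff, mem_preimage, mem_iUnion]
      constructor
      · intro h
        obtain ⟨y, hy, hyτ⟩ := hpW τ
        obtain ⟨g, hg, hgy⟩ := (hU.fibres y (S τ)).1 (by rw [hyτ, hS'])
        refine ⟨⟨⟨g, hg⟩, fun hgq => h ?_⟩, ?_⟩
        · rw [← hgy]; exact hW.mapsTo g hg hgq y hy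
        · change g.symm (S τ) ∈ W
          rwa [← hgy, g.symm_apply_apply]
      · rintro ⟨⟨⟨g, hg⟩, hgq⟩, h⟩ h'
        refine hgq (hW.fixes g hg _ h ?_)
        change g (g.symm (S τ)) ∈ W
        rwa [g.apply_symm_apply]
    rw [h1]
    exact isOpen_iUnion fun g => (hW.isOpen.preimage
      (hU.continuous_perm (G.inv_mem g.1.2))).preimage S.continuous
  have huniv : S ⁻¹' W = univ := hclopen.eq_univ ⟨⟨0, h0⟩, by rw [mem_preimage, hS0]; exact hx⟩
  classical
  refine ⟨fun τ => if h : τ ∈ ball (0 : ℂ) R then S ⟨τ, h⟩ else x, ?_, ?_, ?_⟩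
  · rw [continuousOn_iff_continuous_domRestrict]
    convert S.continuous using 1
    ext τ
    simp only [domRestrict_apply, dif_pos τ.2]
  · simp only [dif_pos h0, hS0]
  · rintro ⟨τ, hτ⟩
    simp only [dif_pos hτ]
    refine ⟨?_, hS' ⟨τ, hτ⟩⟩
    have : (⟨τ, hτ⟩ : ball (0 : ℂ) R) ∈ S ⁻¹' W := by rw [huniv]; exact mem_univ _
    exact this

end IsUniformization

end Slice

/-! ### The rank of the uniformization along the branch divisor -/

section Cone

variable {n : ℕ} {M : Type*} [TopologicalSpace M] [ChartedSpace (Fin n → ℂ) M]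
  {G : Subgroup (Equiv.Perm M)} {φ : M → PSpace n} {b : PSpace n → ℕ}

/-- The lift `(s, y) ↦ s • localLift φ k e y` of `φ` to the cones, in the chart `e` of `M`: the
fibre coordinate `s`, which is the coordinate of index `0`, becomes the `k`-th coordinate
in `ℂⁿ⁺¹`. -/
def coneChart (φ : M → PSpace n) (k : Fin (n + 1)) (e : OpenPartialHomeomorph M (Fin n → ℂ)) :
    (Fin (n + 1) → ℂ) → (Fin (n + 1) → ℂ) := coneMap (localLift φ k e)

/-- The open set on which `coneChart φ k e` is holomorphic, without the vertex of the cone. -/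
def coneDomain (φ : M → PSpace n) (k : Fin (n + 1)) (e : OpenPartialHomeomorph M (Fin n → ℂ)) :
    Set (Fin (n + 1) → ℂ) := {c | c 0 ≠ 0 ∧ Fin.tail c ∈ liftDomain φ k e}

theorem continuous_tail {n : ℕ} :
    Continuous fun c : Fin (n + 1) → ℂ => (Fin.tail c : Fin n → ℂ) := (tailL n).continuous

theorem continuous_cons {n : ℕ} :
    Continuous fun c : ℂ × (Fin n → ℂ) => (Fin.cons c.1 c.2 : Fin (n + 1) → ℂ) := by
  refine continuous_pi fun i => ?_
  refine Fin.cases ?_ (fun i => ?_) i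
  · simpa using continuous_fst
  · exact (continuous_apply i).comp continuous_snd

omit [ChartedSpace (Fin n → ℂ) M] in
theorem coneChart_apply_self {k : Fin (n + 1)} {e : OpenPartialHomeomorph M (Fin n → ℂ)}
    {c : Fin (n + 1) → ℂ} (hc : c ∈ coneDomain φ k e) : coneChart φ k e c k = c 0 := by
  rw [coneChart, coneMap, Pi.smul_apply, localLift, affineLift_self hc.2.2, smul_eq_mul, mul_one]

omit [ChartedSpace (Fin n → ℂ) M] in
theorem coneChart_ne_zero {k : Fin (n + 1)} {e : OpenPartialHomeomorph M (Fin n → ℂ)}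
    {c : Fin (n + 1) → ℂ} (hc : c ∈ coneDomain φ k e) : coneChart φ k e c ≠ 0 :=
  smul_ne_zero hc.1 (affineLift_ne_zero hc.2.2)

omit [ChartedSpace (Fin n → ℂ) M] in
theorem pt_coneChart {k : Fin (n + 1)} {e : OpenPartialHomeomorph M (Fin n → ℂ)}
    {c : Fin (n + 1) → ℂ} (hc : c ∈ coneDomain φ k e) :
    pt (coneChart φ k e c) (coneChart_ne_zero hc) = φ (e.symm (Fin.tail c)) := by
  exact (pt_smul (affineLift_ne_zero hc.2.2) (coneChart_ne_zero hc)).trans (pt_affineLift hc.2.2)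

omit [ChartedSpace (Fin n → ℂ) M] in
theorem cons_mem_coneDomain {k : Fin (n + 1)} {e : OpenPartialHomeomorph M (Fin n → ℂ)} {x : M}
    (hx : x ∈ e.source) {z : Fin (n + 1) → ℂ} (hz : z ≠ 0) (hxz : φ x = pt z hz) (hk : z k ≠ 0) :
    (Fin.cons (z k) (e x) : Fin (n + 1) → ℂ) ∈ coneDomain φ k e := by
  refine ⟨hk, ?_⟩
  rw [Fin.tail_cons]
  exact IsUniformization.apply_mem_liftDomain hx (by rw [hxz]; exact (pt_mem_affineChart hz).2 hk)

omit [ChartedSpace (Fin n → ℂ) M] in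
theorem coneChart_cons {k : Fin (n + 1)} {e : OpenPartialHomeomorph M (Fin n → ℂ)} {x : M}
    (hx : x ∈ e.source) {z : Fin (n + 1) → ℂ} (hz : z ≠ 0) (hxz : φ x = pt z hz) (hk : z k ≠ 0) :
    coneChart φ k e (Fin.cons (z k) (e x)) = z := by
  rw [coneChart, coneMap, Fin.cons_zero, Fin.tail_cons, localLift, e.left_inv hx, hxz,
    affineLift_pt, smul_smul, mul_inv_cancel₀ hk, one_smul]

namespace IsUniformization

theorem isOpen_coneDomain (hU : IsUniformization G φ b) (k : Fin (n + 1))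
    (e : OpenPartialHomeomorph M (Fin n → ℂ)) : IsOpen (coneDomain φ k e) :=
  (isOpen_ne_fun (continuous_apply 0) continuous_const).inter
    ((hU.isOpen_liftDomain k e).preimage continuous_tail)

theorem differentiableOn_coneChart (hU : IsUniformization G φ b) (k : Fin (n + 1))
    {e : OpenPartialHomeomorph M (Fin n → ℂ)} (he : e ∈ atlas (Fin n → ℂ) M) :
    DifferentiableOn ℂ (coneChart φ k e) (coneDomain φ k e) := fun _ hc =>
  (hasFDerivAt_coneMap ((hU.differentiableOn_localLift k he).differentiableAt
    ((hU.isOpen_liftDomain k e).mem_nhds hc.2))).differentiableAt.differentiableWithinAt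

theorem det_fderiv_coneChart (hU : IsUniformization G φ b) (k : Fin (n + 1))
    {e : OpenPartialHomeomorph M (Fin n → ℂ)} (he : e ∈ atlas (Fin n → ℂ) M)
    {c : Fin (n + 1) → ℂ} (hc : c ∈ coneDomain φ k e) :
    (fderiv ℂ (coneChart φ k e) c).det = c 0 ^ n * wronskian (localLift φ k e) (Fin.tail c) :=
  det_fderiv_coneMap ((hU.differentiableOn_localLift k he).differentiableAt
    ((hU.isOpen_liftDomain k e).mem_nhds hc.2))

theorem det_fderiv_coneChart_ne_zero (hU : IsUniformization G φ b) (k : Fin (n + 1))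
    {e : OpenPartialHomeomorph M (Fin n → ℂ)} (he : e ∈ atlas (Fin n → ℂ) M)
    {c : Fin (n + 1) → ℂ} (hc : c ∈ coneDomain φ k e)
    (hb : b (φ (e.symm (Fin.tail c))) = 1) : (fderiv ℂ (coneChart φ k e) c).det ≠ 0 := by
  rw [hU.det_fderiv_coneChart k he hc]
  have h1 := hU.wronskian_ne_zero ((hU.isotropy_eq_one_iff _).1 hb) he (e.map_target hc.2.1) hc.2.2
  rw [e.right_inv hc.2.1] at h1
  exact mul_ne_zero (pow_ne_zero n hc.1) h1

/-- Points of `ℂⁿ⁺¹` near a given one lie over any given neighbourhood of `q`. -/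
theorem cone_image_mem_nhds (hU : IsUniformization G φ b) {q : M} {W : Set M} (hW : W ∈ 𝓝 q)
    {z : Fin (n + 1) → ℂ} (hz : z ≠ 0) (hqz : φ q = pt z hz) : cone (φ '' W) ∈ 𝓝 z := by
  have h1 := isOpen_cone (hU.isOpenMap _ (isOpen_interior (s := W)))
  refine mem_of_superset (h1.mem_nhds ⟨hz, q, mem_interior_iff_mem_nhds.2 hW, hqz⟩) ?_
  rintro w ⟨hw, h2⟩
  exact ⟨hw, image_mono interior_subset h2⟩

/-- Near a smooth point of a branch divisor `F = 0`, the lift of `φ` to the cones is a submersion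
modulo a coordinate direction transversal to the divisor. Indeed, discs of fixed radius on the
hypersurfaces `F = ε`, `ε ≠ 0`, lift to bounded discs in a chart of `M`, and `ε` can tend to
`0`. -/
theorem exists_fderiv_coneChart_eq (hU : IsUniformization G φ b) [Finite G] {q : M}
    {z₀ : Fin (n + 1) → ℂ} (hz₀ : z₀ ≠ 0) (hqz : φ q = pt z₀ hz₀) {k : Fin (n + 1)}
    (hk : z₀ k ≠ 0) {F : (Fin (n + 1) → ℂ) → ℂ} (hF : Differentiable ℂ F) (hF0 : F z₀ = 0)
    {l : Fin (n + 1)} (hl : fderiv ℂ F z₀ (Pi.single l 1) ≠ 0)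
    (hb : ∀ᶠ z in 𝓝 z₀, F z ≠ 0 → ∀ hz : z ≠ 0, b (pt z hz) = 1) (v : Fin (n + 1) → ℂ) :
    ∃ X, ∀ i ≠ l, fderiv ℂ (coneChart φ k (chartAt (Fin n → ℂ) q))
      (Fin.cons (z₀ k) (chartAt (Fin n → ℂ) q q)) X i = v i := by
  have := hU.complexManifold.manifold
  have := hU.complexManifold.secondCountable
  set e := chartAt (Fin n → ℂ) q with he
  have hqe : q ∈ e.source := mem_chart_source _ q
  have hea : e ∈ atlas (Fin n → ℂ) M := chart_mem_atlas _ q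
  set c₀ : Fin (n + 1) → ℂ := Fin.cons (z₀ k) (e q) with hc₀
  -- lifts of discs are kept inside a bounded slice
  obtain ⟨W, hWU, hW⟩ := hU.exists_slice q (U := e.source ∩ e ⁻¹' ball (e q) 1)
    (inter_mem (e.open_source.mem_nhds hqe)
      ((e.continuousAt hqe).preimage_mem_nhds (ball_mem_nhds _ one_pos)))
  have hWn : W ∈ 𝓝 q := hW.isOpen.mem_nhds hW.mem
  -- coordinates in which `F` is the `l`-th one
  set A : (Fin (n + 1) → ℂ) → (Fin (n + 1) → ℂ) := fun z => Function.update z l (F z) with hA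
  have hAd : Differentiable ℂ A := by
    refine differentiable_pi.2 fun i => ?_
    by_cases hi : i = l
    · subst hi; simpa [hA] using hF
    · simpa [hA, hi] using differentiable_apply i
  have hdetA : (fderiv ℂ A z₀).det ≠ 0 := by
    have h1 := hasFDerivAt_pi'.1 (hAd z₀).hasFDerivAt
    rw [det_eq_of_apply_eq _ l]
    · have h2 := h1 l
      simp only [hA, Function.update_self] at h2
      have h3 := congrArg (fun L => L (Pi.single l 1)) (h2.unique (hF z₀).hasFDerivAt)
      change fderiv ℂ A z₀ (Pi.single l 1) l = _ at h3
      rw [h3]; exact hl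
    · intro v i hi
      have h2 := h1 i
      simp only [hA, Function.update_of_ne hi] at h2
      exact congrArg (fun L => L v) (h2.unique (hasFDerivAt_apply i z₀))
  obtain ⟨E, hE1, -, hE3, hE4⟩ := exists_openPartialHomeomorph isOpen_univ hAd.differentiableOn
    (mem_univ z₀) hdetA
  set B := E.symm with hB
  set u₀ := A z₀ with hu₀
  have hu₀t : u₀ ∈ E.target := by rw [hu₀, ← hE3]; exact E.map_source hE1
  have hBu₀ : B u₀ = z₀ := by rw [hu₀, ← hE3]; exact E.left_inv hE1
  have hAB : ∀ u ∈ E.target, A (B u) = u := fun u hu => by rw [← hE3]; exact E.right_inv hu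
  have hu₀l : u₀ l = 0 := by simp [hu₀, hA, hF0]
  have hFB : ∀ u ∈ E.target, F (B u) = u l := fun u hu => by
    have := congrFun (hAB u hu) l
    simpa [hA] using this
  have hBc : ContinuousAt B u₀ :=
    hE4.continuousOn.continuousAt (E.open_target.mem_nhds hu₀t)
  -- the properties of points near `z₀` that are needed
  have hnear : ∀ᶠ z in 𝓝 z₀, (F z ≠ 0 → ∀ hz : z ≠ 0, b (pt z hz) = 1) ∧ z k ≠ 0 ∧
      z ∈ cone (φ '' W) ∧ ‖z‖ < ‖z₀‖ + 1 := by
    refine hb.and (((continuous_apply k).continuousAt.eventually_ne hk).and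
      (Filter.Eventually.and (hU.cone_image_mem_nhds hWn hz₀ hqz) ?_))
    exact continuous_norm.continuousAt.eventually_lt continuousAt_const (by linarith)
  have hnear' : ∀ᶠ u in 𝓝 u₀, u ∈ E.target ∧ (F (B u) ≠ 0 → ∀ hz : B u ≠ 0, b (pt (B u) hz) = 1) ∧
      B u k ≠ 0 ∧ B u ∈ cone (φ '' W) ∧ ‖B u‖ < ‖z₀‖ + 1 := by
    have h1 : Tendsto B (𝓝 u₀) (𝓝 z₀) := by rw [← hBu₀]; exact hBc
    exact Filter.Eventually.and (E.open_target.mem_nhds hu₀t) (h1.eventually hnear)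
  obtain ⟨r, hr, hball⟩ := Metric.eventually_nhds_iff_ball.1 hnear'
  set v' : Fin (n + 1) → ℂ := Function.update v l 0 with hv'
  set R := r / (2 * (‖v'‖ + 1)) with hR
  have hRpos : 0 < R := by positivity
  have hsmall : ∀ ε : ℂ, ‖ε‖ < r / 2 → ∀ τ ∈ ball (0 : ℂ) R,
      u₀ + Pi.single l ε + τ • v' ∈ ball u₀ r := by
    intro ε hε τ hτ
    rw [mem_ball_zero_iff] at hτ
    have h1 : ‖τ • v'‖ ≤ r / 2 := by
      rw [norm_smul]
      calc ‖τ‖ * ‖v'‖ ≤ R * (‖v'‖ + 1) := by gcongr; linarith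
        _ = r / 2 := by rw [hR]; field_simp
    have h2 : ‖(Pi.single l ε : Fin (n + 1) → ℂ)‖ = ‖ε‖ := Pi.norm_single _
    rw [mem_ball_iff_norm, add_assoc, add_sub_cancel_left]
    calc _ ≤ ‖(Pi.single l ε : Fin (n + 1) → ℂ)‖ + ‖τ • v'‖ := norm_add_le _ _
      _ < r := by rw [h2]; linarith
  -- the centres of the discs, and points of `M` above them
  obtain ⟨S, hS⟩ := (𝓝 q).exists_antitone_basis
  have hsingle : Continuous fun ε : ℂ => u₀ + (Pi.single l ε : Fin (n + 1) → ℂ) :=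
    continuous_const.add (continuous_single (A := fun _ => ℂ) l)
  have hex : ∀ j : ℕ, ∃ ε : ℂ, ε ≠ 0 ∧ ‖ε‖ < r / 2 ∧ ‖ε‖ < 1 / ((j : ℝ) + 1) ∧
      B (u₀ + Pi.single l ε) ∈ cone (φ '' (W ∩ S j)) := by
    intro j
    have h1 : Tendsto (fun ε : ℂ => B (u₀ + Pi.single l ε)) (𝓝 0) (𝓝 z₀) := by
      have h2 : Tendsto (fun ε : ℂ => u₀ + (Pi.single l ε : Fin (n + 1) → ℂ)) (𝓝 0) (𝓝 u₀) := by
        simpa using hsingle.tendsto 0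
      rw [← hBu₀]
      exact hBc.tendsto.comp h2
    have h3 := h1.eventually (hU.cone_image_mem_nhds (inter_mem hWn (hS.mem j)) hz₀ hqz)
    have h4 : ∀ᶠ ε : ℂ in 𝓝 0, ‖ε‖ < r / 2 :=
      continuous_norm.continuousAt.eventually_lt continuousAt_const (by simpa using hr)
    have h5 : ∀ᶠ ε : ℂ in 𝓝 0, ‖ε‖ < 1 / ((j : ℝ) + 1) :=
      continuous_norm.continuousAt.eventually_lt continuousAt_const
        (by rw [norm_zero]; positivity)
    have h6 : ∀ᶠ ε in 𝓝[≠] (0 : ℂ), ε ≠ 0 := eventually_mem_nhdsWithin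
    obtain ⟨ε, h⟩ := (h6.and (((h4.and (h5.and h3))).filter_mono nhdsWithin_le_nhds)).exists
    exact ⟨ε, h⟩
  choose ε hε0 hεr hεj hεc using hex
  have hεlim : Tendsto ε atTop (𝓝 0) :=
    squeeze_zero_norm (fun j => (hεj j).le) tendsto_one_div_add_atTop_nhds_zero_nat
  choose hw0 x hx using hεc
  have hxq : Tendsto x atTop (𝓝 q) := hS.tendsto fun j => (hx j).1.2
  set w : ℕ → ℂ → (Fin (n + 1) → ℂ) := fun j τ => B (u₀ + Pi.single l (ε j) + τ • v') with hw
  have hwball : ∀ j, ∀ τ ∈ ball (0 : ℂ) R, u₀ + Pi.single l (ε j) + τ • v' ∈ ball u₀ r :=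
    fun j => hsmall (ε j) (hεr j)
  have hwne : ∀ j, ∀ τ ∈ ball (0 : ℂ) R, w j τ ≠ 0 := fun j τ hτ =>
    (hball _ (hwball j τ hτ)).2.2.2.1.1
  have hwb : ∀ j, ∀ τ, ∀ hτ : τ ∈ ball (0 : ℂ) R, b (pt (w j τ) (hwne j τ hτ)) = 1 := by
    intro j τ hτ
    have h1 := hball _ (hwball j τ hτ)
    refine h1.2.1 ?_ _
    rw [hFB _ h1.1]
    simpa [hu₀l, hv'] using hε0 j
  have hline : ∀ j, Differentiable ℂ fun τ : ℂ => u₀ + Pi.single l (ε j) + τ • v' := fun j => by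
    fun_prop
  have hwd : ∀ j, DifferentiableOn ℂ (w j) (ball 0 R) := fun j =>
    hE4.comp (hline j).differentiableOn fun τ hτ => (hball _ (hwball j τ hτ)).1
  have hwx : ∀ j, w j 0 = B (u₀ + Pi.single l (ε j)) := fun j => by simp [hw]
  have h0R : (0 : ℂ) ∈ ball (0 : ℂ) R := mem_ball_self hRpos
  have hlift : ∀ j, ∃ σ : ℂ → M, ContinuousOn σ (ball 0 R) ∧ σ 0 = x j ∧
      ∀ τ : ball (0 : ℂ) R, σ τ ∈ W ∧ φ (σ τ) = pt (w j τ) (hwne j τ τ.2) := by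
    intro j
    refine hU.exists_lift hW (continuous_pt_comp (hwd j).continuousOn.domRestrict fun τ =>
      hwne j τ τ.2) (fun τ => ?_) (fun τ => hwb j τ τ.2) h0R (hx j).1.1 ?_
    · obtain ⟨h1, h2⟩ := (hball _ (hwball j τ τ.2)).2.2.2.1
      exact h2
    · rw [(hx j).2]
      congr 1
      exact (hwx j).symm
  choose σ hσc hσ0 hσ using hlift
  have hwk : ∀ j, ∀ τ ∈ ball (0 : ℂ) R, w j τ k ≠ 0 := fun j τ hτ =>
    (hball _ (hwball j τ hτ)).2.2.1
  have hσe : ∀ j, ∀ τ ∈ ball (0 : ℂ) R, σ j τ ∈ e.source := fun j τ hτ =>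
    (hWU (hσ j ⟨τ, hτ⟩).1).1
  set c : ℕ → ℂ → (Fin (n + 1) → ℂ) := fun j τ => Fin.cons (w j τ k) (e (σ j τ)) with hc
  have hcO : ∀ j, ∀ τ ∈ ball (0 : ℂ) R, c j τ ∈ coneDomain φ k e := fun j τ hτ =>
    cons_mem_coneDomain (hσe j τ hτ) (hwne j τ hτ) (hσ j ⟨τ, hτ⟩).2 (hwk j τ hτ)
  have hcw : ∀ j, ∀ τ ∈ ball (0 : ℂ) R, coneChart φ k e (c j τ) = w j τ := fun j τ hτ =>
    coneChart_cons (hσe j τ hτ) (hwne j τ hτ) (hσ j ⟨τ, hτ⟩).2 (hwk j τ hτ)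
  have hcc : ∀ j, ContinuousOn (c j) (ball 0 R) := by
    intro j
    refine continuous_cons.comp_continuousOn (ContinuousOn.prodMk ?_ ?_)
    · exact (continuous_apply k).comp_continuousOn (hwd j).continuousOn
    · exact e.continuousOn.comp (hσc j) (hσe j)
  have hcd : ∀ j, DifferentiableOn ℂ (c j) (ball 0 R) := by
    intro j
    refine differentiableOn_of_comp (hU.isOpen_coneDomain k e)
      (hU.differentiableOn_coneChart k hea) isOpen_ball (hcc j) (hcO j) (fun τ hτ => ?_) (hwd j)
      (hcw j)
    refine hU.det_fderiv_coneChart_ne_zero k hea (hcO j τ hτ) ?_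
    rw [hc, Fin.tail_cons, e.left_inv (hσe j τ hτ), (hσ j ⟨τ, hτ⟩).2]
    exact hwb j τ hτ
  have hc₀O : c₀ ∈ coneDomain φ k e := cons_mem_coneDomain hqe hz₀ hqz hk
  have hulim : Tendsto (fun j => u₀ + (Pi.single l (ε j) : Fin (n + 1) → ℂ)) atTop (𝓝 u₀) := by
    have h1 : Tendsto (fun ε : ℂ => u₀ + (Pi.single l ε : Fin (n + 1) → ℂ)) (𝓝 0) (𝓝 u₀) := by
      simpa using hsingle.tendsto 0
    exact h1.comp hεlim
  have hlim : Tendsto (fun j => c j 0) atTop (𝓝 c₀) := by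
    have h1 : Tendsto (fun j => w j 0) atTop (𝓝 z₀) := by
      simp only [hwx]
      rw [← hBu₀]
      exact hBc.tendsto.comp hulim
    have h2 : Tendsto (fun j => w j 0 k) atTop (𝓝 (z₀ k)) :=
      ((continuous_apply k).tendsto z₀).comp h1
    have h3 : Tendsto (fun j => e (σ j 0)) atTop (𝓝 (e q)) := by
      simp only [hσ0]
      exact (e.continuousAt hqe).tendsto.comp hxq
    exact (continuous_cons.tendsto (z₀ k, e q)).comp (h2.prodMk_nhds h3)
  have hξ : Tendsto (fun j => deriv (w j) 0) atTop (𝓝 (fderiv ℂ B u₀ v')) := by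
    have h1 : ∀ j, deriv (w j) 0 = fderiv ℂ B (u₀ + Pi.single l (ε j)) v' := by
      intro j
      have h2 : HasDerivAt (fun τ : ℂ => u₀ + Pi.single l (ε j) + τ • v') v' 0 := by
        simpa using ((hasDerivAt_id (0 : ℂ)).smul_const v').const_add (u₀ + Pi.single l (ε j))
      have h3 : u₀ + Pi.single l (ε j) + (0 : ℂ) • v' ∈ E.target := (hball _ (hwball j 0 h0R)).1
      have h4 := (hE4.differentiableAt (E.open_target.mem_nhds h3)).hasFDerivAt.comp_hasDerivAt
        (0 : ℂ) h2
      rw [zero_smul, add_zero] at h4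
      exact h4.deriv
    simp only [h1]
    exact ((differentiableOn_fderiv_apply E.open_target hE4 v').continuousOn.continuousAt
      (E.open_target.mem_nhds hu₀t)).tendsto.comp hulim
  have hbd : ∀ j, ∀ τ ∈ ball (0 : ℂ) R, ‖c j τ‖ ≤ max (‖z₀‖ + 1) (‖e q‖ + 1) := by
    intro j τ hτ
    refine (pi_norm_le_iff_of_nonneg (le_trans (by positivity) (le_max_left _ _))).2 fun i => ?_
    refine Fin.cases ?_ (fun i => ?_) i
    · refine le_max_of_le_left ?_
      exact (norm_le_pi_norm (w j τ) k).trans (hball _ (hwball j τ hτ)).2.2.2.2.le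
    · refine le_max_of_le_right ?_
      have h1 : ‖e (σ j τ) - e q‖ < 1 := mem_ball_iff_norm.1 (hWU (hσ j ⟨τ, hτ⟩).1).2
      have h2 : ‖e (σ j τ) i‖ ≤ ‖e (σ j τ)‖ := norm_le_pi_norm _ i
      have h3 := norm_le_norm_add_norm_sub' (e (σ j τ)) (e q)
      change ‖e (σ j τ) i‖ ≤ _
      linarith
  obtain ⟨X, hX⟩ := mem_range_fderiv_of_lifts (hU.isOpen_coneDomain k e)
    (hU.differentiableOn_coneChart k hea) hc₀O hRpos hcd hbd hcO hlim hcw hξ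
  refine ⟨X, fun i hi => ?_⟩
  rw [hX]
  have h1 := hasFDerivAt_pi'.1
    (hE4.differentiableAt (E.open_target.mem_nhds hu₀t)).hasFDerivAt i
  have h2 : (fun u => B u i) =ᶠ[𝓝 u₀] fun u => u i := by
    filter_upwards [E.open_target.mem_nhds hu₀t] with u hu
    have := congrFun (hAB u hu) i
    simpa [hA, hi] using this
  have h3 := (h1.congr_of_eventuallyEq h2.symm).unique (hasFDerivAt_apply i u₀)
  have h4 := congrArg (fun L => L v') h3
  refine h4.trans ?_
  simp [hv', hi]

end IsUniformization

end Cone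

/-! ### The multiplicity of a component in the ramification polynomial -/

section Weight

variable {n : ℕ} {M : Type*} [TopologicalSpace M] [ChartedSpace (Fin n → ℂ) M]
  {G : Subgroup (Equiv.Perm M)} {φ : M → PSpace n} {b : PSpace n → ℕ}

namespace IsUniformization

/-- The Jacobians at `x` and `g x` differ by a nowhere vanishing factor. -/
theorem exists_jacobian_perm_eq (hU : IsUniformization G φ b)
    {f : OpenPartialHomeomorph M (Fin n → ℂ) → (Fin n → ℂ) → ℂ} (hf : IsNowhereZeroTopForm n M f)
    {g : Equiv.Perm M} (hg : g ∈ G) {q : M} {k : Fin (n + 1)} (hk : φ q ∈ affineChart k)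
    {e : OpenPartialHomeomorph M (Fin n → ℂ)} (he : e ∈ atlas (Fin n → ℂ) M) (hqe : q ∈ e.source) :
    ∃ u : (Fin n → ℂ) → ℂ, ContinuousAt u (e q) ∧ u (e q) ≠ 0 ∧
      ∀ᶠ y in 𝓝 (e q), jacobian φ f k (g (e.symm y)) = u y * wronskian (localLift φ k e) y := by
  set e' := chartAt (Fin n → ℂ) (g q) with he'
  have hea' : e' ∈ atlas (Fin n → ℂ) M := chart_mem_atlas _ _
  have hq : e q ∈ inChartsDomain g e e' := by
    refine ⟨e.map_source hqe, ?_⟩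
    rw [mem_preimage, e.left_inv hqe]
    exact mem_chart_source _ _
  have ho := hU.isOpen_inChartsDomain hg e e'
  have hT := hU.differentiableOn_inCharts hg he hea'
  have hdet : DifferentiableOn ℂ (fun y => (fderiv ℂ (inCharts g e e') y).det)
      (inChartsDomain g e e') :=
    differentiableOn_det fun v => differentiableOn_fderiv_apply ho hT v
  have hmem : ∀ y ∈ inChartsDomain g e e', inCharts g e e' y ∈ e'.target := fun y hy =>
    e'.map_source hy.2
  have hfc : ContinuousOn (fun y => f e' (inCharts g e e' y)) (inChartsDomain g e e') :=
    (hf.holomorphic e' hea').continuousOn.comp hT.continuousOn hmem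
  have hne : ∀ y ∈ inChartsDomain g e e',
      (fderiv ℂ (inCharts g e e') y).det * f e' (inCharts g e e' y) ≠ 0 := fun y hy =>
    mul_ne_zero (hU.det_inCharts_ne_zero hg he hea' hy) (hf.ne_zero e' hea' _ (hmem y hy))
  refine ⟨fun y => ((fderiv ℂ (inCharts g e e') y).det * f e' (inCharts g e e' y))⁻¹, ?_,
    inv_ne_zero (hne _ hq), ?_⟩
  · exact ((hdet.continuousOn.continuousAt (ho.mem_nhds hq)).mul
      (hfc.continuousAt (ho.mem_nhds hq))).inv₀ (hne _ hq)
  · filter_upwards [ho.mem_nhds hq, (hU.isOpen_liftDomain k e).mem_nhds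
      (apply_mem_liftDomain hqe hk)] with y hy hyk
    have h1 : φ (g (e.symm y)) ∈ affineChart k := by rw [hU.map_perm hg]; exact hyk.2
    rw [hU.jacobian_eq hf hea' hy.2 h1, hU.wronskian_inCharts hg k he hea' hy hyk]
    have h2 := hne y hy
    change _ / f e' (inCharts g e e' y) = _
    rw [inCharts] at h2 ⊢
    have h3 := left_ne_zero_of_mul h2
    have h4 := right_ne_zero_of_mul h2
    field_simp

/-- In a chart, the ramification polynomial is the power of exponent `|G|` of the Jacobian
determinant of the lift of `φ` to the cones, up to a unit. -/
theorem exists_eval_coneChart_eq (hU : IsUniformization G φ b) [Fintype G]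
    {f : OpenPartialHomeomorph M (Fin n → ℂ) → (Fin n → ℂ) → ℂ} (hf : IsNowhereZeroTopForm n M f)
    {P : (Fin (n + 1) → ℂ) → ℂ} {k : Fin (n + 1)}
    (hP : ∀ (x : M) (z : Fin (n + 1) → ℂ) (hz : z ≠ 0), φ x = pt z hz → z k ≠ 0 →
        P z = ∏ g : G, (z k ^ (n + 1) * jacobian φ f k (g.1 x)))
    {e : OpenPartialHomeomorph M (Fin n → ℂ)} (he : e ∈ atlas (Fin n → ℂ) M)
    {c₀ : Fin (n + 1) → ℂ} (hc₀ : c₀ ∈ coneDomain φ k e) :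
    ∃ u : (Fin (n + 1) → ℂ) → ℂ, ContinuousAt u c₀ ∧ u c₀ ≠ 0 ∧ ∀ᶠ c in 𝓝 c₀,
      P (coneChart φ k e c) = u c * (fderiv ℂ (coneChart φ k e) c).det ^ Fintype.card G := by
  set q := e.symm (Fin.tail c₀) with hq
  have hqe : q ∈ e.source := e.map_target hc₀.2.1
  have heq : e q = Fin.tail c₀ := e.right_inv hc₀.2.1
  have h1 := fun g : G => hU.exists_jacobian_perm_eq hf g.2 hc₀.2.2 he hqe
  choose u hu hu0 huj using h1
  rw [heq] at hu hu0 huj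
  refine ⟨fun c => ∏ g : G, (c 0 * u g (Fin.tail c)), ?_, ?_, ?_⟩
  · refine tendsto_finsetProd _ fun g _ => ?_
    exact (continuous_apply 0).continuousAt.mul
      (ContinuousAt.comp (f := fun c : Fin (n + 1) → ℂ => (Fin.tail c : Fin n → ℂ)) (hu g)
        continuous_tail.continuousAt)
  · exact Finset.prod_ne_zero_iff.2 fun g _ => mul_ne_zero hc₀.1 (hu0 g)
  · have h2 : ∀ᶠ c : Fin (n + 1) → ℂ in 𝓝 c₀, ∀ g : G, jacobian φ f k (g.1 (e.symm (Fin.tail c))) =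
        u g (Fin.tail c) * wronskian (localLift φ k e) (Fin.tail c) :=
      eventually_all.2 fun g => continuous_tail.continuousAt.eventually (huj g)
    filter_upwards [h2, (hU.isOpen_coneDomain k e).mem_nhds hc₀] with c hc hcO
    have h3 := coneChart_apply_self hcO
    rw [hP _ _ (coneChart_ne_zero hcO) (pt_coneChart hcO).symm (by rw [h3]; exact hcO.1), h3,
      hU.det_fderiv_coneChart k he hcO, ← Finset.card_univ, ← Finset.prod_const,
      ← Finset.prod_mul_distrib]
    refine Finset.prod_congr rfl fun g _ => ?_
    rw [hc g]
    ring

/-- Along a curve transversal to the branch divisor `F = 0`, the map `φ` is `t ↦ t ^ m`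
with `m` the order of the isotropy group, its Jacobian vanishes to order `m - 1`, and so the
multiplicity `a` of `F` in the ramification polynomial satisfies `|G| * (m - 1) = a * m`. -/
theorem card_mul_isotropy_sub_one (hU : IsUniformization G φ b) [Fintype G]
    {f : OpenPartialHomeomorph M (Fin n → ℂ) → (Fin n → ℂ) → ℂ} (hf : IsNowhereZeroTopForm n M f)
    {P : (Fin (n + 1) → ℂ) → ℂ}
    (hP : ∀ (x : M) (z : Fin (n + 1) → ℂ) (hz : z ≠ 0) (k : Fin (n + 1)), φ x = pt z hz → z k ≠ 0 →
        P z = ∏ g : G, (z k ^ (n + 1) * jacobian φ f k (g.1 x)))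
    {z₀ : Fin (n + 1) → ℂ} (hz₀ : z₀ ≠ 0) {F : (Fin (n + 1) → ℂ) → ℂ} (hF : Differentiable ℂ F)
    (hF0 : F z₀ = 0) {l : Fin (n + 1)} (hl : fderiv ℂ F z₀ (Pi.single l 1) ≠ 0)
    (hb : ∀ᶠ z in 𝓝 z₀, F z ≠ 0 → ∀ hz : z ≠ 0, b (pt z hz) = 1)
    {a : ℕ} {u : (Fin (n + 1) → ℂ) → ℂ} (hu : ContinuousAt u z₀) (hu0 : u z₀ ≠ 0)
    (hPF : ∀ᶠ z in 𝓝 z₀, P z = u z * F z ^ a) :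
    Fintype.card G * (b (pt z₀ hz₀) - 1) = a * b (pt z₀ hz₀) := by
  obtain ⟨k, hk⟩ : ∃ k, z₀ k ≠ 0 := Function.ne_iff.1 hz₀
  obtain ⟨q, hqz⟩ := hU.quotientMap.surjective (pt z₀ hz₀)
  have hfd := hU.exists_fderiv_coneChart_eq hz₀ hqz hk hF hF0 hl hb
  set e := chartAt (Fin n → ℂ) q with he
  have hqe : q ∈ e.source := mem_chart_source _ q
  have hea : e ∈ atlas (Fin n → ℂ) M := chart_mem_atlas _ q
  set c₀ : Fin (n + 1) → ℂ := Fin.cons (z₀ k) (e q) with hc₀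
  have hc₀O : c₀ ∈ coneDomain φ k e := cons_mem_coneDomain hqe hz₀ hqz hk
  have hΦc₀ : coneChart φ k e c₀ = z₀ := coneChart_cons hqe hz₀ hqz hk
  have hOo := hU.isOpen_coneDomain k e
  have hΦd := hU.differentiableOn_coneChart k hea
  obtain ⟨c, h, κ, j, hcc, hc0, hha, hh0, hκ, hκ0, hcurve, Ω, hΩ, hinv⟩ :=
    exists_transversal_curve hOo hΦd hc₀O l hfd
  rw [hΦc₀] at hcurve hinv
  have hcO : ∀ᶠ t in 𝓝 0, c t ∈ coneDomain φ k e :=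
    hcc.eventually_mem (by rw [hc0]; exact hOo.mem_nhds hc₀O)
  -- the point of `M` over `c t`
  set x : ℂ → M := fun t => e.symm (Fin.tail (c t)) with hx
  have hx0 : x 0 = q := by rw [hx]; simp only [hc0, hc₀, Fin.tail_cons, e.left_inv hqe]
  have hxc : ContinuousAt x 0 := by
    refine ContinuousAt.comp (g := e.symm) ?_
      (ContinuousAt.comp (f := c) continuous_tail.continuousAt hcc)
    exact e.continuousAt_symm (by rw [hc0]; exact hc₀O.2.1)
  have hxφ : ∀ t, ∀ ht : c t ∈ coneDomain φ k e,
      φ (x t) = pt (coneChart φ k e (c t)) (coneChart_ne_zero ht) := fun t ht =>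
    (pt_coneChart ht).symm
  -- `h` is not constant, as the fibre of `φ` through `q` is discrete
  have hne : ¬ ∀ᶠ t in 𝓝 0, h t = 0 := by
    intro h0
    obtain ⟨W, hWU, hW⟩ := hU.exists_slice q (e.open_source.mem_nhds hqe)
    have h1 : ∀ᶠ t in 𝓝 0, x t ∈ W :=
      hxc.eventually_mem (by rw [hx0]; exact hW.isOpen.mem_nhds hW.mem)
    have h2 : ∀ᶠ t in 𝓝[≠] (0 : ℂ), t ≠ 0 := eventually_mem_nhdsWithin
    obtain ⟨t, ht, h3, h4, h5, h6⟩ :=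
      (h2.and ((h0.and (h1.and (hcO.and hcurve))).filter_mono nhdsWithin_le_nhds)).exists
    have h7 : coneChart φ k e (c t) = z₀ := by rw [h6.1, h3]; simp
    have h8 : x t = q := by
      obtain ⟨g, hg, hgq⟩ := (hU.fibres q (x t)).1 (by
        rw [hxφ t h5, hqz]; congr 1; exact h7.symm)
      rw [← hgq]
      exact hW.fixes g hg q hW.mem (by rw [hgq]; exact h4)
    have h9 : c t = c₀ := by
      rw [← Fin.cons_self_tail (c t), hc₀, ← coneChart_apply_self h5, h7, ← h8, hx,
        e.right_inv h5.2.1]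
    have h10 := h6.2.1
    rw [h9] at h10
    exact ht (by simpa using h10)
  obtain ⟨m, g, g₁, hm, hg, hg0, hg₁, hg₁0, hhg, hhg₁, N₀, hN₀, hcount⟩ := exists_order hha hh0 hne
  -- the restriction of `F` to the line through `z₀` has a simple zero
  obtain ⟨ψ, hψ, hψ0, hFψ⟩ : ∃ ψ : ℂ → ℂ, ContinuousAt ψ 0 ∧ ψ 0 ≠ 0 ∧
      ∀ ε, F (z₀ + Pi.single l ε) = ε * ψ ε := by
    have h1 : HasDerivAt (fun ε : ℂ => z₀ + (Pi.single l ε : Fin (n + 1) → ℂ))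
        (Pi.single l 1) 0 := by
      refine hasDerivAt_pi.2 fun i => ?_
      by_cases hi : i = l
      · subst hi; simpa using (hasDerivAt_id' (0 : ℂ)).const_add (z₀ i)
      · simpa [hi] using hasDerivAt_const (0 : ℂ) (z₀ i)
    have h2 : HasDerivAt (fun ε : ℂ => F (z₀ + Pi.single l ε))
        (fderiv ℂ F z₀ (Pi.single l 1)) 0 := by
      refine HasFDerivAt.comp_hasDerivAt (l := F) 0 ?_ h1
      simpa using (hF z₀).hasFDerivAt
    refine ⟨dslope (fun ε : ℂ => F (z₀ + Pi.single l ε)) 0,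
      continuousAt_dslope_same.2 h2.differentiableAt, ?_, fun ε => ?_⟩
    · rw [dslope_same, h2.deriv]; exact hl
    · have h3 := sub_smul_dslope (fun ε : ℂ => F (z₀ + Pi.single l ε)) 0 ε
      simpa [hF0] using h3.symm
  have hline : Continuous fun ε : ℂ => z₀ + (Pi.single l ε : Fin (n + 1) → ℂ) :=
    continuous_const.add (continuous_single (A := fun _ => ℂ) l)
  have hline0 : Tendsto (fun ε : ℂ => z₀ + (Pi.single l ε : Fin (n + 1) → ℂ)) (𝓝 0) (𝓝 z₀) := by
    simpa using hline.tendsto 0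
  have hhc : Tendsto h (𝓝 0) (𝓝 0) := by
    have := hha.continuousAt.tendsto
    rwa [hh0] at this
  -- comparison of the orders of vanishing along the curve
  have horder : m * a = (m - 1) * Fintype.card G := by
    obtain ⟨U, hUc, hU0, hUP⟩ := hU.exists_eval_coneChart_eq hf
      (fun x z hz => hP x z hz k) hea hc₀O
    have hcz : ContinuousAt (fun t => z₀ + (Pi.single l (h t) : Fin (n + 1) → ℂ)) 0 := by
      have h1 := hline0.comp hhc
      rw [ContinuousAt, hh0, Pi.single_zero, add_zero]
      exact h1
    refine order_unique (u := fun t => u (z₀ + Pi.single l (h t)) * (g t * ψ (h t)) ^ a)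
      (v := fun t => U (c t) * (g₁ t / κ t) ^ Fintype.card G) ?_ ?_ ?_ ?_ ?_
    · refine (ContinuousAt.comp (g := u) ?_ hcz).mul ((hg.mul (ContinuousAt.comp (g := ψ) ?_
        hha.continuousAt)).pow a)
      · simpa [hh0] using hu
      · rw [hh0]; exact hψ
    · simp only [hh0, Pi.single_zero, add_zero]
      exact mul_ne_zero hu0 (pow_ne_zero _ (mul_ne_zero hg0 hψ0))
    · refine (ContinuousAt.comp (g := U) ?_ hcc).mul ((hg₁.div hκ hκ0).pow _)
      rw [hc0]; exact hUc
    · rw [hc0]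
      exact mul_ne_zero hU0 (pow_ne_zero _ (div_ne_zero hg₁0 hκ0))
    · have h1 : Tendsto c (𝓝 0) (𝓝 c₀) := by
        have := hcc.tendsto
        rwa [hc0] at this
      filter_upwards [h1.eventually hUP, (hline0.comp hhc).eventually hPF, hcurve, hhg, hhg₁,
        hκ.eventually_ne hκ0] with t h2 h3 h4 h5 h6 h7
      simp only [Function.comp_apply] at h3
      have h8 : (fderiv ℂ (coneChart φ k e) (c t)).det = t ^ (m - 1) * (g₁ t / κ t) := by
        rw [← mul_div_assoc, ← h6, ← h4.2.2, mul_div_cancel_right₀ _ h7]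
      rw [h4.1, h3, hFψ, h8] at h2
      have h9 : h t * ψ (h t) = t ^ m * (g t * ψ (h t)) := by rw [← mul_assoc, ← h5]
      rw [h9] at h2
      rw [pow_mul, pow_mul]
      linear_combination h2
  -- the number of points of the fibres near `q`
  have hmb : m = b (pt z₀ hz₀) := by
    set N₁ : Set ℂ := N₀ ∩ {t | c t ∈ coneDomain φ k e ∧
      coneChart φ k e (c t) = z₀ + Pi.single l (h t) ∧ c t j = c₀ j + t} with hN₁
    have hN₁n : N₁ ∈ 𝓝 (0 : ℂ) := by
      filter_upwards [hN₀, hcO, hcurve] with t h1 h2 h3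
      exact ⟨h1, h2, h3.1, h3.2.1⟩
    -- the coordinates of points near `q` and of points of `ℂⁿ⁺¹` over them
    have hcons : ContinuousAt (fun p : M × ℂ => (Fin.cons p.2 (e p.1) : Fin (n + 1) → ℂ))
        (q, z₀ k) := by
      refine ContinuousAt.comp
        (g := fun c : ℂ × (Fin n → ℂ) => (Fin.cons c.1 c.2 : Fin (n + 1) → ℂ))
        continuous_cons.continuousAt (continuousAt_snd.prodMk ?_)
      exact ContinuousAt.comp (g := e) (e.continuousAt hqe) continuousAt_fst
    have hgood : ∀ᶠ p : M × ℂ in 𝓝 (q, z₀ k), (Fin.cons p.2 (e p.1) : Fin (n + 1) → ℂ) ∈ Ω ∧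
        (Fin.cons p.2 (e p.1) : Fin (n + 1) → ℂ) j - c₀ j ∈ N₁ := by
      refine Filter.Eventually.and (hcons.eventually_mem hΩ) ?_
      refine ContinuousAt.eventually_mem (f := fun p : M × ℂ =>
        (Fin.cons p.2 (e p.1) : Fin (n + 1) → ℂ) j - c₀ j)
        ((ContinuousAt.comp (g := fun c : Fin (n + 1) → ℂ => c j)
          (continuous_apply j).continuousAt hcons).sub continuousAt_const) ?_
      simpa [hc₀] using hN₁n
    rw [nhds_prod_eq] at hgood
    obtain ⟨A, hA, S, hS, hAS⟩ := eventually_prod_iff.1 hgood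
    obtain ⟨W, hWU, hW⟩ := hU.exists_slice q (inter_mem (e.open_source.mem_nhds hqe) hA)
    have hWn : W ∈ 𝓝 q := hW.isOpen.mem_nhds hW.mem
    set N : Set ℂ := N₁ ∩ x ⁻¹' W with hN
    have hNn : N ∈ 𝓝 (0 : ℂ) :=
      inter_mem hN₁n (hxc.preimage_mem_nhds (by rw [hx0]; exact hWn))
    have hzk : Tendsto (fun ε : ℂ => (z₀ + (Pi.single l ε : Fin (n + 1) → ℂ)) k) (𝓝 0)
        (𝓝 (z₀ k)) := ((continuous_apply k).tendsto z₀).comp hline0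
    have hev : ∀ᶠ ε in 𝓝[≠] (0 : ℂ), {t ∈ N | h t = ε}.ncard = m ∧ ε ≠ 0 ∧ ψ ε ≠ 0 ∧
        (z₀ + (Pi.single l ε : Fin (n + 1) → ℂ)) k ≠ 0 ∧
        S ((z₀ + (Pi.single l ε : Fin (n + 1) → ℂ)) k) ∧
        z₀ + Pi.single l ε ∈ cone (φ '' W) ∧
        (F (z₀ + Pi.single l ε) ≠ 0 → ∀ hz : z₀ + Pi.single l ε ≠ 0,
          b (pt (z₀ + Pi.single l ε) hz) = 1) := by
      refine (hcount N hNn fun t ht => ht.1.1).and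
        ((eventually_mem_nhdsWithin (a := (0 : ℂ))).and ?_)
      refine Filter.Eventually.filter_mono nhdsWithin_le_nhds ?_
      exact (hψ.eventually_ne hψ0).and ((hzk.eventually_ne hk).and ((hzk.eventually hS).and
        (Filter.Eventually.and (hline0.eventually (hU.cone_image_mem_nhds hWn hz₀ hqz))
          (hline0.eventually hb))))
    obtain ⟨ε, h1, h2, h3, h4, h5, ⟨h6, h7⟩, h8⟩ := hev.exists
    set z := z₀ + (Pi.single l ε : Fin (n + 1) → ℂ) with hz
    have hbz : b (pt z h6) = 1 := h8 (by rw [hFψ]; exact mul_ne_zero h2 h3) h6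
    rw [← h1, ← hqz, ← hU.ncard_fibre hW h7 hbz]
    refine Set.ncard_congr (fun t _ => x t) ?_ ?_ ?_
    · rintro t ⟨⟨ht1, ht2⟩, ht3⟩
      refine ⟨ht2, ?_⟩
      rw [hxφ t ht1.2.1]
      congr 1
      rw [ht1.2.2.1, ht3]
    · rintro t t' ⟨ht1, ht2⟩ ⟨ht1', ht2'⟩ htt
      have h9 : c t = c t' := by
        rw [← Fin.cons_self_tail (c t), ← Fin.cons_self_tail (c t'),
          ← coneChart_apply_self ht1.1.2.1, ← coneChart_apply_self ht1'.1.2.1,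
          ht1.1.2.2.1, ht1'.1.2.2.1, ht2, ht2',
          ← e.right_inv ht1.1.2.1.2.1, ← e.right_inv ht1'.1.2.1.2.1]
        rw [hx] at htt
        simp only at htt
        rw [htt]
      have h10 := ht1.1.2.2.2
      rw [h9, ht1'.1.2.2.2] at h10
      exact (add_left_cancel h10).symm
    · rintro y ⟨hy1, hy2⟩
      have h9 := hAS (hWU hy1).2 h5
      have h10 := coneChart_cons (hWU hy1).1 h6 hy2 h4
      obtain ⟨h11, h12⟩ := hinv _ h9.1 ε h10
      have h13 : x ((Fin.cons (z k) (e y) : Fin (n + 1) → ℂ) j - c₀ j) = y := by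
        simp only [hx]
        rw [h11, Fin.tail_cons, e.left_inv (hWU hy1).1]
      exact ⟨_, ⟨⟨h9.2, by rw [mem_preimage, h13]; exact hy1⟩, h12⟩, h13⟩
  rw [← hmb, mul_comm, ← horder, mul_comm]

end IsUniformization

end Weight

/-! ### Derivatives of polynomial functions -/

/-- The derivative of a polynomial function is given by the formal partial derivatives. -/
theorem hasFDerivAt_eval {m : ℕ} (p : MvPolynomial (Fin m) ℂ) (z : Fin m → ℂ) :
    HasFDerivAt (fun z => MvPolynomial.eval z p)
      (∑ l, MvPolynomial.eval z (MvPolynomial.pderiv l p) •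
        (ContinuousLinearMap.proj l : (Fin m → ℂ) →L[ℂ] ℂ)) z := by
  induction p using MvPolynomial.induction_on with
  | C a =>
    simp only [MvPolynomial.eval_C]
    refine (hasFDerivAt_const (𝕜 := ℂ) a z).congr_fderiv ?_
    ext v
    simp
  | add p q hp hq =>
    simp only [map_add]
    refine (hp.fun_add hq).congr_fderiv ?_
    ext v
    simp [add_mul, Finset.sum_add_distrib]
  | mul_X p i hp =>
    have h1 := hp.fun_mul (hasFDerivAt_apply i z)
    simp only [map_mul, MvPolynomial.eval_X]
    refine h1.congr_fderiv ?_
    ext v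
    have h2 : ∀ l, MvPolynomial.eval z (MvPolynomial.pderiv l (p * MvPolynomial.X i)) =
        MvPolynomial.eval z (MvPolynomial.pderiv l p) * z i +
          if l = i then MvPolynomial.eval z p else 0 := by
      intro l
      rw [MvPolynomial.pderiv_mul, MvPolynomial.pderiv_X, Pi.single_apply]
      by_cases hl : i = l
      · simp [hl]
      · simp [hl, Ne.symm hl]
    simp only [h2]
    simp [add_mul, Finset.sum_add_distrib, Finset.mul_sum]
    rw [add_comm]
    refine congrArg₂ _ (Finset.sum_congr rfl fun l _ => by ring) rfl

theorem fderiv_eval_single {m : ℕ} (p : MvPolynomial (Fin m) ℂ) (z : Fin m → ℂ) (l : Fin m) :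
    fderiv ℂ (fun z => MvPolynomial.eval z p) z (Pi.single l 1) =
      MvPolynomial.eval z (MvPolynomial.pderiv l p) := by
  rw [(hasFDerivAt_eval p z).fderiv]
  simp [Pi.single_apply]

end CYOrbifold

end

theorem lemma3p1 {n : ℕ} (hn : 1 ≤ n) (b : CYOrbifold.PSpace n → ℕ)
    (hb : CYOrbifold.IsCalabiYauOrbifold.{u} b) {r : ℕ}
    (F : Fin r → MvPolynomial (Fin (n + 1)) ℂ) (d : Fin r → ℕ)
    (hF : CYOrbifold.IsLocus b F d) :
    ∃ m : Fin r → ℕ, (∀ i, CYOrbifold.IsWeight b F i (m i)) ∧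
      n + 2 ≤ ∑ i, d i ∧ ∑ i, d i ≤ 2 * n + 2 ∧
      (∑ i, d i = 2 * n + 2 → ∀ i, m i = 2) := by
  obtain ⟨M, _, _, G, φ, hM, hU⟩ := hb
  obtain ⟨f, hf⟩ := hM.trivialCanonicalBundle
  have := hM.compact
  have := hU.finite_group
  have : Fintype G := Fintype.ofFinite G
  obtain ⟨P, hPhom, hP⟩ := hU.exists_ramification_polynomial hn hf
  -- the ramification polynomial vanishes exactly on the branch locus
  have hzero : ∀ z ≠ 0, MvPolynomial.eval z P = 0 ↔ ∃ i, MvPolynomial.eval z (F i) = 0 := by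
    intro z hz
    obtain ⟨k, hk⟩ : ∃ k, z k ≠ 0 := Function.ne_iff.1 hz
    obtain ⟨x, hx⟩ := hU.quotientMap.surjective (CYOrbifold.pt z hz)
    have hg : ∀ g : G, CYOrbifold.jacobian φ f k (g.1 x) = 0 ↔ b (CYOrbifold.pt z hz) ≠ 1 := by
      intro g
      rw [← hx, ← hU.map_perm g.2 x]
      refine hU.jacobian_eq_zero_iff_ne_one hf ?_
      rw [hU.map_perm g.2, hx]
      exact (CYOrbifold.pt_mem_affineChart hz).2 hk
    rw [hP x z hz k hx hk, ← hF.locus_eq z hz, Finset.prod_eq_zero_iff]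
    constructor
    · rintro ⟨g, -, h⟩
      exact (hg g).1 ((mul_eq_zero.1 h).resolve_left (pow_ne_zero _ hk))
    · intro h
      exact ⟨1, Finset.mem_univ _, by rw [(hg 1).2 h, mul_zero]⟩
  obtain ⟨c, a, hc, hPF⟩ := CYOrbifold.exists_eq_prod_pow hn hF.irreducible hzero
  have hsum := CYOrbifold.isHomogeneous_degree_eq_sum hc hF.irreducible hF.homogeneous hPF hPhom
  have hcont : ∀ p : MvPolynomial (Fin (n + 1)) ℂ, Continuous fun z => MvPolynomial.eval z p :=
    fun p => p.continuous_eval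
  have hloc : ∀ (i : Fin r) (z : Fin (n + 1) → ℂ) (hz : z ≠ 0),
      z ∈ CYOrbifold.regularPoints F i →
      Fintype.card G * (b (CYOrbifold.pt z hz) - 1) = a i * b (CYOrbifold.pt z hz) := by
    intro i z hz hreg
    obtain ⟨⟨l, hl⟩, hj⟩ := CYOrbifold.regularPoints_spec hreg
    have hne : ∀ᶠ w in nhds z, ∀ j, j ≠ i → MvPolynomial.eval w (F j) ≠ 0 :=
      Filter.eventually_all.2 fun j => by
        by_cases h : j = i
        · exact Filter.Eventually.of_forall fun w hji => absurd h hji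
        · filter_upwards [(hcont (F j)).continuousAt.eventually_ne (hj j h)] with w hw _
          exact hw
    refine hU.card_mul_isotropy_sub_one hf (P := fun z => MvPolynomial.eval z P)
      (fun x z hz k hx hk => hP x z hz k hx hk) hz (F := fun z => MvPolynomial.eval z (F i))
      (fun w => (CYOrbifold.hasFDerivAt_eval (F i) w).differentiableAt) hreg.2.1
      (l := l) (by rw [CYOrbifold.fderiv_eval_single]; exact hl) ?_
      (u := fun w => c * ∏ j ∈ Finset.univ.erase i, MvPolynomial.eval w (F j) ^ a j) ?_ ?_ ?_
    · filter_upwards [hne] with w hw hwi hw0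
      by_contra h
      obtain ⟨j, hwj⟩ := (hF.locus_eq w hw0).1 h
      by_cases hji : j = i
      · exact hwi (hji ▸ hwj)
      · exact hw j hji hwj
    · exact (continuous_const.mul
        (continuous_finsetProd _ fun j _ => (hcont (F j)).pow (a j))).continuousAt
    · exact mul_ne_zero hc (Finset.prod_ne_zero_iff.2 fun j hji =>
        pow_ne_zero _ (hj j (Finset.mem_erase.1 hji).1))
    · refine Filter.Eventually.of_forall fun w => ?_
      rw [hPF, map_mul, MvPolynomial.eval_C, map_prod,
        ← Finset.prod_erase_mul _ _ (Finset.mem_univ i)]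
      simp only [map_pow]
      ring
  have hpos : ∀ p, 1 ≤ b p := by
    intro p
    obtain ⟨x, rfl⟩ := hU.quotientMap.surjective p
    rw [hU.isotropy]
    exact Nat.card_pos
  choose z hz using fun i =>
    CYOrbifold.regularPoints_nonempty hn hF.irreducible hF.homogeneous hF.distinct i
  have hbounds := CYOrbifold.degree_bounds (N := Fintype.card G) Fintype.card_pos (a := a) (d := d)
    (m := fun i => b (CYOrbifold.pt (z i) (hz i).1))
    (fun i => CYOrbifold.degree_pos_of_irreducible (hF.irreducible i) (hF.homogeneous i))
    (fun i => by
      have h1 := (hF.locus_eq (z i) (hz i).1).2 ⟨i, (hz i).2.1⟩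
      have h2 := hpos (CYOrbifold.pt (z i) (hz i).1)
      omega)
    (fun i => hloc i (z i) (hz i).1 (hz i)) hsum
  refine ⟨fun i => b (CYOrbifold.pt (z i) (hz i).1), fun i => ⟨⟨z i, hz i⟩, ?_⟩, hbounds⟩
  intro w hw0 hw
  -- `N * (m - 1) = a * m` determines `m`
  have h1 := hloc i w hw0 hw
  have h2 := hloc i (z i) (hz i).1 (hz i)
  obtain ⟨s, hs⟩ := Nat.exists_eq_add_of_le' (hpos (CYOrbifold.pt w hw0))
  obtain ⟨t, ht⟩ := Nat.exists_eq_add_of_le' (hpos (CYOrbifold.pt (z i) (hz i).1))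
  simp only [hs, ht, Nat.add_sub_cancel] at h1 h2 ⊢
  have h3 : Fintype.card G * (s * (t + 1)) = Fintype.card G * (t * (s + 1)) := by
    linear_combination (t + 1) * h1 - (s + 1) * h2
  have h4 := Nat.eq_of_mul_eq_mul_left Fintype.card_pos h3
  rw [mul_add, mul_add, mul_comm s t] at h4
  omega
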